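/- An oriented graph $G$ is an orientation of a simple undirected graph $H$ if $G$ is obtained from $H$ by replacing each edge $\{u,v\}$ of $H$ by exactly one of the two arcs $uv$ and $vu$. An oriented $k$-colouring of $G$ is a function $c : V(G) \to \{0,1,\ldots,k-1\}$ such that (1) $c(u) \neq c(v)$ for every arc $uv$ of $G$, and (2) for all arcs $uv$ and $xy$ of $G$, if $c(u) = c(y)$ then $c(v) \neq c(x)$. The oriented chromatic number $\chi_o(G)$ is the smallest $k$ such that $G$ has an oriented $k$-colouring. Theorem. If $G$ is an orientation of a finite connected simple graph with maximum degree at most $3$, then $\chi_o(G) \leq 9$. -/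

import Mathlib

namespace Digraph

variable {V : Type*}

/-- `G` is an orientation of the simple graph `H`: it is obtained from `H` by replacing each edge
`{u, v}` by exactly one of the two arcs `uv` and `vu`. -/
structure IsOrientationOf (G : Digraph V) (H : SimpleGraph V) : Prop where
  /-- The underlying graph of `G` is `H`. -/
  adj_iff : ∀ u v, H.Adj u v ↔ G.Adj u v ∨ G.Adj v u
  /-- No edge receives both orientations. -/
  asymm : ∀ u v, G.Adj u v → ¬ G.Adj v u

/-- `c` is an oriented `k`-colouring of `G`. -/
structure IsOrientedColouring (G : Digraph V) {k : ℕ} (c : V → Fin k) : Prop where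
  /-- Adjacent vertices receive different colours. -/
  ne_of_adj : ∀ u v, G.Adj u v → c u ≠ c v
  /-- All arcs between two colour classes have the same direction. -/
  direction : ∀ u v x y, G.Adj u v → G.Adj x y → c u = c y → c v ≠ c x

/-- `G` has an oriented `k`-colouring. -/
def OrientedColourable (G : Digraph V) (k : ℕ) : Prop :=
  ∃ c : V → Fin k, G.IsOrientedColouring c

/-- The oriented chromatic number of `G`: the least `k` such that `G` has an oriented
`k`-colouring (and `⊤` if there is no such `k`). -/
noncomputable def orientedChromaticNumber (G : Digraph V) : ℕ∞ :=
  ⨅ k ∈ {k : ℕ | G.OrientedColourable k}, (k : ℕ∞)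

end Digraph

/-!
An oriented colouring with `k` colours is a homomorphism to an oriented graph on `k` vertices.  The
colourings constructed here are homomorphisms to the Paley tournament on `{0, …, 6}`, in which
`i → j` when `j - i` is a nonzero square modulo `7`, except on vertices that get one of two
additional colours.

The core of the proof is `Good.colourable`: an oriented graph of maximum degree three that has no
cubic subgraph and contains none of five small configurations (`pats`) has a homomorphism to the
Paley tournament. The proof is by induction on the number of arcs. Unless there are no arcs, some
vertex `v` has degree one or two, and only the case of a directed path through `v`, with
nonadjacent ends `a` and `b`, is not immediate. Then the graph without `v` has to be coloured so
that `a` and `b` get different colours. For this, apart from some direct cases, `a` and `v` are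
replaced by an arc between `b` and a neighbour of `a`, or between the two other neighbours of `a`,
chosen so that every colouring of the new graph extends to `a` with a colour different from that
of `b` (`Ctx.replace`). The new graph may fail to belong to the class for two reasons. If it
contains a cubic subgraph, then the old graph has a bridge, and colourings of the two sides fit
together after a rotation of the colours (`Ctx.bridge`). If it contains one of the five
configurations, then a colouring of the graph without `v` can be changed locally so that `a` and
`b` get different colours (`exists_recolouring`). This is a finite statement about each
configuration: whether a recolouring exists depends only on the colours of the few vertices around
it, and `check` verifies it for all of these colours. In one situation (`Exc`) the local change
may fail; then larger parts of the graph are known and are recoloured (`Ctx.of_linked`,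
`Ctx.of_double`).

Two additional colours reduce the theorem to this result (`exists_isCol9`).  Each of the five
configurations contains an arc from a source of degree three to a sink of degree three.  If the
graph has such arcs, or is not cubic, then remove all of them, colour the rest, and give one new
colour to the sources and the other one to the sinks of degree three.  Otherwise remove any single
arc, and give the new colours to its ends.  Connectedness guarantees that no cubic subgraph is
left.
-/

namespace OrientedCubic

/-! ### The Paley tournament on seven vertices -/

/-- The bit of the number `m` at the position `c`. -/
def bit (m c : ℕ) : Bool := Nat.beq (Nat.land (Nat.shiftRight m c) 1) 1

/-- The out-neighbours of `i` in the Paley tournament on `{0, …, 6}`, as a bit mask.  The number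
`22 = 2 ^ 1 + 2 ^ 2 + 2 ^ 4` encodes the nonzero squares modulo `7`; it is rotated by `i`. -/
def outMask (i : ℕ) : ℕ :=
  Nat.land 127 (Nat.lor (Nat.shiftLeft 22 i) (Nat.shiftRight (Nat.shiftLeft 22 i) 7))

/-- The in-neighbours of `i` in the Paley tournament on `{0, …, 6}`, as a bit mask. -/
def inMask (i : ℕ) : ℕ :=
  Nat.land 127 (Nat.lor (Nat.shiftLeft 104 i) (Nat.shiftRight (Nat.shiftLeft 104 i) 7))

/-- The vertices of the Paley tournament that differ from `i`, as a bit mask. -/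
def neMask (i : ℕ) : ℕ := Nat.xor 127 (Nat.shiftLeft 1 i)

/-- The arcs of the Paley tournament: `i → j` when `j - i` is a nonzero square modulo `7`. -/
def adj (i j : ℕ) : Bool := bit (outMask i) j

theorem bit_land (m n c : ℕ) : bit (Nat.land m n) c = (bit m c && bit n c) := by
  have h : ∀ m, bit m c = m.testBit c := by
    intro m
    have e : Nat.land (Nat.shiftRight m c) 1 = (m >>> c) &&& 1 := rfl
    rw [bit, e, Nat.testBit, Nat.and_comm]
    have : 1 &&& (m >>> c) = 0 ∨ 1 &&& (m >>> c) = 1 := by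
      rw [Nat.and_comm, Nat.and_one_is_mod]; omega
    rcases this with h | h <;> rw [h] <;> rfl
  rw [h, h, h]
  exact Nat.testBit_land m n c

theorem bit_inMask : ∀ i < 7, ∀ j < 7, bit (inMask i) j = adj j i := by decide

theorem bit_neMask : ∀ i < 7, ∀ j < 7, bit (neMask i) j = !(Nat.beq j i) := by decide

theorem bit_full : ∀ i < 7, bit 127 i = true := by decide

theorem adj_rotate : ∀ i < 7, ∀ j < 7, ∀ k < 7,
    adj ((i + k) % 7) ((j + k) % 7) = adj i j := by decide

theorem adj_asymm : ∀ i < 7, ∀ j < 7, adj i j = true → adj j i = false := by decide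

/-! ### Exhaustive search for local extensions

The functions of this section are defined through recursors and bit masks so that the kernel
evaluates them quickly. -/

/-- Membership in a list of numbers. -/
noncomputable def memR (v : ℕ) (l : List ℕ) : Bool :=
  List.rec false (fun h _ ih => bif Nat.beq h v then true else ih) l

/-- The neighbours of `v` in `pre` along the arcs in `L`, with a flag for the arcs into `v`. -/
noncomputable def consL (L : List (ℕ × ℕ)) (v : ℕ) (pre : List ℕ) : List (Bool × ℕ) :=
  List.rec [] (fun a _ ih =>
    bif Nat.beq a.1 v && memR a.2 pre then (false, a.2) :: ih
    else bif Nat.beq a.2 v && memR a.1 pre then (true, a.1) :: ih else ih) L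

/-- The colours in the mask `ini` that obey the constraints `cs` under the colouring `e`. -/
noncomputable def domR (cs : List (Bool × ℕ)) (ini : ℕ) (e : ℕ → ℕ) : ℕ :=
  List.rec ini (fun p _ ih => Nat.land (bif p.1 then outMask (e p.2) else inMask (e p.2)) ih) cs

/-- The colours of `v` allowed by the requirement that the indices `ne.1` and `ne.2` get
different colours. -/
noncomputable def ini (ne : ℕ × ℕ) (v : ℕ) (pre : List ℕ) (e : ℕ → ℕ) : ℕ :=
  bif Nat.beq ne.1 v && memR ne.2 pre then neMask (e ne.2) else
  bif Nat.beq ne.2 v && memR ne.1 pre then neMask (e ne.1) else 127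

/-- The colours that the index `v` may get, given the colours `e` of the indices in `pre`. -/
noncomputable def dom (L : List (ℕ × ℕ)) (ne : ℕ × ℕ) (v : ℕ) (pre : List ℕ) (e : ℕ → ℕ) : ℕ :=
  domR (consL L v pre) (ini ne v pre e) e

/-- Apply `f` for all colours in the mask `m` in turn. -/
noncomputable def gather (f : ℕ → List (List ℕ) → List (List ℕ)) (m : ℕ)
    (acc : List (List ℕ)) : List (List ℕ) :=
  let g := fun c acc => bif bit m c then f c acc else acc
  g 0 (g 1 (g 2 (g 3 (g 4 (g 5 (g 6 acc))))))

/-- Extend the colouring `e` of the indices in `pre` to the indices in `vs` in all possible ways,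
and list the sets of colours that each extension leaves for the indices in `ts`. -/
noncomputable def run (L : List (ℕ × ℕ)) (ne : ℕ × ℕ) (ts : List ℕ) (vs : List ℕ) :
    List ℕ → (ℕ → ℕ) → List (List ℕ) → List (List ℕ) :=
  List.rec
    (fun pre e acc => List.rec [] (fun t _ ih => dom L ne t pre e :: ih) ts :: acc)
    (fun v _ ih pre e acc =>
      gather (fun c acc => ih (v :: pre) (fun i => bif Nat.beq i v then c else e i) acc)
        (dom L ne v pre e) acc) vs

/-- Keep the lists whose head mask contains `c`, and drop the heads. -/
noncomputable def step (c : ℕ) (ls : List (List ℕ)) : List (List ℕ) :=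
  List.rec [] (fun l _ ih => List.rec ih (fun m ms _ => bif bit m c then ms :: ih else ih) l) ls

/-- The members of `good` and `all` are lists of `n` masks, read as products of sets of colours.
Every tuple of `n` colours in the union of `all` is in the union of `good`.  The flag `z` exempts
the constant tuple `0`. -/
noncomputable def cover (n : ℕ) : Bool → List (List ℕ) → List (List ℕ) → Bool :=
  Nat.rec (fun z good all => z || !good.isEmpty || all.isEmpty)
    (fun _ ih z good all =>
      let g := fun c => ih (z && Nat.beq c 0) (step c good) (step c all)
      g 0 && (g 1 && (g 2 && (g 3 && (g 4 && (g 5 && g 6)))))) n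

/-- The recolouring test for a configuration with arcs `L`, internal indices `vs` and terminals
`6 :: ts`: a colouring of the terminals with `6` coloured `0` that extends to the internal indices
has such an extension in which the indices `0` and `b` get different colours. -/
noncomputable def check (z : Bool) (L : List (ℕ × ℕ)) (b : ℕ) (vs ts : List ℕ) : Bool :=
  cover ts.length z (run L (0, b) ts vs [6] (fun _ => 0) [])
    (run L (0, 0) ts vs [6] (fun _ => 0) [])

theorem natBeq_eq (i j : ℕ) : Nat.beq i j = decide (i = j) := by
  cases h : Nat.beq i j
  · exact (decide_eq_false (Nat.ne_of_beq_eq_false h)).symm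
  · exact (decide_eq_true (Nat.eq_of_beq_eq_true h)).symm

theorem memR_iff (v : ℕ) (l : List ℕ) : memR v l = true ↔ v ∈ l := by
  induction l with
  | nil => simp [memR]
  | cons h t ih =>
    have e : memR v (h :: t) = bif Nat.beq h v then true else memR v t := rfl
    rw [e]
    by_cases hv : h = v
    · subst hv; simp
    · rw [natBeq_eq, decide_eq_false hv, cond_false, ih]
      simp [Ne.symm hv]

theorem memR_eq (v : ℕ) (l : List ℕ) : memR v l = decide (v ∈ l) := by
  by_cases h : v ∈ l
  · simp [h, (memR_iff v l).2 h]
  · have : ¬ memR v l = true := fun h' => h ((memR_iff v l).1 h')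
    simp [h, this]

/-- The constraint between the colour `c` of `v` and the colour `d` of `w`. -/
def PairOk (L : List (ℕ × ℕ)) (ne : ℕ × ℕ) (v c w d : ℕ) : Prop :=
  ((v, w) ∈ L → adj c d = true) ∧ ((w, v) ∈ L → adj d c = true) ∧
    (v ≠ w → (ne = (v, w) ∨ ne = (w, v)) → c ≠ d)

theorem bit_domR (cs : List (Bool × ℕ)) (m : ℕ) (e : ℕ → ℕ) (c : ℕ) (hc : c < 7)
    (he : ∀ p ∈ cs, e p.2 < 7) :
    bit (domR cs m e) c = true ↔ bit m c = true ∧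
      ∀ p ∈ cs, (if p.1 then adj (e p.2) c else adj c (e p.2)) = true := by
  induction cs with
  | nil => simp [domR]
  | cons p cs ih =>
    have e1 : domR (p :: cs) m e =
      Nat.land (bif p.1 then outMask (e p.2) else inMask (e p.2)) (domR cs m e) := rfl
    rw [e1, bit_land, Bool.and_eq_true, ih fun q hq => he q (List.mem_cons_of_mem _ hq)]
    have hp := he p List.mem_cons_self
    have e2 : bit (bif p.1 then outMask (e p.2) else inMask (e p.2)) c =
        (if p.1 then adj (e p.2) c else adj c (e p.2)) := by
      cases p.1
      · simpa using bit_inMask _ hp _ hc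
      · simp [adj]
    rw [e2]
    simp only [List.forall_mem_cons]
    tauto

theorem mem_consL (L : List (ℕ × ℕ)) (v : ℕ) (pre : List ℕ) (hv : v ∉ pre) (p : Bool × ℕ) :
    p ∈ consL L v pre ↔ p.2 ∈ pre ∧ (if p.1 then (p.2, v) ∈ L else (v, p.2) ∈ L) := by
  induction L with
  | nil => simp [consL]
  | cons a L ih =>
    have e1 : consL (a :: L) v pre =
      bif Nat.beq a.1 v && memR a.2 pre then (false, a.2) :: consL L v pre
      else bif Nat.beq a.2 v && memR a.1 pre then (true, a.1) :: consL L v pre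
        else consL L v pre := rfl
    obtain ⟨x, y⟩ := a
    obtain ⟨f, w⟩ := p
    rw [e1, natBeq_eq, natBeq_eq, memR_eq, memR_eq]
    by_cases hx : x = v ∧ y ∈ pre
    · have hy : y ≠ v := fun h => hv (h ▸ hx.2)
      cases f
      · simp only [hx.1, hx.2, decide_true, Bool.and_self, cond_true, List.mem_cons, ih]
        simp; grind
      · simp only [hx.1, hx.2, decide_true, Bool.and_self, cond_true, List.mem_cons, ih]
        simp; grind
    · by_cases hy : y = v ∧ x ∈ pre
      · cases f <;> simp [hy] <;> grind
      · cases f <;> simp <;> grind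

theorem bit_dom (L : List (ℕ × ℕ)) (ne : ℕ × ℕ) (v : ℕ) (pre : List ℕ) (e : ℕ → ℕ) (c : ℕ)
    (hv : v ∉ pre) (hc : c < 7) (he : ∀ w ∈ pre, e w < 7) :
    bit (dom L ne v pre e) c = true ↔ ∀ w ∈ pre, PairOk L ne v c w (e w) := by
  rw [dom, bit_domR _ _ _ _ hc fun p hp => he _ ((mem_consL L v pre hv p).1 hp).1]
  have h1 : bit (ini ne v pre e) c = true ↔
      ∀ w ∈ pre, (ne = (v, w) ∨ ne = (w, v)) → c ≠ e w := by
    obtain ⟨x, y⟩ := ne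
    simp only [ini, natBeq_eq, memR_eq]
    by_cases hx : x = v ∧ y ∈ pre
    · simp only [hx.1, hx.2, decide_true, Bool.and_self, cond_true]
      rw [bit_neMask _ (he y hx.2) _ hc, natBeq_eq]
      simp
      grind
    · by_cases hy : y = v ∧ x ∈ pre
      · have : (decide (x = v) && decide (y ∈ pre)) = false := by simpa using hx
        rw [this]
        simp only [hy.1, hy.2, decide_true, Bool.and_self, cond_true, cond_false]
        rw [bit_neMask _ (he x hy.2) _ hc, natBeq_eq]
        simp
        grind
      · have h1 : (decide (x = v) && decide (y ∈ pre)) = false := by simpa using hx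
        have h2 : (decide (y = v) && decide (x ∈ pre)) = false := by simpa using hy
        simp only [h1, h2, cond_false, bit_full c hc, true_iff]
        grind
  rw [h1]
  constructor
  · rintro ⟨h, h'⟩ w hw
    refine ⟨fun hL => ?_, fun hL => ?_, fun _ => h w hw⟩
    · have := h' (false, w) ((mem_consL L v pre hv _).2 ⟨hw, by simpa using hL⟩)
      simpa using this
    · have := h' (true, w) ((mem_consL L v pre hv _).2 ⟨hw, by simpa using hL⟩)
      simpa using this
  · intro h
    refine ⟨fun w hw => (h w hw).2.2 fun h => hv (h ▸ hw), ?_⟩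
    rintro ⟨f, w⟩ hp
    obtain ⟨hw, hL⟩ := (mem_consL L v pre hv _).1 hp
    cases f
    · simpa using (h w hw).1 (by simpa using hL)
    · simpa using (h w hw).2.1 (by simpa using hL)

/-- The colouring `g` of the indices in `vs` extends its restriction to `pre` correctly. -/
def Ext (L : List (ℕ × ℕ)) (ne : ℕ × ℕ) (g : ℕ → ℕ) : List ℕ → List ℕ → Prop
  | _, [] => True
  | pre, v :: vs => g v < 7 ∧ (∀ w ∈ pre, PairOk L ne v (g v) w (g w)) ∧ Ext L ne g (v :: pre) vs

theorem mem_gather (f : ℕ → List (List ℕ) → List (List ℕ)) (m : ℕ) (acc : List (List ℕ))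
    (l : List ℕ) (P : ℕ → Prop)
    (hf : ∀ c < 7, bit m c = true → ∀ acc, l ∈ f c acc ↔ P c ∨ l ∈ acc) :
    l ∈ gather f m acc ↔ (∃ c < 7, bit m c = true ∧ P c) ∨ l ∈ acc := by
  have key : ∀ c < 7, ∀ acc, l ∈ (bif bit m c then f c acc else acc) ↔
      (bit m c = true ∧ P c) ∨ l ∈ acc := by
    intro c hc acc
    cases h : bit m c
    · simp
    · simp [hf c hc h]
  simp only [gather]
  rw [key 0 (by omega), key 1 (by omega), key 2 (by omega), key 3 (by omega), key 4 (by omega),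
    key 5 (by omega), key 6 (by omega)]
  have : (∃ c < 7, bit m c = true ∧ P c) ↔ (bit m 0 = true ∧ P 0) ∨ (bit m 1 = true ∧ P 1) ∨
      (bit m 2 = true ∧ P 2) ∨ (bit m 3 = true ∧ P 3) ∨ (bit m 4 = true ∧ P 4) ∨
      (bit m 5 = true ∧ P 5) ∨ (bit m 6 = true ∧ P 6) := by
    constructor
    · rintro ⟨c, hc, h⟩
      interval_cases c <;> simp only [h, and_self, true_or, or_true]
    · rintro (h | h | h | h | h | h | h)
      exacts [⟨0, by omega, h⟩, ⟨1, by omega, h⟩, ⟨2, by omega, h⟩, ⟨3, by omega, h⟩,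
        ⟨4, by omega, h⟩, ⟨5, by omega, h⟩, ⟨6, by omega, h⟩]
  rw [this]
  simp only [or_assoc]

theorem dom_congr (L : List (ℕ × ℕ)) (ne : ℕ × ℕ) (v : ℕ) (pre : List ℕ) (e g : ℕ → ℕ)
    (hv : v ∉ pre) (h : ∀ w ∈ pre, g w = e w) : dom L ne v pre g = dom L ne v pre e := by
  have h1 : ini ne v pre g = ini ne v pre e := by
    have : ∀ i, memR i pre = true → g i = e i := fun i hi => h i ((memR_iff i pre).1 hi)
    simp only [ini]
    cases h1 : memR ne.2 pre <;> cases h2 : memR ne.1 pre <;> simp_all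
  have h2 : ∀ cs : List (Bool × ℕ), (∀ p ∈ cs, p.2 ∈ pre) → ∀ m, domR cs m g = domR cs m e := by
    intro cs
    induction cs with
    | nil => intros; rfl
    | cons p cs ih =>
      intro hp m
      have e1 : ∀ e, domR (p :: cs) m e =
        Nat.land (bif p.1 then outMask (e p.2) else inMask (e p.2)) (domR cs m e) := fun _ => rfl
      rw [e1, e1, ih (fun q hq => hp q (List.mem_cons_of_mem _ hq)), h _ (hp p List.mem_cons_self)]
  rw [dom, dom, h1, h2 _ fun p hp => ((mem_consL L v pre hv p).1 hp).1]

/-- The search `run` lists exactly the sets of colours left for the indices in `ts` by the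
extensions of the colouring `e` to the indices in `vs`. -/
theorem mem_run (L : List (ℕ × ℕ)) (ne : ℕ × ℕ) (ts : List ℕ) (vs : List ℕ) (l : List ℕ) :
    ∀ (pre : List ℕ) (e : ℕ → ℕ) (acc : List (List ℕ)), (∀ w ∈ pre, e w < 7) →
      (vs ++ pre).Nodup → (∀ t ∈ ts, t ∉ vs ∧ t ∉ pre) →
      (l ∈ run L ne ts vs pre e acc ↔
        (∃ g : ℕ → ℕ, (∀ w ∈ pre, g w = e w) ∧ Ext L ne g pre vs ∧
          l = ts.map fun t => dom L ne t (vs.reverse ++ pre) g) ∨ l ∈ acc) := by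
  induction vs with
  | nil =>
    intro pre e acc he hn ht
    have e1 : run L ne ts [] pre e acc = (ts.map fun t => dom L ne t pre e) :: acc := by
      have : ∀ ts : List ℕ, (List.rec [] (fun t _ ih => dom L ne t pre e :: ih) ts : List ℕ) =
          ts.map fun t => dom L ne t pre e := by
        intro ts
        induction ts with
        | nil => rfl
        | cons t ts ih => simp [ih]
      change _ :: acc = _
      rw [this]
    rw [e1, List.mem_cons]
    refine or_congr ⟨fun h => ⟨e, fun _ _ => rfl, trivial, h⟩, ?_⟩ Iff.rfl
    rintro ⟨g, hg, -, rfl⟩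
    refine List.map_congr_left fun t htt => ?_
    exact dom_congr L ne t pre e g (ht t htt).2 hg
  | cons v vs ih =>
    intro pre e acc he hn ht
    have e1 : run L ne ts (v :: vs) pre e acc =
      gather (fun c acc => run L ne ts vs (v :: pre) (fun i => bif Nat.beq i v then c else e i) acc)
        (dom L ne v pre e) acc := rfl
    have hv : v ∉ pre := by
      intro h; simp at hn; exact hn.1.2 h
    rw [e1, mem_gather (P := fun c => ∃ g : ℕ → ℕ,
      (∀ w ∈ v :: pre, g w = bif Nat.beq w v then c else e w) ∧ Ext L ne g (v :: pre) vs ∧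
          l = ts.map fun t => dom L ne t (vs.reverse ++ (v :: pre)) g)]
    · refine or_congr ?_ Iff.rfl
      constructor
      · rintro ⟨c, hc, hb, g, hg, hE, hl⟩
        have hgv : g v = c := by simpa [natBeq_eq] using hg v List.mem_cons_self
        have hgp : ∀ w ∈ pre, g w = e w := by
          intro w hw
          have hwv : w ≠ v := fun h => hv (h ▸ hw)
          simpa [natBeq_eq, hwv] using hg w (List.mem_cons_of_mem _ hw)
        refine ⟨g, hgp, ⟨hgv ▸ hc, ?_, hE⟩, by simpa using hl⟩
        intro w hw
        rw [hgp w hw, hgv]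
        exact (bit_dom L ne v pre e c hv hc he).1 hb w hw
      · rintro ⟨g, hg, ⟨hc, hp, hE⟩, hl⟩
        refine ⟨g v, hc, (bit_dom L ne v pre e _ hv hc he).2 ?_, g, ?_, hE, by simpa using hl⟩
        · intro w hw
          rw [← hg w hw]; exact hp w hw
        · intro w hw
          by_cases hwv : w = v
          · simp [hwv]
          · rw [natBeq_eq]
            simp [hwv, hg w (by simpa [hwv] using hw)]
    · intro c hc _ acc
      refine ih (v :: pre) _ acc ?_ ?_ ?_
      · intro w hw
        rw [natBeq_eq]
        by_cases hwv : w = v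
        · simpa [hwv] using hc
        · simpa [hwv] using he w (by simpa [hwv] using hw)
      · exact (List.perm_middle.nodup_iff).2 hn
      · intro t htt
        have := ht t htt
        simp only [List.mem_cons, not_or] at this ⊢
        tauto

theorem mem_step (c : ℕ) (ls : List (List ℕ)) (ms : List ℕ) :
    ms ∈ step c ls ↔ ∃ m, bit m c = true ∧ (m :: ms) ∈ ls := by
  induction ls with
  | nil => simp [step]
  | cons l ls ih =>
    cases l with
    | nil =>
      have : step c ([] :: ls) = step c ls := rfl
      simp [this, ih]
    | cons m0 ms0 =>
      have : step c ((m0 :: ms0) :: ls) = bif bit m0 c then ms0 :: step c ls else step c ls := rfl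
      rw [this]
      cases h : bit m0 c
      · simp only [cond_false, ih, List.mem_cons, List.cons.injEq]
        grind
      · simp only [cond_true, ih, List.mem_cons, List.cons.injEq]
        grind

theorem cover_spec (n : ℕ) : ∀ (z : Bool) (good all : List (List ℕ)), cover n z good all = true →
    ∀ tc : List ℕ, tc.length = n → (∀ c ∈ tc, c < 7) → (z = true → ∃ c ∈ tc, c ≠ 0) →
      (∃ l ∈ all, List.Forall₂ (fun m c => bit m c = true) l tc) →
      ∃ l ∈ good, ∃ l', List.Forall₂ (fun m c => bit m c = true) l' tc ∧ ∃ r, l = l' ++ r := by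
  induction n with
  | zero =>
    intro z good all h tc hn htc hz hall
    have h' : (z || !good.isEmpty || all.isEmpty) = true := h
    obtain rfl : tc = [] := List.length_eq_zero_iff.1 hn
    obtain ⟨l, hl, hF⟩ := hall
    have hz' : z = false := by
      cases z
      · rfl
      · simpa using hz rfl
    have : good ≠ [] := by
      rintro rfl
      cases all
      · simp at hl
      · simp [hz'] at h'
    obtain ⟨g, hg⟩ := List.exists_mem_of_ne_nil _ this
    exact ⟨g, hg, [], List.Forall₂.nil, g, rfl⟩
  | succ n ih =>
    intro z good all h tc hn htc hz hall
    obtain ⟨c, tc, rfl⟩ : ∃ c tc', tc = c :: tc' := by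
      cases tc
      · simp at hn
      · exact ⟨_, _, rfl⟩
    have hc : c < 7 := htc c List.mem_cons_self
    have h1 : cover n (z && Nat.beq c 0) (step c good) (step c all) = true := by
      have e : cover (n + 1) z good all =
        (cover n (z && Nat.beq 0 0) (step 0 good) (step 0 all) &&
        (cover n (z && Nat.beq 1 0) (step 1 good) (step 1 all) &&
        (cover n (z && Nat.beq 2 0) (step 2 good) (step 2 all) &&
        (cover n (z && Nat.beq 3 0) (step 3 good) (step 3 all) &&
        (cover n (z && Nat.beq 4 0) (step 4 good) (step 4 all) &&
        (cover n (z && Nat.beq 5 0) (step 5 good) (step 5 all) &&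
        cover n (z && Nat.beq 6 0) (step 6 good) (step 6 all))))))) := rfl
      rw [e] at h
      simp only [Bool.and_eq_true] at h
      interval_cases c <;> tauto
    obtain ⟨l, hl, hF⟩ := hall
    obtain ⟨m, ms, rfl⟩ : ∃ m ms, l = m :: ms := by
      cases hF; exact ⟨_, _, rfl⟩
    rw [List.forall₂_cons] at hF
    obtain ⟨l1, hl1, l', hF', r, rfl⟩ := ih _ _ _ h1 tc (by simpa using hn)
      (fun d hd => htc d (List.mem_cons_of_mem _ hd)) (by
        intro hzc
        simp only [Bool.and_eq_true] at hzc
        obtain ⟨d, hd, hd0⟩ := hz hzc.1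
        have hc0 : c = 0 := by simpa using hzc.2
        rcases List.mem_cons.1 hd with rfl | hd
        · exact absurd hc0 hd0
        · exact ⟨d, hd, hd0⟩) ⟨ms, (mem_step c all ms).2 ⟨m, hF.1, hl⟩, hF.2⟩
    obtain ⟨m', hm', hl'⟩ := (mem_step c good _).1 hl1
    exact ⟨_, hl', m' :: l', List.Forall₂.cons hm' hF', r, rfl⟩

theorem ext_pairs (L : List (ℕ × ℕ)) (ne : ℕ × ℕ) (g : ℕ → ℕ) (vs : List ℕ) :
    ∀ pre, Ext L ne g pre vs ↔ (∀ v ∈ vs, g v < 7) ∧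
      (∀ v ∈ vs, ∀ w ∈ pre, PairOk L ne v (g v) w (g w)) ∧
      vs.Pairwise fun v w => PairOk L ne w (g w) v (g v) := by
  induction vs with
  | nil => intro pre; simp [Ext]
  | cons v vs ih =>
    intro pre
    simp only [Ext, ih, List.forall_mem_cons, List.pairwise_cons]
    constructor
    · rintro ⟨h1, h2, h3, h4, h5⟩
      exact ⟨⟨h1, h3⟩, ⟨h2, fun w hw => (h4 w hw).2⟩, fun w hw => (h4 w hw).1, h5⟩
    · rintro ⟨⟨h1, h3⟩, ⟨h2, h4⟩, h5, h6⟩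
      exact ⟨h1, h2, h3, fun w hw => ⟨h5 w hw, h4 w hw⟩, h6⟩

theorem PairOk.symm {L : List (ℕ × ℕ)} {ne : ℕ × ℕ} {v c w d : ℕ} (h : PairOk L ne v c w d) :
    PairOk L ne w d v c :=
  ⟨h.2.1, h.1, fun h1 h2 h3 => h.2.2 (Ne.symm h1) h2.symm h3.symm⟩

/-- Correctness of the recolouring test.  The colour `0` of the terminal `6` is no restriction, as
colours can be rotated. -/
theorem check_spec {z : Bool} {L : List (ℕ × ℕ)} {b : ℕ} {vs ts : List ℕ}
    (h : check z L b vs ts = true) (hn : (6 :: (vs ++ ts)).Nodup)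
    (h0 : 0 ∈ vs) (hb : b ∈ 6 :: (vs ++ ts)) (hb0 : b ≠ 0)
    (g : ℕ → ℕ) (hg : ∀ i ∈ 6 :: (vs ++ ts), g i < 7) (hg6 : g 6 = 0)
    (hgL : ∀ p ∈ L, adj (g p.1) (g p.2) = true) (hz : z = true → ∃ t ∈ ts, g t ≠ 0) :
    ∃ g' : ℕ → ℕ, (∀ i, i ∉ vs → g' i = g i) ∧ (∀ v ∈ vs, g' v < 7) ∧ g' 0 ≠ g' b ∧
      ∀ p ∈ L, p.1 ∈ 6 :: (vs ++ ts) → p.2 ∈ 6 :: (vs ++ ts) → adj (g' p.1) (g' p.2) = true := by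
  have hn6 : ∀ i ∈ vs ++ ts, i ≠ 6 := by
    intro i hi h6; rw [List.nodup_cons] at hn; exact hn.1 (h6 ▸ hi)
  have hnd : (vs ++ ts).Nodup := (List.nodup_cons.1 hn).2
  have hdis : ∀ t ∈ ts, t ∉ vs := by
    intro t ht hv
    exact (List.nodup_append.1 hnd).2.2 t hv t ht rfl
  have hpre : ∀ w ∈ [6], (fun _ : ℕ => 0) w < 7 := by simp
  have hn1 : (vs ++ [6]).Nodup := by
    rw [List.nodup_append]
    refine ⟨(List.nodup_append.1 hnd).1, by simp, ?_⟩
    intro a ha b hb hab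
    simp at hb; subst hb
    exact hn6 a (List.mem_append_left _ ha) hab
  have ht1 : ∀ t ∈ ts, t ∉ vs ∧ t ∉ [6] := fun t ht =>
    ⟨hdis t ht, by simpa using hn6 t (List.mem_append_right _ ht)⟩
  have hpair : ∀ v w, PairOk L (0, 0) v (g v) w (g w) := by
    intro v w
    refine ⟨fun hL => hgL _ hL, fun hL => hgL _ hL, fun hvw hh => ?_⟩
    rcases hh with hh | hh <;> simp only [Prod.mk.injEq] at hh <;> omega
  have htp : ∀ t ∈ ts, t ∉ vs.reverse ++ [6] := by
    intro t ht; simpa using ht1 t ht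
  have hall : ∃ l ∈ run L (0, 0) ts vs [6] (fun _ => 0) [],
      List.Forall₂ (fun m c => bit m c = true) l (ts.map g) := by
    refine ⟨ts.map fun t => dom L (0, 0) t (vs.reverse ++ [6]) g, ?_, ?_⟩
    · rw [mem_run _ _ _ _ _ _ _ _ hpre hn1 ht1]
      refine Or.inl ⟨g, by simpa using hg6, ?_, rfl⟩
      rw [ext_pairs]
      exact ⟨fun v hv => hg v (by simp [hv]), fun v _ w _ => hpair v w,
        List.pairwise_of_forall fun v w => hpair w v⟩
    · rw [List.forall₂_map_left_iff, List.forall₂_map_right_iff, List.forall₂_same]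
      intro t ht
      refine (bit_dom L _ t _ g _ (htp t ht) (hg t (by simp [ht])) ?_).2 fun w _ => hpair t w
      intro w hw
      refine hg w ?_
      simp at hw ⊢; tauto
  obtain ⟨l, hl, l', hF, r, rfl⟩ := cover_spec _ _ _ _ h (ts.map g) (by simp)
    (by simpa using fun t ht => hg t (by simp [ht])) (by simpa using hz) hall
  rw [mem_run _ _ _ _ _ _ _ _ hpre hn1 ht1] at hl
  obtain ⟨f, hf6, hE, hl⟩ | hl := hl
  swap
  · simp at hl
  obtain rfl : r = [] := by
    have h1 := congrArg List.length hl
    have h2 := hF.length_eq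
    simp at h1 h2
    exact List.length_eq_zero_iff.1 (by omega)
  rw [List.append_nil] at hl
  subst hl
  rw [ext_pairs] at hE
  obtain ⟨hf7, hfp, hfq⟩ := hE
  rw [List.forall₂_map_left_iff, List.forall₂_map_right_iff, List.forall₂_same] at hF
  have hf0 : f 6 = 0 := hf6 6 (by simp)
  have hfpre : ∀ w ∈ vs.reverse ++ [6], f w < 7 := by
    intro w hw
    simp at hw
    rcases hw with hw | rfl
    · exact hf7 w hw
    · omega
  have hft : ∀ t ∈ ts, ∀ w ∈ vs.reverse ++ [6], PairOk L (0, b) t (g t) w (f w) := by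
    intro t ht
    exact (bit_dom L _ t _ f _ (htp t ht) (hg t (by simp [ht])) hfpre).1 (hF t ht)
  have hvv : ∀ v ∈ vs, ∀ w ∈ vs, v ≠ w → PairOk L (0, b) v (f v) w (f w) := by
    intro v hv w hw hne
    have : Std.Symm fun v w => PairOk L (0, b) w (f w) v (f v) := ⟨fun _ _ h => h.symm⟩
    exact (List.Pairwise.forall hfq hv hw hne).symm
  refine ⟨fun i => if i ∈ vs then f i else g i, fun i hi => by simp [hi],
    fun v hv => by simpa [hv] using hf7 v hv, ?_, ?_⟩
  · have h00 : (if 0 ∈ vs then f 0 else g 0) = f 0 := by simp [h0]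
    simp only [h00]
    by_cases hbv : b ∈ vs
    · simp only [hbv, if_true]
      exact (hvv 0 h0 b hbv hb0.symm).2.2 hb0.symm (Or.inl rfl)
    · simp only [hbv, if_false]
      simp only [List.mem_cons, List.mem_append, hbv, false_or] at hb
      rcases hb with rfl | hbt
      · have := (hfp 0 h0 6 (by simp)).2.2 hb0.symm (Or.inl rfl)
        rw [hg6]
        rwa [hf0] at this
      · exact ((hft b hbt 0 (by simp [h0])).2.2 hb0 (Or.inr rfl)).symm
  · rintro ⟨v, w⟩ hp hv hw
    simp only [List.mem_cons, List.mem_append] at hv hw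
    have key : ∀ i, i = 6 ∨ i ∈ ts → (if i ∈ vs then f i else g i) = g i := by
      intro i hi
      have : i ∉ vs := by
        rcases hi with rfl | hi
        · intro h6; exact hn6 6 (List.mem_append_left _ h6) rfl
        · exact hdis i hi
      simp [this]
    have hloop : v ≠ w := by
      rintro rfl
      have := hgL _ hp
      have h7 : g v < 7 := hg v (by simp; tauto)
      have := adj_asymm _ h7 _ h7 this
      simp_all
    by_cases hv' : v ∈ vs <;> by_cases hw' : w ∈ vs
    · simpa [hv', hw'] using (hvv v hv' w hw' hloop).1 hp
    · simp only [hv', hw', if_true, if_false]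
      have hw2 : w = 6 ∨ w ∈ ts := by tauto
      rcases hw2 with rfl | hw2
      · have := (hfp v hv' 6 (by simp)).1 hp
        rwa [hf0, ← hg6] at this
      · exact (hft w hw2 v (by simp [hv'])).2.1 hp
    · simp only [hv', hw', if_true, if_false]
      have hv2 : v = 6 ∨ v ∈ ts := by tauto
      rcases hv2 with rfl | hv2
      · have := (hfp w hw' 6 (by simp)).2.1 hp
        rwa [hf0, ← hg6] at this
      · exact (hft v hv2 w (by simp [hw'])).1 hp
    · simp only [hv', hw', if_false]
      exact hgL _ hp

/-! ### The five excluded configurations -/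

/-- A small configuration with arcs `arcs`.  The indices `1, …, k - 1` are its internal vertices,
the indices `6` and `7` are its terminals, which may coincide.  Internal vertices `1, …, 4` have
degree three.  The list `ord` contains the index `0` and all internal ones, in the order in which
they are coloured in exhaustive searches. -/
structure Pat where
  /-- The internal vertices are `1, …, k - 1`. -/
  k : ℕ
  /-- The arcs of the configuration. -/
  arcs : List (ℕ × ℕ)
  /-- The indices below `k`, in the order of colouring. -/
  ord : List ℕ

/-- The excluded configurations: a diamond, and four configurations that contain the orientation
`{1, 2} → {3, 4}` of a four-cycle.  The list is closed under reversal of all arcs. -/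
def pats : List Pat :=
  [⟨5, [(1, 2), (1, 3), (1, 4), (2, 4), (3, 4), (2, 6), (7, 3)], [2, 1, 3, 4, 0]⟩,
   ⟨5, [(1, 3), (1, 4), (2, 3), (2, 4), (1, 2), (3, 6), (7, 4)], [3, 1, 4, 2, 0]⟩,
   ⟨5, [(1, 3), (1, 4), (2, 3), (2, 4), (3, 4), (1, 6), (7, 2)], [1, 3, 2, 4, 0]⟩,
   ⟨6, [(1, 3), (1, 4), (2, 3), (2, 4), (1, 5), (5, 2), (3, 6), (7, 4)], [3, 2, 4, 1, 5, 0]⟩,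
   ⟨6, [(1, 3), (1, 4), (2, 3), (2, 4), (3, 5), (5, 4), (1, 6), (7, 2)], [1, 3, 2, 4, 5, 0]⟩]

/-- The ways to attach the vertex `0` to a configuration from which the arc `(x, y)` is deleted:
the new arcs, and the index whose colour has to differ from that of `0`.  In the first two cases
the neighbours of `0` are `y` and `X`, in the third one they are `y` and `x`. -/
def attach (typ x y X : ℕ) : List (ℕ × ℕ) × ℕ :=
  match typ with
  | 0 => ([(y, 0), (X, 0)], x)
  | 1 => ([(y, 0), (0, X)], x)
  | _ => ([(y, 0), (0, x)], X)

/-- A possible third arc at the internal vertex `5` of degree two. -/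
def third (q : ℕ) : List (ℕ × ℕ) :=
  match q with
  | 0 => []
  | 1 => [(5, 9)]
  | _ => [(9, 5)]

/-- The configuration obtained from `S` by replacing the arc `e` by the vertex `0`. -/
def cfg (S : Pat) (e : ℕ × ℕ) (typ X q : ℕ) : List (ℕ × ℕ) :=
  S.arcs.erase e ++ ((attach typ e.1 e.2 X).1 ++ third q)

/-- The terminals of `cfg` other than `6`. -/
def trm (X q : ℕ) : List ℕ :=
  7 :: ((if X = 8 then [8] else []) ++ (if q = 0 then [] else [9]))

/-- The configurations in which recolouring may fail when all terminals have the same colour. -/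
def exceptional (S : Pat) (e : ℕ × ℕ) (typ X q : ℕ) : Bool :=
  typ == 0 && X == 8 && q == 2 && S.k == 6 && (e == (5, 2) || e == (5, 4))

/-- The recolouring test for `cfg`. -/
noncomputable def cfgCheck (S : Pat) (e : ℕ × ℕ) (typ X q : ℕ) : Bool :=
  check (exceptional S e typ X q) (cfg S e typ X q) (attach typ e.1 e.2 X).2 S.ord (trm X q)

theorem cfgCheck_base : ∀ S ∈ pats, ∀ e ∈ S.arcs, ∀ typ ∈ [0, 1, 2],
    cfgCheck S e typ 8 0 = true := by
  decide +kernel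

theorem cfgCheck_five : ∀ S ∈ pats, S.k = 6 → ∀ e ∈ S.arcs, e.1 ≠ 5 → e.2 ≠ 5 →
    ∀ typ ∈ [0, 1, 2], cfgCheck S e typ 5 0 = true := by
  decide +kernel

theorem cfgCheck_third : ∀ S ∈ pats, S.k = 6 → ∀ e ∈ S.arcs, ∀ typ ∈ [0, 1, 2], ∀ q ∈ [1, 2],
    cfgCheck S e typ 8 q = true := by
  decide +kernel

/-- The admissible parameters of `cfg`. -/
def Valid (S : Pat) (e : ℕ × ℕ) (X q : ℕ) : Prop :=
  (X = 8 ∧ (q = 0 ∨ S.k = 6 ∧ (q = 1 ∨ q = 2))) ∨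
    (X = 5 ∧ q = 0 ∧ S.k = 6 ∧ e.1 ≠ 5 ∧ e.2 ≠ 5)

theorem cfgCheck_true {S : Pat} (hS : S ∈ pats) {e : ℕ × ℕ} (he : e ∈ S.arcs) {typ : ℕ}
    (ht : typ ∈ [0, 1, 2]) {X q : ℕ} (h : Valid S e X q) : cfgCheck S e typ X q = true := by
  rcases h with ⟨rfl, rfl | ⟨hk, hq⟩⟩ | ⟨rfl, rfl, hk, h1, h2⟩
  · exact cfgCheck_base S hS e he typ ht
  · exact cfgCheck_third S hS hk e he typ ht q (by simpa using hq)
  · exact cfgCheck_five S hS hk e he h1 h2 typ ht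

/-- Two vertices `1, 2` with common out-neighbours `0` and `3`, and possible third arcs at `1`
and `2`; the selectors `p` and `q` choose no arc, an arc to a terminal, or an arc from it. -/
def fourCycle (p q : ℕ) : List (ℕ × ℕ) :=
  [(1, 0), (2, 0), (1, 3), (2, 3)] ++
    ((match p with | 0 => [] | 1 => [(1, 6)] | _ => [(6, 1)]) ++
      (match q with | 0 => [] | 1 => [(2, 7)] | _ => [(7, 2)]))

theorem check_fourCycle : ∀ pq ∈ [(0, 0), (0, 1), (0, 2), (1, 0), (2, 0), (1, 1), (2, 2)],
    check false (fourCycle pq.1 pq.2) 3 [1, 2, 0, 3] [7] = true := by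
  decide +kernel

/-- The vertices `0` and `5` have the common in-neighbour `8`, and their other in-neighbours
`1` and `2` have the same in-neighbours, or the same out-neighbours, `3` and `4`.  The flag `f` is
the direction of the arcs between `{1, 2}` and `{3, 4}`, and `w` distinguishes how the vertex `8`
is joined to the rest: not at all, by an arc to or from a terminal, or by an arc from `3` or to
`4`. -/
def linked (f : Bool) (w : ℕ) : List (ℕ × ℕ) :=
  (if f then [(1, 3), (1, 4), (2, 3), (2, 4)] else [(3, 1), (3, 2), (4, 1), (4, 2)]) ++
    ([(1, 0), (8, 0), (2, 5), (8, 5)] ++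
      (match w with
        | 0 => [(3, 6), (7, 4)]
        | 1 => [(3, 6), (7, 4), (8, 9)]
        | 2 => [(3, 6), (7, 4), (9, 8)]
        | 3 => [(3, 8), (7, 4)]
        | _ => [(3, 6), (8, 4)]))

theorem check_linked : ∀ f ∈ [true, false], ∀ w ∈ [0, 3, 4],
    check false (linked f w) 5 [3, 4, 1, 2, 8, 0, 5] [7] = true := by
  decide +kernel
theorem check_linked' : ∀ f ∈ [true, false], ∀ w ∈ [1, 2],
    check false (linked f w) 5 [3, 4, 1, 2, 8, 0, 5] [7, 9] = true := by
  decide +kernel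

/-! ### Colourings by the Paley tournament -/

section

variable {V : Type*}

/-- A homomorphism from the relation `R` to the Paley tournament on seven vertices. -/
def IsCol (R : V → V → Prop) (c : V → ℕ) : Prop :=
  (∀ u, c u < 7) ∧ ∀ u w, R u w → adj (c u) (c w) = true

theorem IsCol.mono {R R' : V → V → Prop} {c : V → ℕ} (h : IsCol R c)
    (hR : ∀ u w, R' u w → R u w) : IsCol R' c :=
  ⟨h.1, fun u w huw => h.2 u w (hR u w huw)⟩

theorem IsCol.rotate {R : V → V → Prop} {c : V → ℕ} (h : IsCol R c) {k : ℕ} (hk : k < 7) :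
    IsCol R fun u => (c u + k) % 7 :=
  ⟨fun _ => Nat.mod_lt _ (by omega), fun u w huw => by
    rw [adj_rotate _ (h.1 u) _ (h.1 w) _ hk]; exact h.2 u w huw⟩

theorem adj_sub : ∀ i < 7, ∀ j < 7, adj (6 - i) (6 - j) = adj j i := by decide

theorem IsCol.flip {R : V → V → Prop} {c : V → ℕ} (h : IsCol R c) :
    IsCol (flip R) fun u => 6 - c u :=
  ⟨fun u => (Nat.sub_le 6 (c u)).trans_lt (by omega), fun u w huw => by
    rw [adj_sub _ (h.1 u) _ (h.1 w)]; exact h.2 w u huw⟩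

/-- Change a colouring on the internal vertices of a configuration `φ` all of whose arcs are
listed in `L`. -/
theorem IsCol.patch {R : V → V → Prop} {c : V → ℕ} (hc : IsCol R c) {φ : ℕ → V}
    {L : List (ℕ × ℕ)} {vs l : List ℕ} (hvl : ∀ i ∈ vs, i ∈ l)
    (hinj : ∀ i ∈ vs, ∀ j ∈ l, i ≠ j → φ i ≠ φ j)
    (hout : ∀ i ∈ vs, ∀ z, R (φ i) z → ∃ j ∈ l, φ j = z ∧ (i, j) ∈ L)
    (hin : ∀ i ∈ vs, ∀ z, R z (φ i) → ∃ j ∈ l, φ j = z ∧ (j, i) ∈ L)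
    {g : ℕ → ℕ} (hgt : ∀ j ∈ l, j ∉ vs → g j = c (φ j)) (hgv : ∀ i ∈ vs, g i < 7)
    (hL : ∀ p ∈ L, p.1 ∈ l → p.2 ∈ l → adj (g p.1) (g p.2) = true) :
    ∃ c' : V → ℕ, IsCol R c' ∧ ∀ j ∈ l, c' (φ j) = g j := by
  classical
  let c' : V → ℕ := fun z => if h : ∃ i ∈ vs, φ i = z then g h.choose else c z
  have h1 : ∀ i ∈ vs, c' (φ i) = g i := by
    intro i hi
    have h : ∃ k ∈ vs, φ k = φ i := ⟨i, hi, rfl⟩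
    have h2 : h.choose = i := by
      by_contra hne
      exact hinj _ h.choose_spec.1 i (hvl i hi) hne h.choose_spec.2
    simp only [c', h, dif_pos, h2]
  have h2 : ∀ z, (¬ ∃ i ∈ vs, φ i = z) → c' z = c z := fun z hz => by simp only [c', dif_neg hz]
  have h3 : ∀ j ∈ l, c' (φ j) = g j := by
    intro j hj
    by_cases hv : j ∈ vs
    · exact h1 j hv
    · rw [h2, hgt j hj hv]
      rintro ⟨i, hi, h⟩
      exact hinj i hi j hj (fun e => hv (e ▸ hi)) h
  refine ⟨c', ⟨fun z => ?_, fun u w huw => ?_⟩, h3⟩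
  · by_cases h : ∃ i ∈ vs, φ i = z
    · obtain ⟨i, hi, rfl⟩ := h
      rw [h1 i hi]; exact hgv i hi
    · rw [h2 z h]; exact hc.1 z
  · by_cases hu : ∃ i ∈ vs, φ i = u
    · obtain ⟨i, hi, rfl⟩ := hu
      obtain ⟨j, hj, rfl, hij⟩ := hout i hi w huw
      rw [h3 i (hvl i hi), h3 j hj]
      exact hL _ hij (hvl i hi) hj
    · by_cases hw : ∃ i ∈ vs, φ i = w
      · obtain ⟨i, hi, rfl⟩ := hw
        obtain ⟨j, hj, rfl, hij⟩ := hin i hi u huw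
        rw [h3 i (hvl i hi), h3 j hj]
        exact hL _ hij hj (hvl i hi)
      · rw [h2 u hu, h2 w hw]
        exact hc.2 u w huw

/-- If a configuration passes the recolouring test, then every colouring can be changed on its
internal vertices so that the vertices with indices `0` and `b` get different colours. -/
theorem IsCol.recolour {R : V → V → Prop} (hR : ∀ u w, R u w → ¬ R w u) {c : V → ℕ}
    (hc : IsCol R c) {φ : ℕ → V} {z : Bool} {L : List (ℕ × ℕ)} {b : ℕ} {vs ts : List ℕ}
    (h : check z L b vs ts = true) (hn : (6 :: (vs ++ ts)).Nodup) (h0 : 0 ∈ vs)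
    (hb : b ∈ 6 :: (vs ++ ts)) (hb0 : b ≠ 0)
    (hL : ∀ p ∈ L, R (φ p.1) (φ p.2))
    (hinj : ∀ i ∈ vs, ∀ j ∈ 6 :: (vs ++ ts), i ≠ j → φ i ≠ φ j)
    (hcomp : ∀ i ∈ vs, ∀ w, R (φ i) w ∨ R w (φ i) →
      ∃ j ∈ 6 :: (vs ++ ts), φ j = w ∧ ((i, j) ∈ L ∨ (j, i) ∈ L))
    (hz : z = true → ∃ t ∈ ts, c (φ t) ≠ c (φ 6)) :
    ∃ c' : V → ℕ, IsCol R c' ∧ c' (φ 0) ≠ c' (φ b) := by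
  have h6 := hc.1 (φ 6)
  have hk : (7 - c (φ 6)) % 7 < 7 := Nat.mod_lt _ (by omega)
  have hc1 := hc.rotate hk
  set c1 : V → ℕ := fun u => (c u + (7 - c (φ 6)) % 7) % 7 with hc1d
  have h61 : c1 (φ 6) = 0 := by simp only [c1]; omega
  have hz1 : z = true → ∃ t ∈ ts, c1 (φ t) ≠ 0 := by
    intro hzt
    obtain ⟨t, ht, hne⟩ := hz hzt
    refine ⟨t, ht, ?_⟩
    have := hc.1 (φ t)
    simp only [c1]; omega
  obtain ⟨g, hg1, hg2, hg3, hg4⟩ := check_spec h hn h0 hb hb0 (fun i => c1 (φ i))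
    (fun i _ => hc1.1 _) h61 (fun p hp => hc1.2 _ _ (hL p hp)) hz1
  have hvl : ∀ i ∈ vs, i ∈ 6 :: (vs ++ ts) := fun i hi => by simp [hi]
  obtain ⟨c', hc', hv⟩ := hc1.patch hvl hinj (L := L)
    (by
      intro i hi w hw
      obtain ⟨j, hj, rfl, h | h⟩ := hcomp i hi w (Or.inl hw)
      · exact ⟨j, hj, rfl, h⟩
      · exact absurd (hL _ h) (hR _ _ hw))
    (by
      intro i hi w hw
      obtain ⟨j, hj, rfl, h | h⟩ := hcomp i hi w (Or.inr hw)
      · exact absurd (hL _ h) (hR _ _ hw)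
      · exact ⟨j, hj, rfl, h⟩)
    (fun j _ hj => hg1 j hj) hg2 hg4
  refine ⟨c', hc', ?_⟩
  rw [hv 0 (hvl 0 h0), hv b hb]
  exact hg3

/-- A colouring of `R` without the vertex `v` extends to `v`. -/
theorem IsCol.extend {R : V → V → Prop} (hR : ∀ u, ¬ R u u) {c : V → ℕ} {v : V}
    (hc : IsCol (fun u w => R u w ∧ u ≠ v ∧ w ≠ v) c) {α : ℕ} (hα : α < 7)
    (hout : ∀ w, R v w → adj α (c w) = true) (hin : ∀ w, R w v → adj (c w) α = true) :
    ∃ c' : V → ℕ, IsCol R c' ∧ c' v = α ∧ ∀ w, w ≠ v → c' w = c w := by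
  classical
  refine ⟨Function.update c v α, ⟨fun u => ?_, fun u w huw => ?_⟩, by simp,
    fun w hw => by simp [hw]⟩
  · by_cases hu : u = v
    · subst hu; simpa using hα
    · simpa [hu] using hc.1 u
  · by_cases hu : u = v
    · subst hu
      have hw : w ≠ u := by rintro rfl; exact hR _ huw
      simpa [hw] using hout w huw
    · by_cases hw : w = v
      · subst hw; simpa [hu] using hin u huw
      · simpa [hu, hw] using hc.2 u w ⟨huw, hu, hw⟩

/-- If all arcs but `(x, y)` respect the partition into `W` and its complement, then a colouring
of the remaining arcs yields one of all arcs, by rotation of the colours on `W`. -/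
theorem IsCol.bridge {R : V → V → Prop} {c : V → ℕ} {x y : V}
    (hc : IsCol (fun u w => R u w ∧ ¬ (u = x ∧ w = y)) c) (W : V → Prop) (hxy : W x ↔ ¬ W y)
    (hW : ∀ u w, R u w → ¬ (u = x ∧ w = y) → (W u ↔ W w)) : ∃ c' : V → ℕ, IsCol R c' := by
  classical
  have key : ∀ i < 7, ∀ j < 7, ∃ k < 7, adj ((i + k) % 7) j = true := by decide
  have key' : ∀ i < 7, ∀ j < 7, ∃ k < 7, adj i ((j + k) % 7) = true := by decide
  have main : ∀ k < 7, adj (if W x then (c x + k) % 7 else c x)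
      (if W y then (c y + k) % 7 else c y) = true →
      IsCol R fun u => if W u then (c u + k) % 7 else c u := by
    intro k hk h
    refine ⟨fun u => ?_, fun u w huw => ?_⟩
    · have := hc.1 u
      by_cases hu : W u
      · simp only [hu, if_true]; omega
      · simpa only [hu, if_false] using this
    · by_cases he : u = x ∧ w = y
      · obtain ⟨rfl, rfl⟩ := he; exact h
      · have h1 := hW u w huw he
        have h2 := hc.2 u w ⟨huw, he⟩
        by_cases hu : W u
        · simp only [hu, h1.1 hu, if_true]
          rw [adj_rotate _ (hc.1 u) _ (hc.1 w) _ hk]; exact h2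
        · have hw : ¬ W w := fun h => hu (h1.2 h)
          simpa only [hu, hw, if_false] using h2
  by_cases hx : W x
  · obtain ⟨k, hk, h⟩ := key _ (hc.1 x) _ (hc.1 y)
    refine ⟨_, main k hk ?_⟩
    simpa only [hx, hxy.1 hx, if_true, if_false] using h
  · have hy : W y := by tauto
    obtain ⟨k, hk, h⟩ := key' _ (hc.1 x) _ (hc.1 y)
    refine ⟨_, main k hk ?_⟩
    simpa only [hx, hy, if_true, if_false] using h

end

/-! ### Reducible relations -/

section

variable {V : Type*}

/-- The relation `R` without the arcs at `v`. -/
def del (R : V → V → Prop) (v u w : V) : Prop := R u w ∧ u ≠ v ∧ w ≠ v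

/-- An occurrence of the configuration `S` in `R`.  It need not be induced, and its two terminals
may coincide. -/
structure Occ (R : V → V → Prop) (S : Pat) (φ : ℕ → V) : Prop where
  arcs : ∀ p ∈ S.arcs, R (φ p.1) (φ p.2)
  inj : ∀ i ∈ S.ord, i ≠ 0 → ∀ j ∈ 6 :: 7 :: S.ord, j ≠ 0 → i ≠ j → φ i ≠ φ j

/-- The relabelling that identifies each configuration with the reversal of another one. -/
def rev (i : ℕ) : ℕ :=
  match i with
  | 1 => 4
  | 2 => 3
  | 3 => 2
  | 4 => 1
  | 6 => 7
  | 7 => 6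
  | i => i

theorem pats_rev : ∀ S ∈ pats, ∃ S' ∈ pats, (∀ p ∈ S'.arcs, (rev p.2, rev p.1) ∈ S.arcs) ∧
    ∀ i ∈ S'.ord, i ≠ 0 → (rev i ∈ S.ord ∧ rev i ≠ 0) ∧ ∀ j ∈ 6 :: 7 :: S'.ord, j ≠ 0 →
      (rev j ∈ 6 :: 7 :: S.ord ∧ rev j ≠ 0) ∧ (i ≠ j → rev i ≠ rev j) := by
  decide

theorem Occ.flip {R : V → V → Prop} {S : Pat} (hS : S ∈ pats) {φ : ℕ → V} (h : Occ (flip R) S φ) :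
    ∃ S' ∈ pats, Occ R S' fun i => φ (rev i) := by
  obtain ⟨S', hS', h1, h2⟩ := pats_rev S hS
  refine ⟨S', hS', fun p hp => h.arcs _ (h1 p hp), fun i hi hi0 j hj hj0 hij => ?_⟩
  obtain ⟨⟨h3, h4⟩, h5⟩ := h2 i hi hi0
  obtain ⟨⟨h6, h7⟩, h8⟩ := h5 j hj hj0
  exact h.inj _ h3 h4 _ h6 h7 (h8 hij)

variable [Fintype V]

open Classical in
/-- The neighbours of `u`. -/
noncomputable def nb (R : V → V → Prop) (u : V) : Finset V :=
  Finset.univ.filter fun w => R u w ∨ R w u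

open Classical in
/-- The number of arcs of `R`. -/
noncomputable def size (R : V → V → Prop) : ℕ :=
  (Finset.univ.filter fun p : V × V => R p.1 p.2).card

theorem mem_nb {R : V → V → Prop} {u w : V} : w ∈ nb R u ↔ R u w ∨ R w u := by
  simp [nb]

theorem nb_mono {R R' : V → V → Prop} (h : ∀ u w, R' u w → R u w) (u : V) : nb R' u ⊆ nb R u := by
  intro w
  rw [mem_nb, mem_nb]
  exact Or.imp (h _ _) (h _ _)

theorem nb_flip (R : V → V → Prop) (u : V) : nb (flip R) u = nb R u := by
  ext w
  rw [mem_nb, mem_nb]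
  exact Or.comm

theorem length_le_nb {R : V → V → Prop} {u : V} {l : List V} (hl : l.Nodup)
    (hm : ∀ w ∈ l, R u w ∨ R w u) : l.length ≤ (nb R u).card := by
  classical
  rw [← List.toFinset_card_of_nodup hl]
  exact Finset.card_le_card fun w hw => mem_nb.2 (hm w (List.mem_toFinset.1 hw))

/-- If as many neighbours are listed as the degree allows, then all of them are listed. -/
theorem mem_of_nb_le {R : V → V → Prop} {u : V} {l : List V} (hl : l.Nodup)
    (hm : ∀ w ∈ l, R u w ∨ R w u) (hc : (nb R u).card ≤ l.length) {z : V}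
    (hz : R u z ∨ R z u) : z ∈ l := by
  by_contra h
  have := length_le_nb (l := z :: l) (List.nodup_cons.2 ⟨h, hl⟩)
    (by intro w hw; rcases List.mem_cons.1 hw with rfl | hw; exacts [hz, hm w hw])
  rw [List.length_cons] at this
  omega

open Classical in
/-- The class of oriented graphs to which the induction applies: subcubic, without a cubic
subgraph, and without the excluded configurations. -/
structure Good (R : V → V → Prop) : Prop where
  asymm : ∀ u w, R u w → ¬ R w u
  deg : ∀ u, (nb R u).card ≤ 3
  proper : ∀ U : Finset V, U.Nonempty → ∃ u ∈ U, (nb R u ∩ U).card ≤ 2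
  free : ∀ S ∈ pats, ∀ φ, ¬ Occ R S φ

theorem Good.mono {R R' : V → V → Prop} (h : Good R) (hR : ∀ u w, R' u w → R u w) : Good R' where
  asymm u w h1 h2 := h.asymm u w (hR _ _ h1) (hR _ _ h2)
  deg u := (Finset.card_le_card (nb_mono hR u)).trans (h.deg u)
  proper U hU := by
    classical
    obtain ⟨u, hu, h1⟩ := h.proper U hU
    exact ⟨u, hu, (Finset.card_le_card (Finset.inter_subset_inter_right (nb_mono hR u))).trans h1⟩
  free S hS φ hφ := h.free S hS φ ⟨fun p hp => hR _ _ (hφ.arcs p hp), hφ.inj⟩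

theorem Good.flip {R : V → V → Prop} (h : Good R) : Good (flip R) where
  asymm u w := h.asymm w u
  deg u := by rw [nb_flip]; exact h.deg u
  proper U hU := by
    classical
    obtain ⟨u, hu, h1⟩ := h.proper U hU
    exact ⟨u, hu, by rwa [nb_flip]⟩
  free S hS φ hφ := by
    obtain ⟨S', hS', h'⟩ := Occ.flip hS hφ
    exact h.free S' hS' _ h'

theorem Good.irrefl {R : V → V → Prop} (h : Good R) (u : V) : ¬ R u u :=
  fun hu => h.asymm u u hu hu

theorem size_flip (R : V → V → Prop) : size (flip R) = size R := by
  classical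
  refine Finset.card_bij (fun p _ => (p.2, p.1)) ?_ ?_ ?_
  · intro p hp
    exact Finset.mem_filter.2 ⟨Finset.mem_univ _, (Finset.mem_filter.1 hp).2⟩
  · rintro ⟨a, b⟩ _ ⟨c, d⟩ _ h; simp only [Prod.mk.injEq] at h ⊢; tauto
  · rintro ⟨a, b⟩ h
    exact ⟨(b, a), Finset.mem_filter.2 ⟨Finset.mem_univ _, (Finset.mem_filter.1 h).2⟩, rfl⟩

theorem size_lt {R R' : V → V → Prop} (h : ∀ u w, R' u w → R u w) {x y : V} (h1 : R x y)
    (h2 : ¬ R' x y) : size R' < size R := by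
  classical
  refine Finset.card_lt_card ⟨?_, ?_⟩
  · intro p hp; simp only [Finset.mem_filter, Finset.mem_univ, true_and] at hp ⊢; exact h _ _ hp
  · intro hs
    have : (x, y) ∈ Finset.univ.filter fun p : V × V => R' p.1 p.2 := hs (by simpa using h1)
    simp at this
    exact h2 this

/-- The number of arcs decreases when two arcs are replaced by one. -/
theorem size_lt_of_replace {R R' : V → V → Prop} {x y x1 y1 x2 y2 : V}
    (h : ∀ u w, R' u w → (R u w ∧ ¬ (u = x1 ∧ w = y1) ∧ ¬ (u = x2 ∧ w = y2)) ∨ (u = x ∧ w = y))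
    (h1 : R x1 y1) (h2 : R x2 y2) (hne : ¬ (x1 = x2 ∧ y1 = y2)) : size R' < size R := by
  classical
  let A := Finset.univ.filter fun p : V × V => R p.1 p.2
  have hA1 : (x1, y1) ∈ A := by simpa [A] using h1
  have hA2 : (x2, y2) ∈ A.erase (x1, y1) := by
    simp only [A, Finset.mem_erase, Finset.mem_filter, Finset.mem_univ, true_and, Prod.mk.injEq,
      ne_eq]
    exact ⟨by rintro ⟨rfl, rfl⟩; exact hne ⟨rfl, rfl⟩, h2⟩
  have hs : (Finset.univ.filter fun p : V × V => R' p.1 p.2) ⊆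
      insert (x, y) ((A.erase (x1, y1)).erase (x2, y2)) := by
    rintro ⟨u, w⟩ hp
    simp only [Finset.mem_filter, Finset.mem_univ, true_and] at hp
    have := h u w hp
    simp only [A, Finset.mem_insert, Finset.mem_erase, Finset.mem_filter, Finset.mem_univ, true_and,
      Prod.mk.injEq, ne_eq]
    tauto
  have h3 := Finset.card_le_card hs
  have h4 := Finset.card_insert_le (x, y) ((A.erase (x1, y1)).erase (x2, y2))
  rw [Finset.card_erase_of_mem hA2, Finset.card_erase_of_mem hA1] at h4
  have h5 : 2 ≤ A.card := by
    have h6 := Finset.card_pos.2 ⟨_, hA2⟩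
    rw [Finset.card_erase_of_mem hA1] at h6
    omega
  change (Finset.univ.filter fun p : V × V => R' p.1 p.2).card < A.card
  omega

theorem card_nb_del_lt {R : V → V → Prop} {v u : V} (h : R u v ∨ R v u) :
    (nb (del R v) u).card < (nb R u).card := by
  refine Finset.card_lt_card ⟨nb_mono (fun _ _ h => h.1) u, fun hs => ?_⟩
  rcases mem_nb.1 (hs (mem_nb.2 h)) with h | h
  · exact h.2.2 rfl
  · exact h.2.1 rfl

end

/-! ### Recolouring around an excluded configuration -/

section

variable {V : Type*}

/-- The indices that are joined to `i` by a listed arc. -/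
def nbrs (L : List (ℕ × ℕ)) (i : ℕ) : List ℕ :=
  L.filterMap fun p => if p.1 = i then some p.2 else if p.2 = i then some p.1 else none

theorem mem_nbrs {L : List (ℕ × ℕ)} {i j : ℕ} (h : j ∈ nbrs L i) : (i, j) ∈ L ∨ (j, i) ∈ L := by
  simp only [nbrs, List.mem_filterMap] at h
  obtain ⟨⟨x, y⟩, hp, h⟩ := h
  dsimp only at h
  split_ifs at h with h1 h2
  · simp only [Option.some.injEq] at h; subst h1 h; exact Or.inl hp
  · simp only [Option.some.injEq] at h; subst h2 h; exact Or.inr hp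

theorem mem_nbrs_symm {L : List (ℕ × ℕ)} {i j : ℕ} (h : j ∈ nbrs L i) : i ∈ nbrs L j := by
  have : ∀ x y, (x, y) ∈ L → x ∈ nbrs L y ∧ y ∈ nbrs L x ∨ x = y ∧ x ∈ nbrs L x := by
    intro x y hp
    by_cases hxy : x = y
    · subst hxy
      exact Or.inr ⟨rfl, List.mem_filterMap.2 ⟨_, hp, by simp⟩⟩
    · exact Or.inl ⟨List.mem_filterMap.2 ⟨_, hp, by simp [hxy]⟩,
        List.mem_filterMap.2 ⟨_, hp, by simp⟩⟩
  rcases mem_nbrs h with h1 | h1 <;> rcases this _ _ h1 with h2 | ⟨rfl, h2⟩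
  exacts [h2.1, h2, h2.2, h2]

instance (S : Pat) (e : ℕ × ℕ) (X q : ℕ) : Decidable (Valid S e X q) := by
  unfold Valid; infer_instance

/-- In a configuration `cfg` all neighbours of an internal vertex are listed, up to the third
neighbour of the vertex `5`. -/
theorem cfg_nbrs : ∀ S ∈ pats, ∀ e ∈ S.arcs, ∀ typ ∈ [0, 1, 2], ∀ X ∈ [5, 8], ∀ q ∈ [0, 1, 2],
    Valid S e X q → ∀ i ∈ S.ord, i ≠ 0 → (i = 5 → q ≠ 0 ∨ X = 5) →
      (nbrs (cfg S e typ X q) i).Nodup ∧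
      (∀ j ∈ nbrs (cfg S e typ X q) i, ∀ k ∈ nbrs (cfg S e typ X q) i, j ≠ k →
        j ∈ S.ord ∨ k ∈ S.ord) ∧
      (if i = (attach typ e.1 e.2 X).2 then 2 else 3) ≤ (nbrs (cfg S e typ X q) i).length := by
  decide +kernel

theorem cfg_nbrs_zero : ∀ S ∈ pats, ∀ e ∈ S.arcs, ∀ typ ∈ [0, 1, 2], ∀ X ∈ [5, 8], ∀ q ∈ [0, 1, 2],
    (nbrs (cfg S e typ X q) 0) = [e.2, if typ = 2 then e.1 else X] := by
  decide +kernel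

theorem cfg_index : ∀ S ∈ pats, ∀ e ∈ S.arcs, ∀ typ ∈ [0, 1, 2], ∀ X ∈ [5, 8], ∀ q ∈ [0, 1, 2],
    Valid S e X q → (6 :: (S.ord ++ trm X q)).Nodup ∧ 0 ∈ S.ord ∧
      (attach typ e.1 e.2 X).2 ∈ 6 :: (S.ord ++ trm X q) ∧ (attach typ e.1 e.2 X).2 ≠ 0 ∧
      ∀ i ∈ S.ord, ∀ j ∈ nbrs (cfg S e typ X q) i, j ∈ 6 :: (S.ord ++ trm X q) := by
  decide +kernel

/-- The vertices `1, …, 4` that are not ends of the deleted arc `e` keep three neighbours. -/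
theorem cfg_far : ∀ S ∈ pats, ∀ e ∈ S.arcs, ∀ i ∈ S.ord, i ≠ 0 → i ≠ 5 → i ≠ e.1 → i ≠ e.2 →
    (nbrs (S.arcs.erase e) i).Nodup ∧ 3 ≤ (nbrs (S.arcs.erase e) i).length ∧
    (∀ j ∈ nbrs (S.arcs.erase e) i, j ∈ 6 :: 7 :: S.ord ∧ j ≠ 0) ∧
    ∀ j ∈ nbrs (S.arcs.erase e) i, ∀ k ∈ nbrs (S.arcs.erase e) i, j ≠ k →
      j ∈ S.ord ∨ k ∈ S.ord := by
  decide +kernel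

theorem pats_index : ∀ S ∈ pats, (5 ∈ S.ord → S.k = 6) ∧ (S.k = 6 → 5 ∈ S.ord) ∧ 8 ∉ S.ord ∧
    9 ∉ S.ord ∧ 6 ∉ S.ord ∧ 7 ∉ S.ord ∧ 0 ∈ S.ord ∧
    ∀ e ∈ S.arcs, (e.1 ∈ 6 :: 7 :: S.ord ∧ e.1 ≠ 0) ∧ (e.2 ∈ 6 :: 7 :: S.ord ∧ e.2 ≠ 0) := by
  decide +kernel

theorem nodup_map_of {l : List ℕ} {φ : ℕ → V} (hl : l.Nodup)
    (h : ∀ j ∈ l, ∀ k ∈ l, j ≠ k → φ j ≠ φ k) : (l.map φ).Nodup :=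
  hl.map_on fun j hj k hk e => by
    by_contra hne
    exact h j hj k hk hne e

variable [Fintype V]

/-- In an occurrence of `cfg` all neighbours of the internal vertices are listed, except possibly
a third neighbour of the vertex `5`. -/
theorem cfg_complete {R : V → V → Prop} {S : Pat} (hS : S ∈ pats)
    {e : ℕ × ℕ} (he : e ∈ S.arcs) {typ : ℕ} (ht : typ ∈ [0, 1, 2]) {X : ℕ} (hX : X ∈ [5, 8])
    {q : ℕ} (hq : q ∈ [0, 1, 2]) (hv : Valid S e X q) {φ : ℕ → V}
    (harcs : ∀ p ∈ cfg S e typ X q, R (φ p.1) (φ p.2))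
    (hdeg : ∀ u, (nb R u).card ≤ 3) (hB : (nb R (φ (attach typ e.1 e.2 X).2)).card ≤ 2)
    (ha : (nb R (φ 0)).card ≤ 2) (hz : φ e.2 ≠ φ (if typ = 2 then e.1 else X))
    (hinj : ∀ i ∈ S.ord, ∀ j ∈ 6 :: (S.ord ++ trm X q), i ≠ j → φ i ≠ φ j)
    {i : ℕ} (hi : i ∈ S.ord) (h5 : i = 5 → q ≠ 0 ∨ X = 5) {w : V}
    (hw : R (φ i) w ∨ R w (φ i)) : ∃ j ∈ nbrs (cfg S e typ X q) i, φ j = w := by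
  have hm : ∀ w ∈ (nbrs (cfg S e typ X q) i).map φ, R (φ i) w ∨ R w (φ i) := by
    intro w hw
    obtain ⟨j, hj, rfl⟩ := List.mem_map.1 hw
    exact (mem_nbrs hj).imp (harcs _) (harcs _)
  have hidx := (cfg_index S hS e he typ ht X hX q hq hv).2.2.2.2 i hi
  suffices h : w ∈ (nbrs (cfg S e typ X q) i).map φ by simpa using h
  by_cases hi0 : i = 0
  · subst hi0
    rw [cfg_nbrs_zero S hS e he typ ht X hX q hq] at hm ⊢
    exact mem_of_nb_le (by simpa using hz) hm (by simpa using ha) hw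
  · obtain ⟨h1, h2, h3⟩ := cfg_nbrs S hS e he typ ht X hX q hq hv i hi hi0 h5
    refine mem_of_nb_le (nodup_map_of h1 fun j hj k hk hjk => ?_) hm ?_ hw
    · rcases h2 j hj k hk hjk with h | h
      · exact hinj j h k (hidx k hk) hjk
      · exact (hinj k h j (hidx j hj) hjk.symm).symm
    · rw [List.length_map]
      by_cases hib : i = (attach typ e.1 e.2 X).2
      · rw [if_pos hib] at h3
        rw [← hib] at hB
        omega
      · rw [if_neg hib] at h3
        exact (hdeg _).trans h3

/-- Recolouring for an occurrence of `cfg` in which all neighbours of internal vertices are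
listed. -/
theorem cfg_recolour {R : V → V → Prop} (hR : ∀ u w, R u w → ¬ R w u) {c : V → ℕ}
    (hc : IsCol R c) {S : Pat} (hS : S ∈ pats)
    {e : ℕ × ℕ} (he : e ∈ S.arcs) {typ : ℕ} (ht : typ ∈ [0, 1, 2]) {X : ℕ} (hX : X ∈ [5, 8])
    {q : ℕ} (hq : q ∈ [0, 1, 2]) (hv : Valid S e X q) {φ : ℕ → V}
    (harcs : ∀ p ∈ cfg S e typ X q, R (φ p.1) (φ p.2))
    (hdeg : ∀ u, (nb R u).card ≤ 3) (hB : (nb R (φ (attach typ e.1 e.2 X).2)).card ≤ 2)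
    (ha : (nb R (φ 0)).card ≤ 2) (hz : φ e.2 ≠ φ (if typ = 2 then e.1 else X))
    (hinj : ∀ i ∈ S.ord, ∀ j ∈ 6 :: (S.ord ++ trm X q), i ≠ j → φ i ≠ φ j)
    (h5 : 5 ∈ S.ord → q = 0 → X ≠ 5 → ∀ w, R (φ 5) w ∨ R w (φ 5) →
      ∃ j ∈ nbrs (cfg S e typ X q) 5, φ j = w)
    (hex : exceptional S e typ X q = true → ∃ t ∈ trm X q, c (φ t) ≠ c (φ 6)) :
    ∃ c' : V → ℕ, IsCol R c' ∧ c' (φ 0) ≠ c' (φ (attach typ e.1 e.2 X).2) := by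
  obtain ⟨h1, h2, h3, h4, h6⟩ := cfg_index S hS e he typ ht X hX q hq hv
  refine hc.recolour hR (cfgCheck_true hS he ht hv) h1 h2 h3 h4 harcs hinj ?_ hex
  intro i hi w hw
  have key : ∃ j ∈ nbrs (cfg S e typ X q) i, φ j = w := by
    by_cases hi5 : i = 5 ∧ q = 0 ∧ X ≠ 5
    · obtain ⟨rfl, hq0, hX5⟩ := hi5
      exact h5 hi hq0 hX5 w hw
    · exact cfg_complete hS he ht hX hq hv harcs hdeg hB ha hz hinj hi (by tauto) hw
  obtain ⟨j, hj, rfl⟩ := key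
  exact ⟨j, h6 i hi j hj, rfl, mem_nbrs hj⟩

set_option maxHeartbeats 1000000 in
/-- A colouring of the oriented graph obtained by replacing an arc of an excluded configuration by
the vertex `φ 0` can be changed so that `φ 0` gets a colour different from that of a given
vertex of degree at most two.  The only exception is described by the second alternative. -/
theorem exists_recolouring {R : V → V → Prop} (hR : ∀ u w, R u w → ¬ R w u) {c : V → ℕ}
    (hc : IsCol R c) {S : Pat} (hS : S ∈ pats)
    {e : ℕ × ℕ} (he : e ∈ S.arcs) {typ : ℕ} (ht : typ ∈ [0, 1, 2]) {φ : ℕ → V}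
    (harcs : ∀ p ∈ cfg S e typ 8 0, R (φ p.1) (φ p.2))
    (hdeg : ∀ u, (nb R u).card ≤ 3) (hB : (nb R (φ (attach typ e.1 e.2 8).2)).card ≤ 2)
    (ha : (nb R (φ 0)).card ≤ 2)
    (hinj : ∀ i ∈ S.ord, i ≠ 0 → ∀ j ∈ 6 :: 7 :: S.ord, j ≠ 0 → i ≠ j → φ i ≠ φ j)
    (h0 : ∀ j ∈ 6 :: 7 :: S.ord, j ≠ 0 → φ j ≠ φ 0)
    (h80 : φ 8 ≠ φ 0) (h8x : φ 8 ≠ φ e.1) (h8y : φ 8 ≠ φ e.2) (hxy : φ e.1 ≠ φ e.2) :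
    (∃ c' : V → ℕ, IsCol R c' ∧ c' (φ 0) ≠ c' (φ (attach typ e.1 e.2 8).2)) ∨
      typ = 0 ∧ S.k = 6 ∧ (e = (5, 2) ∨ e = (5, 4)) ∧ (∀ i ∈ S.ord, φ 8 ≠ φ i) ∧
        ∃ Q, R Q (φ 5) ∧ (∀ i ∈ S.ord, Q ≠ φ i) ∧
          c (φ 7) = c (φ 6) ∧ c (φ 8) = c (φ 6) := by
  obtain ⟨k6, k5, o8, o9, o6, o7, o0, hidx⟩ := pats_index S hS
  have hz : ∀ X, φ X = φ 8 → φ e.2 ≠ φ (if typ = 2 then e.1 else X) := by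
    intro X hX
    split_ifs
    · exact hxy.symm
    · rw [hX]; exact h8y.symm
  have hinj0 : ∀ i ∈ S.ord, ∀ j ∈ 6 :: 7 :: S.ord, i ≠ j → φ i ≠ φ j := by
    intro i hi j hj hij
    by_cases hi0 : i = 0
    · subst hi0; exact (h0 j hj hij.symm).symm
    · by_cases hj0 : j = 0
      · subst hj0; exact h0 i (by simp [hi]) hi0
      · exact hinj i hi hi0 j hj hj0 hij
  by_cases h85 : 5 ∈ S.ord ∧ φ 8 = φ 5
  · -- the neighbour `φ 8` of `φ 0` is the vertex `5` of the configuration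
    obtain ⟨o5, h85⟩ := h85
    left
    have hBe : φ (attach typ e.1 e.2 5).2 = φ (attach typ e.1 e.2 8).2 := by
      simp only [List.mem_cons, List.not_mem_nil, or_false] at ht
      rcases ht with rfl | rfl | rfl
      exacts [rfl, rfl, h85.symm]
    have harcs5 : ∀ p ∈ cfg S e typ 5 0, R (φ p.1) (φ p.2) := by
      intro p hp
      simp only [cfg, List.mem_append] at hp
      rcases hp with hp | hp | hp
      · exact harcs p (by simp [cfg, hp])
      · simp only [List.mem_cons, List.not_mem_nil, or_false] at ht
        rcases ht with rfl | rfl | rfl <;>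
          simp only [attach, List.mem_cons, List.not_mem_nil, or_false] at hp <;>
          rcases hp with rfl | rfl
        · exact harcs (e.2, 0) (by simp [cfg, attach])
        · have := harcs (8, 0) (by simp [cfg, attach])
          dsimp only at this ⊢
          rwa [← h85]
        · exact harcs (e.2, 0) (by simp [cfg, attach])
        · have := harcs (0, 8) (by simp [cfg, attach])
          dsimp only at this ⊢
          rwa [← h85]
        · exact harcs (e.2, 0) (by simp [cfg, attach])
        · exact harcs (0, e.1) (by simp [cfg, attach])
      · simp [third] at hp
    have hv : Valid S e 5 0 := by
      refine Or.inr ⟨rfl, rfl, k6 o5, ?_, ?_⟩ <;> intro h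
      · rw [h] at h8x; exact h8x h85
      · rw [h] at h8y; exact h8y h85
    rw [← hBe] at hB ⊢
    refine cfg_recolour hR hc hS he ht (by simp) (by simp) hv harcs5 hdeg hB ha (hz 5 h85.symm) ?_
      (fun _ _ h => absurd rfl h) ?_
    · intro i hi j hj hij
      refine hinj0 i hi j ?_ hij
      simp [trm] at hj ⊢
      clear * - hj
      tauto
    · intro h; simp [exceptional] at h
  · have h8 : ∀ i ∈ S.ord, φ 8 ≠ φ i := by
      intro i hi h8i
      have hi0 : i ≠ 0 := by rintro rfl; exact h80 h8i
      have hi5 : i ≠ 5 := by rintro rfl; exact h85 ⟨hi, h8i⟩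
      have hix : i ≠ e.1 := by rintro rfl; exact h8x h8i
      have hiy : i ≠ e.2 := by rintro rfl; exact h8y h8i
      obtain ⟨g1, g2, g3, g4⟩ := cfg_far S hS e he i hi hi0 hi5 hix hiy
      have hm : ∀ w ∈ (nbrs (S.arcs.erase e) i).map φ, R (φ i) w ∨ R w (φ i) := by
        intro w hw
        obtain ⟨j, hj, rfl⟩ := List.mem_map.1 hw
        exact (mem_nbrs hj).imp (fun h => harcs (i, j) (List.mem_append_left _ h))
          (fun h => harcs (j, i) (List.mem_append_left _ h))
      have hnd : ((nbrs (S.arcs.erase e) i).map φ).Nodup := by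
        refine nodup_map_of g1 fun j hj k hk hjk => ?_
        rcases g4 j hj k hk hjk with h | h
        · exact hinj0 j h k (g3 k hk).1 hjk
        · exact (hinj0 k h j (g3 j hj).1 hjk.symm).symm
      have h0l : φ 0 ∉ (nbrs (S.arcs.erase e) i).map φ := by
        intro h
        obtain ⟨j, hj, hj0⟩ := List.mem_map.1 h
        exact h0 j (g3 j hj).1 (g3 j hj).2 hj0
      simp only [List.mem_cons, List.not_mem_nil, or_false] at ht
      have hlong : R (φ i) (φ 0) ∨ R (φ 0) (φ i) → False := by
        intro h
        have := length_le_nb (l := φ 0 :: (nbrs (S.arcs.erase e) i).map φ)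
          (List.nodup_cons.2 ⟨h0l, hnd⟩)
          (by intro w hw; rcases List.mem_cons.1 hw with rfl | hw; exacts [h, hm w hw])
        have h3 := hdeg (φ i)
        simp only [List.length_cons, List.length_map] at this
        omega
      rcases ht with rfl | rfl | rfl
      · exact hlong (Or.inl (h8i ▸ harcs (8, 0) (by simp [cfg, attach])))
      · exact hlong (Or.inr (h8i ▸ harcs (0, 8) (by simp [cfg, attach])))
      · have := length_le_nb hnd hm
        rw [← h8i, List.length_map] at this
        have h2 : (nb R (φ 8)).card ≤ 2 := hB
        omega
    have hinj8 : ∀ i ∈ S.ord, ∀ j ∈ 6 :: (S.ord ++ trm 8 0), i ≠ j → φ i ≠ φ j := by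
      intro i hi j hj hij
      by_cases hj8 : j = 8
      · subst hj8; exact (h8 i hi).symm
      · refine hinj0 i hi j ?_ hij
        simp [trm] at hj ⊢
        clear * - hj hj8
        tauto
    have hv0 : Valid S e 8 0 := Or.inl ⟨rfl, Or.inl rfl⟩
    by_cases hcl : 5 ∈ S.ord → ∀ w, R (φ 5) w ∨ R w (φ 5) →
      ∃ j ∈ nbrs (cfg S e typ 8 0) 5, φ j = w
    · left
      refine cfg_recolour hR hc hS he ht (by simp) (by simp) hv0 harcs hdeg hB ha (hz 8 rfl) hinj8
        (fun h _ _ => hcl h) ?_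
      intro h; simp [exceptional] at h
    · push Not at hcl
      obtain ⟨o5, Q, hQ, hQn⟩ := hcl
      have hQi : ∀ i ∈ S.ord, Q ≠ φ i := by
        rintro i hi rfl
        by_cases hi5 : i = 5
        · subst hi5
          rcases hQ with h | h <;> exact hR _ _ h h
        · obtain ⟨j, hj, hj5⟩ := cfg_complete hS he ht (by simp) (by simp) hv0 harcs hdeg hB ha
            (hz 8 rfl) hinj8 hi (fun h => absurd h hi5) hQ.symm
          have hjl := (cfg_index S hS e he typ ht 8 (by simp) 0 (by simp) hv0).2.2.2.2 i hi j hj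
          have : j = 5 := by
            by_contra hne
            exact hinj8 5 o5 j hjl (Ne.symm hne) hj5.symm
          subst this
          exact hQn i (mem_nbrs_symm hj) rfl
      -- the third neighbour of the vertex `5` gets the index `9`
      let ψ : ℕ → V := Function.update φ 9 Q
      have hψ9 : ψ 9 = Q := Function.update_self ..
      have hψ : ∀ i, i ≠ 9 → ψ i = φ i := fun i hi => Function.update_of_ne hi ..
      have hψo : ∀ i ∈ S.ord, ψ i = φ i := fun i hi => hψ i (fun h => o9 (h ▸ hi))
      have he9 : e.1 ≠ 9 ∧ e.2 ≠ 9 := by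
        have := hidx e he
        simp only [List.mem_cons] at this
        constructor <;> intro h <;> rw [h] at this <;> simp [o9] at this
      have hψB : ψ (attach typ e.1 e.2 8).2 = φ (attach typ e.1 e.2 8).2 := by
        apply hψ
        simp only [List.mem_cons, List.not_mem_nil, or_false] at ht
        rcases ht with rfl | rfl | rfl
        exacts [he9.1, he9.1, by simp [attach]]
      have hbase : ∀ p ∈ cfg S e typ 8 0, R (ψ p.1) (ψ p.2) := by
        intro p hp
        have hp9 : p.1 ≠ 9 ∧ p.2 ≠ 9 := by
          simp only [cfg, List.mem_append] at hp
          rcases hp with hp | hp | hp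
          · have := hidx p (List.mem_of_mem_erase hp)
            simp only [List.mem_cons] at this
            constructor <;> intro h <;> rw [h] at this <;> simp [o9] at this
          · simp only [List.mem_cons, List.not_mem_nil, or_false] at ht
            rcases ht with rfl | rfl | rfl <;>
              simp only [attach, List.mem_cons, List.not_mem_nil, or_false] at hp <;>
              rcases hp with rfl | rfl <;> simp [he9]
          · simp [third] at hp
        rw [hψ _ hp9.1, hψ _ hp9.2]
        exact harcs p hp
      have hψ5 : ψ 5 = φ 5 := hψ 5 (by simp)
      have main : ∀ q, q = 1 ∨ q = 2 → (∀ p ∈ third q, R (ψ p.1) (ψ p.2)) →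
          (exceptional S e typ 8 q = true → ∃ t ∈ trm 8 q, c (ψ t) ≠ c (ψ 6)) →
          ∃ c' : V → ℕ, IsCol R c' ∧ c' (φ 0) ≠ c' (φ (attach typ e.1 e.2 8).2) := by
        intro q hq h3 hex
        have hq0 : q ≠ 0 := by omega
        have hvq : Valid S e 8 q := Or.inl ⟨rfl, Or.inr ⟨k6 o5, hq⟩⟩
        rw [← hψB] at hB ⊢
        rw [← hψo 0 o0] at ha ⊢
        refine cfg_recolour hR hc hS he ht (by simp) (by rcases hq with rfl | rfl <;> simp) hvq ?_
          hdeg hB ha ?_ ?_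
          (fun _ h => absurd h hq0) hex
        · intro p hp
          simp only [cfg, List.mem_append] at hp
          rcases hp with hp | hp | hp
          · exact hbase p (by simp [cfg, hp])
          · exact hbase p (by simp [cfg, hp])
          · exact h3 p hp
        · rw [hψ _ he9.2, hψ]
          · exact hz 8 rfl
          · split_ifs
            exacts [he9.1, by simp]
        · intro i hi j hj hij
          rw [hψo i hi]
          by_cases hj9 : j = 9
          · subst hj9; rw [hψ9]; exact (hQi i hi).symm
          · rw [hψ j hj9]
            refine hinj8 i hi j ?_ hij
            simp [trm, hq0] at hj ⊢
            clear * - hj hj9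
            tauto
      rcases hQ with hQ | hQ
      · left
        refine main 1 (Or.inl rfl) ?_ ?_
        · simpa [third, hψ9, hψ5] using hQ
        · intro h; simp [exceptional] at h
      · by_cases hex : exceptional S e typ 8 2 = true ∧ ¬ ∃ t ∈ trm 8 2, c (ψ t) ≠ c (ψ 6)
        · right
          obtain ⟨hx, hn⟩ := hex
          push Not at hn
          simp only [exceptional, Bool.and_eq_true, beq_iff_eq, Bool.or_eq_true] at hx
          have e7 := hn 7 (by simp [trm])
          have e8 := hn 8 (by simp [trm])
          rw [hψ 6 (by simp)] at e7 e8
          rw [hψ 7 (by simp)] at e7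
          rw [hψ 8 (by simp)] at e8
          exact ⟨hx.1.1.1.1, hx.1.2, hx.2, h8, Q, hQ, hQi, e7, e8⟩
        · left
          refine main 2 (Or.inr rfl) ?_ ?_
          · simpa [third, hψ9, hψ5] using hQ
          · intro h
            by_contra h'
            exact hex ⟨h, h'⟩

end

/-! ### Removing a vertex of degree two -/

section

variable {V : Type*}

/-- The relation `R` with the vertices `v` and `a` replaced by the arc `(x, y)`. -/
def rep (R : V → V → Prop) (v a x y u w : V) : Prop :=
  del (del R v) a u w ∨ (u = x ∧ w = y)

/-- An arc of a configuration is determined by its ends, even if the terminals coincide. -/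
theorem pats_arc : ∀ S ∈ pats, ∀ e ∈ S.arcs, ∀ p ∈ S.arcs, p ≠ e →
    (p.1 ≠ e.1 ∧ (p.1 ∈ S.ord ∨ e.1 ∈ S.ord)) ∨ (p.2 ≠ e.2 ∧ (p.2 ∈ S.ord ∨ e.2 ∈ S.ord)) := by
  decide +kernel

theorem pats_ord : ∀ S ∈ pats, ∀ j ∈ 6 :: 7 :: S.ord, j ≠ 0 →
    ∃ p ∈ S.arcs, p.1 = j ∨ p.2 = j := by
  decide +kernel

theorem pats_nodup : ∀ S ∈ pats, S.arcs.Nodup := by decide +kernel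

theorem Occ.eq_arc {R : V → V → Prop} {S : Pat} (hS : S ∈ pats) {φ : ℕ → V} (h : Occ R S φ)
    {e p : ℕ × ℕ} (he : e ∈ S.arcs) (hp : p ∈ S.arcs) (h1 : φ p.1 = φ e.1) (h2 : φ p.2 = φ e.2) :
    p = e := by
  by_contra hne
  obtain ⟨-, -, -, -, -, -, -, hidx⟩ := pats_index S hS
  obtain ⟨⟨e1, e1'⟩, e2, e2'⟩ := hidx e he
  obtain ⟨⟨p1, p1'⟩, p2, p2'⟩ := hidx p hp
  rcases pats_arc S hS e he p hp hne with ⟨hn, ho | ho⟩ | ⟨hn, ho | ho⟩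
  · exact h.inj _ ho p1' _ e1 e1' hn h1
  · exact h.inj _ ho e1' _ p1 p1' (Ne.symm hn) h1.symm
  · exact h.inj _ ho p2' _ e2 e2' hn h2
  · exact h.inj _ ho e2' _ p2 p2' (Ne.symm hn) h2.symm

variable [Fintype V]

/-- The situation in the induction step: `v` is a vertex of degree two with one in-neighbour and
one out-neighbour, and these neighbours `a` and `b` are not adjacent. -/
structure Ctx (R : V → V → Prop) (v a b : V) : Prop where
  good : Good R
  mixed : (R a v ∧ R v b) ∨ (R v a ∧ R b v)
  nbv : ∀ w, R v w ∨ R w v → w = a ∨ w = b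
  nab : ¬ R a b
  nba : ¬ R b a
  ih : ∀ R' : V → V → Prop, Good R' → size R' < size R → ∃ c, IsCol R' c

/-- If the vertex `v` has the neighbours `a` and `b` only, one of them an in-neighbour and the
other one an out-neighbour, then it suffices to colour the graph without `v` so that `a` and `b`
get different colours. -/
theorem Good.finish {R : V → V → Prop} (h : Good R) {v a b : V}
    (hm : (R a v ∧ R v b) ∨ (R v a ∧ R b v)) (hnb : ∀ w, R v w ∨ R w v → w = a ∨ w = b)
    {c : V → ℕ} (hc : IsCol (del R v) c) (hab : c a ≠ c b) : ∃ c, IsCol R c := by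
  have key : ∀ i < 7, ∀ j < 7, i ≠ j → ∃ α < 7, adj i α = true ∧ adj α j = true := by decide
  have fin : ∀ x y, R x v → R v y → (∀ w, R v w ∨ R w v → w = x ∨ w = y) → c x ≠ c y →
      ∃ c, IsCol R c := by
    intro x y hx hy hn hxy
    obtain ⟨α, hα, h1, h2⟩ := key _ (hc.1 x) _ (hc.1 y) hxy
    obtain ⟨c', hc', -⟩ := IsCol.extend (v := v) h.irrefl hc hα
      (by
        intro w hw
        rcases hn w (Or.inl hw) with rfl | rfl
        · exact absurd hx (h.asymm _ _ hw)
        · exact h2)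
      (by
        intro w hw
        rcases hn w (Or.inr hw) with rfl | rfl
        · exact h1
        · exact absurd hw (h.asymm _ _ hy))
    exact ⟨c', hc'⟩
  rcases hm with ⟨h1, h2⟩ | ⟨h1, h2⟩
  · exact fin a b h1 h2 hnb hab
  · exact fin b a h2 h1 (fun w hw => (hnb w hw).symm) hab.symm

namespace Ctx

variable {R : V → V → Prop} {v a b : V}

theorem flip (h : Ctx R v a b) : Ctx (flip R) v a b where
  good := h.good.flip
  mixed := h.mixed.symm
  nbv w hw := h.nbv w hw.symm
  nab := h.nba
  nba := h.nab
  ih R' hR' hs := by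
    obtain ⟨c, hc⟩ := h.ih _ hR'.flip (by rw [size_flip] at hs ⊢; exact hs)
    exact ⟨_, hc.flip⟩

theorem av (h : Ctx R v a b) : R a v ∨ R v a := h.mixed.imp And.left And.left

theorem bv (h : Ctx R v a b) : R b v ∨ R v b := (h.mixed.imp And.right And.right).symm

theorem ne (h : Ctx R v a b) : a ≠ b := by
  rintro rfl
  rcases h.mixed with ⟨h1, h2⟩ | ⟨h1, h2⟩ <;> exact h.good.asymm _ _ h1 h2

theorem a_ne_v (h : Ctx R v a b) : a ≠ v := by
  rintro rfl
  rcases h.av with h1 | h1 <;> exact h.good.irrefl _ h1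

theorem b_ne_v (h : Ctx R v a b) : b ≠ v := by
  rintro rfl
  rcases h.bv with h1 | h1 <;> exact h.good.irrefl _ h1

theorem finish (h : Ctx R v a b) {c : V → ℕ} (hc : IsCol (del R v) c) (hab : c a ≠ c b) :
    ∃ c, IsCol R c :=
  h.good.finish h.mixed h.nbv hc hab

/-- It suffices to find, for a colouring of the graph without `v` and `a`, an admissible colour
of `a` that differs from the colour of `b`. -/
theorem finish_of_ext (h : Ctx R v a b) {c : V → ℕ} (hc : IsCol (del (del R v) a) c) {α : ℕ}
    (hα : α < 7) (hab : α ≠ c b) (hout : ∀ w, del R v a w → adj α (c w) = true)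
    (hin : ∀ w, del R v w a → adj (c w) α = true) : ∃ c, IsCol R c := by
  obtain ⟨c', hc', h1, h2⟩ := IsCol.extend (R := del R v) (v := a)
    (fun u hu => h.good.irrefl u hu.1) hc hα hout hin
  refine h.finish hc' ?_
  rwa [h1, h2 b h.ne.symm]

theorem exists_del (h : Ctx R v a b) : ∃ c, IsCol (del R v) c := by
  refine h.ih _ (h.good.mono fun _ _ h => h.1) ?_
  rcases h.av with h1 | h1
  · exact size_lt (fun _ _ h => h.1) h1 fun h2 => h2.2.2 rfl
  · exact size_lt (fun _ _ h => h.1) h1 fun h2 => h2.2.1 rfl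

theorem exists_del_del (h : Ctx R v a b) : ∃ c, IsCol (del (del R v) a) c := by
  obtain ⟨c, hc⟩ := h.exists_del
  exact ⟨c, hc.mono fun _ _ h => h.1⟩

theorem card_a (h : Ctx R v a b) : (nb (del R v) a).card ≤ 2 := by
  have := card_nb_del_lt h.av
  have := h.good.deg a
  omega

theorem card_b (h : Ctx R v a b) : (nb (del R v) b).card ≤ 2 := by
  have := card_nb_del_lt h.bv
  have := h.good.deg b
  omega

theorem card_del (h : Ctx R v a b) (u : V) : (nb (del R v) u).card ≤ 3 :=
  (Finset.card_le_card (nb_mono (fun _ _ h => h.1) u)).trans (h.good.deg u)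

theorem asymm_del (h : Ctx R v a b) (u w : V) (h1 : del R v u w) : ¬ del R v w u :=
  fun h2 => h.good.asymm _ _ h1.1 h2.1

/-- The bridge case: only the arc `(p, q)` leaves the set `W`. -/
theorem bridge (h : Ctx R v a b) (W : V → Prop) {p q : V} (hpq : R p q) (hW : W p ↔ ¬ W q)
    (hr : ∀ u w, R u w → ¬ (u = p ∧ w = q) → (W u ↔ W w)) : ∃ c, IsCol R c := by
  obtain ⟨c, hc⟩ := h.ih (fun u w => R u w ∧ ¬ (u = p ∧ w = q)) (h.good.mono fun _ _ h => h.1)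
    (size_lt (fun _ _ h => h.1) hpq fun h => h.2 ⟨rfl, rfl⟩)
  exact hc.bridge W hW hr

/-- Replace `v` and `a` by an arc `(x, y)`.  Either the result has a colouring by induction, or
it has a cubic component, or the new arc lies in an excluded configuration. -/
theorem replace (h : Ctx R v a b) {x y : V} (hxy : x ≠ y) (hyx : ¬ R y x) (hxa : x ≠ a)
    (hya : y ≠ a) (hxv : x ≠ v) (hyv : y ≠ v) {p q : V} (hpq : del R v p q) (hpa : p = a ∨ q = a)
    (hx : (nb (del (del R v) a) x).card ≤ 2) (hy : (nb (del (del R v) a) y).card ≤ 2) :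
    (∃ c, IsCol (rep R v a x y) c) ∨
    (∃ U : V → Prop, U x ∧ U y ∧ ¬ U a ∧ ¬ U v ∧
      (∀ u w, del (del R v) a u w → (U u ↔ U w)) ∧ ∀ u, U u → 3 ≤ (nb (rep R v a x y) u).card) ∨
    ∃ S ∈ pats, ∃ φ, ∃ e ∈ S.arcs, Occ (rep R v a x y) S φ ∧ φ e.1 = x ∧ φ e.2 = y := by
  classical
  have hsub : ∀ u w, del (del R v) a u w → R u w := fun _ _ h => h.1.1
  have hdeg : ∀ u, (nb (rep R v a x y) u).card ≤ 3 := by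
    intro u
    by_cases hux : u = x
    · subst hux
      have : nb (rep R v a u y) u ⊆ insert y (nb (del (del R v) a) u) := by
        intro w hw
        rw [mem_nb] at hw
        rw [Finset.mem_insert, mem_nb]
        rcases hw with (hw | hw) | (hw | hw)
        · exact Or.inr (Or.inl hw)
        · exact Or.inl hw.2
        · exact Or.inr (Or.inr hw)
        · exact absurd hw.2 hxy
      exact (Finset.card_le_card this).trans ((Finset.card_insert_le _ _).trans (by omega))
    · by_cases huy : u = y
      · subst huy
        have : nb (rep R v a x u) u ⊆ insert x (nb (del (del R v) a) u) := by
          intro w hw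
          rw [mem_nb] at hw
          rw [Finset.mem_insert, mem_nb]
          rcases hw with (hw | hw) | (hw | hw)
          · exact Or.inr (Or.inl hw)
          · exact absurd hw.1 hux
          · exact Or.inr (Or.inr hw)
          · exact Or.inl hw.1
        exact (Finset.card_le_card this).trans ((Finset.card_insert_le _ _).trans (by omega))
      · refine (Finset.card_le_card ?_).trans (h.good.deg u)
        intro w hw
        rw [mem_nb] at hw ⊢
        rcases hw with (hw | hw) | (hw | hw)
        · exact Or.inl (hsub _ _ hw)
        · exact absurd hw.1 hux
        · exact Or.inr (hsub _ _ hw)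
        · exact absurd hw.2 huy
  have hasymm : ∀ u w, rep R v a x y u w → ¬ rep R v a x y w u := by
    rintro u w (h1 | ⟨rfl, rfl⟩) (h2 | ⟨h3, h4⟩)
    · exact h.good.asymm _ _ (hsub _ _ h1) (hsub _ _ h2)
    · subst h3 h4; exact hyx (hsub _ _ h1)
    · exact hyx (hsub _ _ h2)
    · exact hxy h4
  by_cases hprop : ∀ U : Finset V, U.Nonempty → ∃ u ∈ U, (nb (rep R v a x y) u ∩ U).card ≤ 2
  · by_cases hfree : ∀ S ∈ pats, ∀ φ, ¬ Occ (rep R v a x y) S φ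
    · left
      refine h.ih _ ⟨hasymm, hdeg, ?_, hfree⟩ ?_
      · convert hprop
      · have hv : ∃ p' q', R p' q' ∧ (p' = v ∨ q' = v) := by
          rcases h.av with h1 | h1
          · exact ⟨_, _, h1, Or.inr rfl⟩
          · exact ⟨_, _, h1, Or.inl rfl⟩
        obtain ⟨p', q', hp', hv⟩ := hv
        refine size_lt_of_replace (x := x) (y := y) (x1 := p) (y1 := q) (x2 := p') (y2 := q') ?_
          hpq.1 hp' ?_
        · rintro u w (h1 | h1)
          · refine Or.inl ⟨hsub _ _ h1, ?_, ?_⟩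
            · rintro ⟨rfl, rfl⟩
              rcases hpa with rfl | rfl
              exacts [h1.2.1 rfl, h1.2.2 rfl]
            · rintro ⟨rfl, rfl⟩
              rcases hv with rfl | rfl
              exacts [h1.1.2.1 rfl, h1.1.2.2 rfl]
          · exact Or.inr h1
        · rintro ⟨rfl, rfl⟩
          rcases hv with rfl | rfl
          exacts [hpq.2.1 rfl, hpq.2.2 rfl]
    · right; right
      push Not at hfree
      obtain ⟨S, hS, φ, hφ⟩ := hfree
      by_cases he : ∃ e ∈ S.arcs, φ e.1 = x ∧ φ e.2 = y
      · obtain ⟨e, he, h1, h2⟩ := he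
        exact ⟨S, hS, φ, e, he, hφ, h1, h2⟩
      · exfalso
        refine h.good.free S hS φ ⟨fun p hp => ?_, hφ.inj⟩
        rcases hφ.arcs p hp with h1 | h1
        · exact hsub _ _ h1
        · exact absurd ⟨p, hp, h1⟩ he
  · right; left
    push Not at hprop
    obtain ⟨U, hU, hU3⟩ := hprop
    have hin : ∀ u ∈ U, nb (rep R v a x y) u ⊆ U := by
      intro u hu
      have : nb (rep R v a x y) u ∩ U = nb (rep R v a x y) u :=
        Finset.eq_of_subset_of_card_le Finset.inter_subset_left ((hdeg u).trans (hU3 u hu))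
      exact Finset.inter_eq_left.1 this
    have h3 : ∀ u ∈ U, 3 ≤ (nb (rep R v a x y) u).card := fun u hu =>
      le_trans (hU3 u hu) (Finset.card_le_card Finset.inter_subset_left)
    have hboth : x ∈ U ∧ y ∈ U := by
      by_contra hn
      obtain ⟨u, hu, hu2⟩ := h.good.proper U hU
      have h4 := hU3 u hu
      have : nb (rep R v a x y) u ∩ U ⊆ nb R u ∩ U := by
        intro w hw
        rw [Finset.mem_inter, mem_nb] at hw ⊢
        refine ⟨?_, hw.2⟩
        rcases hw.1 with (h1 | h1) | (h1 | h1)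
        · exact Or.inl (hsub _ _ h1)
        · exact absurd ⟨h1.1 ▸ hu, h1.2 ▸ hw.2⟩ hn
        · exact Or.inr (hsub _ _ h1)
        · exact absurd ⟨h1.1 ▸ hw.2, h1.2 ▸ hu⟩ hn
      have h5 := Finset.card_le_card this
      have h6 : (nb R u ∩ U).card ≤ 2 := by convert hu2
      omega
    have hempty : ∀ u, (∀ w, ¬ rep R v a x y u w ∧ ¬ rep R v a x y w u) → u ∉ U := by
      intro u hu huU
      have := Finset.card_pos.1 (lt_of_lt_of_le (by omega) (h3 u huU))
      obtain ⟨w, hw⟩ := this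
      rw [mem_nb] at hw
      exact hw.elim (hu w).1 (hu w).2
    refine ⟨fun u => u ∈ U, hboth.1, hboth.2, hempty a fun w => ⟨?_, ?_⟩,
      hempty v fun w => ⟨?_, ?_⟩, fun u w huw => ⟨fun hu => ?_, fun hw => ?_⟩, h3⟩
    · rintro (h1 | h1)
      exacts [h1.2.1 rfl, hxa h1.1.symm]
    · rintro (h1 | h1)
      exacts [h1.2.2 rfl, hya h1.2.symm]
    · rintro (h1 | h1)
      exacts [h1.1.2.1 rfl, hxv h1.1.symm]
    · rintro (h1 | h1)
      exacts [h1.1.2.2 rfl, hyv h1.2.symm]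
    · exact hin u hu (mem_nb.2 (Or.inl (Or.inl huw)))
    · exact hin w hw (mem_nb.2 (Or.inr (Or.inl huw)))

/-- Recolouring when the new arc `(x, y)` lies in an excluded configuration. -/
theorem of_occ (h : Ctx R v a b) {c : V → ℕ} (hc : IsCol (del R v) c) {x y X : V} (hxy : x ≠ y)
    (hxa : x ≠ a) (hya : y ≠ a) (hXa : X ≠ a) (hXx : X ≠ x) (hXy : X ≠ y)
    {S : Pat} (hS : S ∈ pats) {φ : ℕ → V} {e : ℕ × ℕ} (he : e ∈ S.arcs)
    (hφ : Occ (rep R v a x y) S φ) (hx : φ e.1 = x) (hy : φ e.2 = y) {typ : ℕ}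
    (ht : (typ = 0 ∧ del R v y a ∧ del R v X a ∧ x = b) ∨
      (typ = 1 ∧ del R v y a ∧ del R v a X ∧ x = b) ∨
      (typ = 2 ∧ del R v y a ∧ del R v a x ∧ X = b)) :
    (∃ c, IsCol R c) ∨
      typ = 0 ∧ S.k = 6 ∧ (e = (5, 2) ∨ e = (5, 4)) ∧ (∀ i ∈ S.ord, i ≠ 0 → X ≠ φ i) ∧
        ∃ Q, del R v Q (φ 5) ∧ (∀ i ∈ S.ord, i ≠ 0 → Q ≠ φ i) ∧
          c (φ 7) = c (φ 6) ∧ c X = c (φ 6) := by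
  obtain ⟨k6, k5, o8, o9, o6, o7, o0, hidx⟩ := pats_index S hS
  obtain ⟨⟨e1, e1'⟩, e2, e2'⟩ := hidx e he
  have ha : ∀ j ∈ 6 :: 7 :: S.ord, j ≠ 0 → φ j ≠ a := by
    intro j hj hj0 hja
    obtain ⟨p, hp, hpj⟩ := pats_ord S hS j hj hj0
    rcases hφ.arcs p hp with h1 | h1
    · rcases hpj with rfl | rfl
      exacts [h1.2.1 hja, h1.2.2 hja]
    · rcases hpj with rfl | rfl
      exacts [hxa (h1.1.symm.trans hja), hya (h1.2.symm.trans hja)]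
  let ψ : ℕ → V := fun i => if i = 0 then a else if i = 8 then X else φ i
  have hψ0 : ψ 0 = a := rfl
  have hψ8 : ψ 8 = X := rfl
  have hψ : ∀ j ∈ 6 :: 7 :: S.ord, j ≠ 0 → ψ j = φ j := by
    intro j hj hj0
    have : j ≠ 8 := by rintro rfl; simp [o8] at hj
    simp only [ψ, hj0, this, if_false]
  have hψo : ∀ j ∈ S.ord, j ≠ 0 → ψ j = φ j := fun j hj => hψ j (by simp [hj])
  have hψx : ψ e.1 = x := by rw [hψ _ e1 e1', hx]
  have hψy : ψ e.2 = y := by rw [hψ _ e2 e2', hy]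
  have hB : ψ (attach typ e.1 e.2 8).2 = b := by
    rcases ht with ⟨rfl, -, -, rfl⟩ | ⟨rfl, -, -, rfl⟩ | ⟨rfl, -, -, rfl⟩
    exacts [hψx, hψx, rfl]
  have htm : typ ∈ [0, 1, 2] := by
    rcases ht with ⟨rfl, -⟩ | ⟨rfl, -⟩ | ⟨rfl, -⟩ <;> simp
  have harcs : ∀ p ∈ cfg S e typ 8 0, del R v (ψ p.1) (ψ p.2) := by
    intro p hp
    simp only [cfg, List.mem_append] at hp
    rcases hp with hp | hp | hp
    · obtain ⟨hne, hp⟩ := ((pats_nodup S hS).mem_erase_iff).1 hp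
      obtain ⟨⟨p1, p1'⟩, p2, p2'⟩ := hidx p hp
      rw [hψ _ p1 p1', hψ _ p2 p2']
      rcases hφ.arcs p hp with h1 | h1
      · exact h1.1
      · exact absurd (hφ.eq_arc hS he hp (h1.1.trans hx.symm) (h1.2.trans hy.symm)) hne
    · rcases ht with ⟨rfl, g1, g2, rfl⟩ | ⟨rfl, g1, g2, rfl⟩ | ⟨rfl, g1, g2, rfl⟩ <;>
        simp only [attach, List.mem_cons, List.not_mem_nil, or_false] at hp <;>
        rcases hp with rfl | rfl <;> dsimp only
      · rw [hψ0, hψy]; exact g1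
      · exact g2
      · rw [hψ0, hψy]; exact g1
      · exact g2
      · rw [hψ0, hψy]; exact g1
      · rw [hψ0, hψx]; exact g2
    · simp [third] at hp
  rcases exists_recolouring h.asymm_del hc hS he htm harcs h.card_del (by rw [hB]; exact h.card_b)
    h.card_a (fun i hi hi0 j hj hj0 hij => by
      rw [hψo i hi hi0, hψ j hj hj0]; exact hφ.inj i hi hi0 j hj hj0 hij)
    (fun j hj hj0 => by rw [hψ j hj hj0]; exact ha j hj hj0)
    hXa (by rw [hψx]; exact hXx) (by rw [hψy]; exact hXy) (by rw [hψx, hψy]; exact hxy) with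
    ⟨c', hc', hne⟩ | ⟨g1, g2, g3, g4, Q, g5, g6, g7, g8⟩
  · left
    rw [hB] at hne
    exact h.finish hc' hne
  · right
    refine ⟨g1, g2, g3, fun i hi hi0 => ?_, Q, ?_, fun i hi hi0 => ?_, g7, g8⟩
    · rw [← hψo i hi hi0]; exact g4 i hi
    · exact g5
    · rw [← hψo i hi hi0]; exact g6 i hi

end Ctx

end

section

variable {V : Type*}

theorem inj_of_nodup {φ : ℕ → V} {is ts : List ℕ} (h : (is.map φ).Nodup)
    (ht : ∀ t ∈ ts, φ t ∉ is.map φ) : ∀ i ∈ is, ∀ j, j ∈ is ∨ j ∈ ts → i ≠ j → φ i ≠ φ j := by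
  rintro i hi j (hj | hj) hij he
  · exact hij (List.inj_on_of_nodup_map h hi hj he)
  · exact ht j hj (he ▸ List.mem_map_of_mem hi)

variable [Fintype V]

theorem complete_of_card {R : V → V → Prop} {L : List (ℕ × ℕ)} {φ : ℕ → V}
    (harcs : ∀ p ∈ L, R (φ p.1) (φ p.2)) {vs l : List ℕ}
    (hinj : ∀ i ∈ vs, ∀ j ∈ l, i ≠ j → φ i ≠ φ j) {i : ℕ}
    (hn : (nbrs L i).Nodup ∧ (∀ j ∈ nbrs L i, j ∈ l) ∧
      ∀ j ∈ nbrs L i, ∀ k ∈ nbrs L i, j ≠ k → j ∈ vs ∨ k ∈ vs)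
    (hc : (nb R (φ i)).card ≤ (nbrs L i).length) {w : V} (hw : R (φ i) w ∨ R w (φ i)) :
    ∃ j ∈ l, φ j = w ∧ ((i, j) ∈ L ∨ (j, i) ∈ L) := by
  have : w ∈ (nbrs L i).map φ := by
    refine mem_of_nb_le (nodup_map_of hn.1 fun j hj k hk hjk => ?_) ?_ (by simpa using hc) hw
    · rcases hn.2.2 j hj k hk hjk with h | h
      · exact hinj j h k (hn.2.1 k hk) hjk
      · exact (hinj k h j (hn.2.1 j hj) hjk.symm).symm
    · intro w hw
      obtain ⟨j, hj, rfl⟩ := List.mem_map.1 hw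
      exact (mem_nbrs hj).imp (harcs _) (harcs _)
  obtain ⟨j, hj, rfl⟩ := List.mem_map.1 this
  exact ⟨j, hn.2.1 j hj, rfl, mem_nbrs hj⟩

/-- Recolouring for a configuration in which degrees show that all neighbours of internal vertices
are listed. -/
theorem IsCol.recolour_of_card {R : V → V → Prop} (hR : ∀ u w, R u w → ¬ R w u) {c : V → ℕ}
    (hc : IsCol R c) {φ : ℕ → V} {L : List (ℕ × ℕ)} {b : ℕ} {vs ts : List ℕ}
    (h : check false L b vs ts = true) (hn : (6 :: (vs ++ ts)).Nodup) (h0 : 0 ∈ vs)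
    (hb : b ∈ 6 :: (vs ++ ts)) (hb0 : b ≠ 0) (harcs : ∀ p ∈ L, R (φ p.1) (φ p.2))
    (hnd : (vs.map φ).Nodup) (hts : ∀ t ∈ 6 :: ts, φ t ∉ vs.map φ)
    (hlist : ∀ i ∈ vs, (nbrs L i).Nodup ∧ (∀ j ∈ nbrs L i, j ∈ 6 :: (vs ++ ts)) ∧
      ∀ j ∈ nbrs L i, ∀ k ∈ nbrs L i, j ≠ k → j ∈ vs ∨ k ∈ vs)
    (hcard : ∀ i ∈ vs, (nb R (φ i)).card ≤ (nbrs L i).length) :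
    ∃ c' : V → ℕ, IsCol R c' ∧ c' (φ 0) ≠ c' (φ b) := by
  have hinj : ∀ i ∈ vs, ∀ j ∈ 6 :: (vs ++ ts), i ≠ j → φ i ≠ φ j := by
    intro i hi j hj
    refine inj_of_nodup hnd hts i hi j ?_
    simp only [List.mem_cons, List.mem_append] at hj ⊢
    clear * - hj
    tauto
  exact hc.recolour hR h hn h0 hb hb0 harcs hinj
    (fun i hi w hw => complete_of_card harcs hinj (hlist i hi) (hcard i hi) hw) (by simp)

theorem exists_third {R : V → V → Prop} {u : V} (h : 3 ≤ (nb R u).card) (x y : V) :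
    ∃ t, (R u t ∨ R t u) ∧ t ≠ x ∧ t ≠ y := by
  classical
  obtain ⟨t, ht, hn⟩ := Finset.exists_mem_notMem_of_card_lt_card
    (lt_of_le_of_lt (Finset.card_le_two (a := x) (b := y)) h)
  simp only [Finset.mem_insert, Finset.mem_singleton, not_or] at hn
  exact ⟨t, mem_nb.1 ht, hn⟩

namespace Ctx

variable {R : V → V → Prop} {v a b : V}

set_option maxHeartbeats 1000000 in
/-- The case in which `a` and `b` have two common in-neighbours.  These are not adjacent, and their
third arcs are not oppositely directed, since the path through `v` would complete an excluded
configuration. -/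
theorem of_fourCycle (h : Ctx R v a b) {a1 a2 : V} (hne : a1 ≠ a2) (h1a : del R v a1 a)
    (h2a : del R v a2 a) (h1b : del R v a1 b) (h2b : del R v a2 b) : ∃ c, IsCol R c := by
  have irr := h.good.irrefl
  have ab := h.ne
  have av := h.a_ne_v
  have bv := h.b_ne_v
  have n1a : a1 ≠ a := by rintro rfl; exact irr _ h1a.1
  have n2a : a2 ≠ a := by rintro rfl; exact irr _ h2a.1
  have n1b : a1 ≠ b := by rintro rfl; exact irr _ h1b.1
  have n2b : a2 ≠ b := by rintro rfl; exact irr _ h2b.1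
  have n1v : a1 ≠ v := h1a.2.1
  have n2v : a2 ≠ v := h2a.2.1
  -- the path through `v`, directed from `m1` to `m2`
  obtain ⟨m1, m2, hm1, hm2, hm⟩ : ∃ m1 m2, R m1 v ∧ R v m2 ∧
      ((m1 = a ∧ m2 = b) ∨ (m1 = b ∧ m2 = a)) := by
    rcases h.mixed with ⟨g1, g2⟩ | ⟨g1, g2⟩
    exacts [⟨a, b, g1, g2, Or.inl ⟨rfl, rfl⟩⟩, ⟨b, a, g2, g1, Or.inr ⟨rfl, rfl⟩⟩]
  have h1m1 : R a1 m1 := by rcases hm with ⟨rfl, rfl⟩ | ⟨rfl, rfl⟩; exacts [h1a.1, h1b.1]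
  have h1m2 : R a1 m2 := by rcases hm with ⟨rfl, rfl⟩ | ⟨rfl, rfl⟩; exacts [h1b.1, h1a.1]
  have h2m1 : R a2 m1 := by rcases hm with ⟨rfl, rfl⟩ | ⟨rfl, rfl⟩; exacts [h2a.1, h2b.1]
  have h2m2 : R a2 m2 := by rcases hm with ⟨rfl, rfl⟩ | ⟨rfl, rfl⟩; exacts [h2b.1, h2a.1]
  have hm12 : m1 ≠ m2 := by
    rcases hm with ⟨rfl, rfl⟩ | ⟨rfl, rfl⟩
    exacts [ab, ab.symm]
  have hm1v : m1 ≠ v := by rintro rfl; exact irr _ hm1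
  have hm2v : m2 ≠ v := by rintro rfl; exact irr _ hm2
  have irm : ∀ u w, R u w → u ≠ w := by rintro u w huw rfl; exact irr _ huw
  have n1m1 := irm _ _ h1m1
  have n1m2 := irm _ _ h1m2
  have n2m1 := irm _ _ h2m1
  have n2m2 := irm _ _ h2m2
  have hE1 : ∀ x y, x ≠ y → R x m1 → R x m2 → R y m1 → R y m2 → x ≠ v → y ≠ v → ¬ R x y := by
    intro x y hxy g1 g2 g3 g4 hxv hyv hR
    have k1 := irm _ _ g1
    have k2 := irm _ _ g2
    have k3 := irm _ _ g3
    have k4 := irm _ _ g4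
    refine h.good.free _ (List.mem_cons_of_mem _ List.mem_cons_self)
      (fun i => [v, x, y, m1, m2, v, v, v].getD i v) ⟨?_, ?_⟩
    · simp; tauto
    · have := inj_of_nodup (φ := fun i => [v, x, y, m1, m2, v, v, v].getD i v) (is := [3, 1, 4, 2])
        (ts := [6, 7]) (by simp; tauto) (by simp; tauto)
      intro i hi hi0 j hj hj0 hij
      refine this i ?_ j ?_ hij
      · simp at hi ⊢; tauto
      · simp at hj ⊢; tauto
  have hn12 : ¬ R a1 a2 := hE1 a1 a2 hne h1m1 h1m2 h2m1 h2m2 n1v n2v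
  have hn21 : ¬ R a2 a1 := hE1 a2 a1 hne.symm h2m1 h2m2 h1m1 h1m2 n2v n1v
  have hE2 : ∀ x y t s, x ≠ y → R x m1 → R x m2 → R y m1 → R y m2 → x ≠ v → y ≠ v →
      R x t → R s y → t ≠ y → t ≠ m1 → t ≠ m2 → t ≠ v → s ≠ x → s ≠ m1 → s ≠ m2 → s ≠ v →
      False := by
    intro x y t s hxy g1 g2 g3 g4 hxv hyv hxt hsy ht1 ht2 ht3 ht4 hs1 hs2 hs3 hs4
    have k1 := irm _ _ g1
    have k2 := irm _ _ g2
    have k3 := irm _ _ g3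
    have k4 := irm _ _ g4
    have k5 := irm _ _ hxt
    have k6 := irm _ _ hsy
    refine h.good.free _ (List.mem_cons_of_mem _ (List.mem_cons_of_mem _ (List.mem_cons_of_mem _
      (List.mem_cons_of_mem _ List.mem_cons_self))))
      (fun i => [v, x, y, m1, m2, v, t, s].getD i v) ⟨?_, ?_⟩
    · simp; tauto
    · have := inj_of_nodup (φ := fun i => [v, x, y, m1, m2, v, t, s].getD i v)
        (is := [1, 3, 2, 4, 5]) (ts := [6, 7])
        (by simp; clear * - hxy k1 k2 k3 k4 hxv hyv hm12 hm1v hm2v; tauto)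
        (by
          simp
          clear * - ht1 ht2 ht3 ht4 hs1 hs2 hs3 hs4 k5 k6
          tauto)
      intro i hi hi0 j hj hj0 hij
      refine this i ?_ j ?_ hij
      · simp at hi ⊢; clear * - hi hi0; tauto
      · simp at hj ⊢; clear * - hj hj0; tauto
  have third : ∀ u u', del R v u a → del R v u b → ¬ R u u' → ¬ R u' u → ∃ p t,
      (p = 0 ∧ (nb (del R v) u).card ≤ 2 ∧ t = v ∨ p = 1 ∧ del R v u t ∨ p = 2 ∧ del R v t u) ∧
        (t = v ∨ t ≠ u' ∧ t ≠ a ∧ t ≠ b ∧ t ≠ v ∧ t ≠ u) := by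
    intro u u' hua hub hn1 hn2
    by_cases hc : (nb (del R v) u).card ≤ 2
    · exact ⟨0, v, Or.inl ⟨rfl, hc, rfl⟩, Or.inl rfl⟩
    · obtain ⟨t, ht, hta, htb⟩ := exists_third (not_le.1 hc) a b
      rcases ht with ht | ht
      · exact ⟨1, t, Or.inr (Or.inl ⟨rfl, ht⟩), Or.inr ⟨by rintro rfl; exact hn1 ht.1, hta, htb,
          ht.2.2, (irm _ _ ht.1).symm⟩⟩
      · exact ⟨2, t, Or.inr (Or.inr ⟨rfl, ht⟩), Or.inr ⟨by rintro rfl; exact hn2 ht.1, hta, htb,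
          ht.2.1, irm _ _ ht.1⟩⟩
  obtain ⟨p, t, hp, ht⟩ := third a1 a2 h1a h1b hn12 hn21
  obtain ⟨q, s, hq, hs⟩ := third a2 a1 h2a h2b hn21 hn12
  have hmn : ∀ z, z ≠ a → z ≠ b → z ≠ m1 ∧ z ≠ m2 := by
    rcases hm with ⟨rfl, rfl⟩ | ⟨rfl, rfl⟩
    exacts [fun z h1 h2 => ⟨h1, h2⟩, fun z h1 h2 => ⟨h2, h1⟩]
  have hpq : (p, q) ∈ [(0, 0), (0, 1), (0, 2), (1, 0), (2, 0), (1, 1), (2, 2)] := by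
    rcases hp with ⟨rfl, -⟩ | ⟨rfl, hp⟩ | ⟨rfl, hp⟩ <;>
      rcases hq with ⟨rfl, -⟩ | ⟨rfl, hq⟩ | ⟨rfl, hq⟩ <;> try simp
    · obtain ⟨t1, t2, t3, t4, -⟩ := ht.resolve_left hp.2.2
      obtain ⟨s1, s2, s3, s4, -⟩ := hs.resolve_left hq.2.1
      exact hE2 a1 a2 t s hne h1m1 h1m2 h2m1 h2m2 n1v n2v hp.1 hq.1 t1 (hmn t t2 t3).1
        (hmn t t2 t3).2 t4 s1 (hmn s s2 s3).1 (hmn s s2 s3).2 s4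
    · obtain ⟨t1, t2, t3, t4, -⟩ := ht.resolve_left hp.2.1
      obtain ⟨s1, s2, s3, s4, -⟩ := hs.resolve_left hq.2.2
      exact hE2 a2 a1 s t hne.symm h2m1 h2m2 h1m1 h1m2 n2v n1v hq.1 hp.1 s1 (hmn s s2 s3).1
        (hmn s s2 s3).2 s4 t1 (hmn t t2 t3).1 (hmn t t2 t3).2 t4
  obtain ⟨c, hc⟩ := h.exists_del
  have harcs : ∀ p' ∈ fourCycle p q, del R v ([a, a1, a2, b, v, v, t, s].getD p'.1 v)
      ([a, a1, a2, b, v, v, t, s].getD p'.2 v) := by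
    clear * - hp hq h1a h2a h1b h2b
    rcases hp with ⟨rfl, -⟩ | ⟨rfl, hp⟩ | ⟨rfl, hp⟩ <;>
      rcases hq with ⟨rfl, -⟩ | ⟨rfl, hq⟩ | ⟨rfl, hq⟩ <;> simp [fourCycle] <;> tauto
  have key : ∀ pq ∈ [(0, 0), (0, 1), (0, 2), (1, 0), (2, 0), (1, 1), (2, 2)],
      ∀ i ∈ [1, 2, 0, 3], (nbrs (fourCycle pq.1 pq.2) i).Nodup ∧
      (∀ j ∈ nbrs (fourCycle pq.1 pq.2) i, j ∈ 6 :: ([1, 2, 0, 3] ++ [7])) ∧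
      ∀ j ∈ nbrs (fourCycle pq.1 pq.2) i, ∀ k ∈ nbrs (fourCycle pq.1 pq.2) i, j ≠ k →
        j ∈ [1, 2, 0, 3] ∨ k ∈ [1, 2, 0, 3] := by
    decide +kernel
  obtain ⟨c', hc', hne'⟩ := hc.recolour_of_card h.asymm_del (check_fourCycle _ hpq) (by simp)
    (by simp) (by simp) (by simp) (φ := fun i => [a, a1, a2, b, v, v, t, s].getD i v) harcs
    (by simp; clear * - ab n1a n2a n1b n2b hne; tauto)
    (by
      simp
      constructor
      · clear * - ht av bv n1v n2v
        rcases ht with rfl | ht <;> tauto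
      · clear * - hs av bv n1v n2v
        rcases hs with rfl | hs <;> tauto)
    (key _ hpq)
    (by
      intro i hi
      have d1 := h.card_del a1
      have d2 := h.card_del a2
      have d3 := h.card_a
      have d4 := h.card_b
      clear * - hp hq d1 d2 d3 d4 hi
      rcases hp with ⟨rfl, hp, -⟩ | ⟨rfl, hp⟩ | ⟨rfl, hp⟩ <;>
        rcases hq with ⟨rfl, hq, -⟩ | ⟨rfl, hq⟩ | ⟨rfl, hq⟩ <;>
        simp only [List.mem_cons, List.not_mem_nil, or_false] at hi <;>
        rcases hi with rfl | rfl | rfl | rfl <;> assumption)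
  exact h.finish hc' hne'

end Ctx

end

/-! ### The exceptional configuration -/

section

variable {V : Type*}

/-- The configuration in which local recolouring fails: the vertices `u` and `x` are twins of an
oriented four-cycle with the other vertices `y` and `z`, the vertices `u` and `X` are the
in-neighbours of `a`, the vertices `x` and `Q` are those of `b`, and the vertices `T`, `S` and `X`
around the configuration have the same colour. -/
structure Exc (R : V → V → Prop) (c : V → ℕ) (a b X u x y z T S Q : V) : Prop where
  twins : (R u y ∧ R u z ∧ R x y ∧ R x z) ∨ (R y u ∧ R z u ∧ R y x ∧ R z x)
  yT : R y T
  Sz : R S z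
  xb : R x b
  Qb : R Q b
  ua : R u a
  Xa : R X a
  nodup : [a, b, u, x, y, z].Nodup
  hX : X ∉ [a, b, u, x, y, z]
  hT : T ∉ [b, u, x, y, z]
  hS : S ∉ [b, u, x, y, z]
  hQ : Q ∉ [b, u, x, y, z]
  cS : c S = c T
  cX : c X = c T

variable [Fintype V]

theorem eq_of_card_two {R : V → V → Prop} {u p q w : V} (hc : (nb R u).card ≤ 2) (hpq : p ≠ q)
    (hp : R u p ∨ R p u) (hq : R u q ∨ R q u) (hw : R u w ∨ R w u) : w = p ∨ w = q := by
  have := mem_of_nb_le (l := [p, q]) (by simpa using hpq) (by simp [hp, hq]) hc hw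
  simpa using this

theorem eq_of_card_three {R : V → V → Prop} {u p q r w : V} (hc : (nb R u).card ≤ 3)
    (hpq : p ≠ q) (hpr : p ≠ r) (hqr : q ≠ r) (hp : R u p ∨ R p u) (hq : R u q ∨ R q u)
    (hr : R u r ∨ R r u) (hw : R u w ∨ R w u) : w = p ∨ w = q ∨ w = r := by
  have := mem_of_nb_le (l := [p, q, r]) (by simp [hpq, hpr, hqr]) (by simp [hp, hq, hr]) hc hw
  simpa using this

namespace Ctx

variable {R : V → V → Prop} {v a b : V}

/-- If the arc from `b` to `u` lies in an excluded configuration, then recolouring succeeds except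
in the exceptional configuration. -/
theorem exc_of_occ (h : Ctx R v a b) {c : V → ℕ} (hc : IsCol (del R v) c) {u X : V}
    (hua : del R v u a) (hXa : del R v X a) (hXu : X ≠ u) (hbu : ¬ R b u ∧ ¬ R u b)
    {S : Pat} (hS : S ∈ pats) {φ : ℕ → V} {e : ℕ × ℕ} (he : e ∈ S.arcs)
    (hφ : Occ (rep R v a b u) S φ) (hx : φ e.1 = b) (hy : φ e.2 = u) :
    (∃ c, IsCol R c) ∨ ∃ x y z T S Q, Exc (del R v) c a b X u x y z T S Q := by
  have irr := h.good.irrefl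
  have hub : b ≠ u := by
    rintro rfl
    exact h.nba hua.1
  have hXb : X ≠ b := by rintro rfl; exact h.nba hXa.1
  have hua' : u ≠ a := by rintro rfl; exact irr _ hua.1
  have hXa' : X ≠ a := by rintro rfl; exact irr _ hXa.1
  rcases h.of_occ hc hub h.ne.symm hua' hXa' hXb hXu hS he hφ hx hy
    (typ := 0) (Or.inl ⟨rfl, hua, hXa, rfl⟩) with h1 | ⟨-, hk, hee, h8, Q, hQ, hQi, c7, c8⟩
  · exact Or.inl h1
  · right
    have e1 : e.1 = 5 := by rcases hee with rfl | rfl <;> rfl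
    have arcs : ∀ p ∈ S.arcs, p.1 ≠ 5 ∨ p.2 ≠ e.2 → del R v (φ p.1) (φ p.2) := by
      intro p hp hne
      rcases hφ.arcs p hp with h1 | h1
      · exact h1.1
      · have := hφ.eq_arc hS he hp (h1.1.trans hx.symm) (h1.2.trans hy.symm)
        subst this
        exact absurd e1 (by tauto)
    have ha : ∀ j ∈ 6 :: 7 :: S.ord, j ≠ 0 → φ j ≠ a := by
      intro j hj hj0 hja
      obtain ⟨p, hp, hpj⟩ := pats_ord S hS j hj hj0
      rcases hφ.arcs p hp with h1 | h1
      · rcases hpj with rfl | rfl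
        exacts [h1.2.1 hja, h1.2.2 hja]
      · rcases hpj with rfl | rfl
        exacts [h.ne (hja.symm.trans h1.1), hua' (h1.2.symm.trans hja)]
    obtain ⟨-, -, -, -, o6, o7, -, -⟩ := pats_index S hS
    rw [e1] at hx
    have build : ∀ iu ix iy iz, [5, iu, ix, iy, iz].Nodup →
        (∀ i ∈ [5, iu, ix, iy, iz], i ∈ S.ord ∧ i ≠ 0) → e.2 = iu →
        ((del R v (φ iu) (φ iy) ∧ del R v (φ iu) (φ iz) ∧ del R v (φ ix) (φ iy) ∧
          del R v (φ ix) (φ iz)) ∨ (del R v (φ iy) (φ iu) ∧ del R v (φ iz) (φ iu) ∧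
          del R v (φ iy) (φ ix) ∧ del R v (φ iz) (φ ix))) →
        del R v (φ iy) (φ 6) → del R v (φ 7) (φ iz) → del R v (φ ix) (φ 5) →
        ∃ x y z T S Q, Exc (del R v) c a b X u x y z T S Q := by
      intro iu ix iy iz hnd ho hiu h1 h2 h3 h4
      have hu : φ iu = u := by rw [← hiu, hy]
      have hmap : [b, u, φ ix, φ iy, φ iz] = [5, iu, ix, iy, iz].map φ := by simp [hx, hu]
      have hmap' : [a, b, u, φ ix, φ iy, φ iz] = a :: [5, iu, ix, iy, iz].map φ := by
        rw [← hmap]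
      have hout : ∀ t, (∀ i ∈ [5, iu, ix, iy, iz], t ≠ φ i) → t ∉ [b, u, φ ix, φ iy, φ iz] := by
        intro t ht hm
        rw [hmap] at hm
        obtain ⟨i, hi, rfl⟩ := List.mem_map.1 hm
        exact ht i hi rfl
      have hin : ∀ i ∈ [5, iu, ix, iy, iz], ∀ j ∈ 6 :: 7 :: S.ord, j ≠ 0 → i ≠ j → φ i ≠ φ j :=
        fun i hi => hφ.inj i (ho i hi).1 (ho i hi).2
      rw [hu] at h1
      rw [hx] at h4 hQ
      refine ⟨φ ix, φ iy, φ iz, φ 6, φ 7, Q, ⟨h1, h2, h3, h4, hQ, hua, hXa, ?_, ?_, ?_, ?_, ?_,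
        c7, c8⟩⟩
      · rw [hmap', List.nodup_cons]
        refine ⟨fun hm => ?_, nodup_map_of hnd fun j hj k hk hjk =>
          hin j hj k (by simp [(ho k hk).1]) (ho k hk).2 hjk⟩
        obtain ⟨i, hi, hia⟩ := List.mem_map.1 hm
        exact ha i (by simp [(ho i hi).1]) (ho i hi).2 hia
      · refine fun hm => ?_
        rcases List.mem_cons.1 hm with hm | hm
        · exact hXa' hm
        · exact hout X (fun i hi => h8 i (ho i hi).1 (ho i hi).2) hm
      · exact hout _ fun i hi => (hin i hi 6 (by simp) (by simp)
          (by rintro rfl; exact o6 (ho _ hi).1)).symm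
      · exact hout _ fun i hi => (hin i hi 7 (by simp) (by simp)
          (by rintro rfl; exact o7 (ho _ hi).1)).symm
      · exact hout _ fun i hi => hQi i (ho i hi).1 (ho i hi).2
    simp only [pats, List.mem_cons, List.not_mem_nil, or_false] at hS
    rcases hS with rfl | rfl | rfl | rfl | rfl
    · simp at hk
    · simp at hk
    · simp at hk
    · have e2 : e = (5, 2) := by
        rcases hee with rfl | rfl
        · rfl
        · simp at he
      subst e2
      exact build 2 1 3 4 (by simp) (by simp) rfl
        (Or.inl ⟨arcs (2, 3) (by simp) (by simp), arcs (2, 4) (by simp) (by simp),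
          arcs (1, 3) (by simp) (by simp), arcs (1, 4) (by simp) (by simp)⟩)
        (arcs (3, 6) (by simp) (by simp)) (arcs (7, 4) (by simp) (by simp))
        (arcs (1, 5) (by simp) (by simp))
    · have e2 : e = (5, 4) := by
        rcases hee with rfl | rfl
        · simp at he
        · rfl
      subst e2
      exact build 4 3 1 2 (by simp) (by simp) rfl
        (Or.inr ⟨arcs (1, 4) (by simp) (by simp), arcs (2, 4) (by simp) (by simp),
          arcs (1, 3) (by simp) (by simp), arcs (2, 3) (by simp) (by simp)⟩)
        (arcs (1, 6) (by simp) (by simp)) (arcs (7, 2) (by simp) (by simp))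
        (arcs (3, 5) (by simp) (by simp))

end Ctx

end

section

variable {V : Type*} [Fintype V]

/-- In the exceptional configuration all neighbours of the internal vertices are known. -/
theorem Exc.neighbours {R : V → V → Prop} (hdeg : ∀ w, (nb R w).card ≤ 3) {c : V → ℕ}
    {a b X u x y z T S Q : V} (E : Exc R c a b X u x y z T S Q) (ha : (nb R a).card ≤ 2)
    (hb : (nb R b).card ≤ 2) :
    (∀ w, R a w ∨ R w a → w = u ∨ w = X) ∧ (∀ w, R b w ∨ R w b → w = x ∨ w = Q) ∧
    (∀ w, R u w ∨ R w u → w = a ∨ w = y ∨ w = z) ∧ (∀ w, R x w ∨ R w x → w = b ∨ w = y ∨ w = z) ∧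
    (∀ w, R y w ∨ R w y → w = u ∨ w = x ∨ w = T) ∧
    (∀ w, R z w ∨ R w z → w = u ∨ w = x ∨ w = S) := by
  obtain ⟨tw, yT, Sz, xb, Qb, ua, Xa, nd, hX, hT, hS, hQ, -⟩ := E
  simp only [List.nodup_cons, List.mem_cons, List.not_mem_nil, or_false, not_or, List.nodup_nil,
    not_false_eq_true, and_true] at nd hX hT hS hQ
  obtain ⟨⟨ab, au, ax, ay, az⟩, ⟨bu, bx, byy, bz⟩, ⟨ux, uy, uz⟩, ⟨xy, xz⟩, yz⟩ := nd
  have huy : R u y ∨ R y u := by tauto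
  have huz : R u z ∨ R z u := by tauto
  have hxy : R x y ∨ R y x := by tauto
  have hxz : R x z ∨ R z x := by tauto
  refine ⟨fun w hw => ?_, fun w hw => ?_, fun w hw => ?_, fun w hw => ?_, fun w hw => ?_,
    fun w hw => ?_⟩
  · exact eq_of_card_two ha (Ne.symm hX.2.2.1) (Or.inr ua) (Or.inr Xa) hw
  · exact eq_of_card_two hb (Ne.symm hQ.2.2.1) (Or.inr xb) (Or.inr Qb) hw
  · exact eq_of_card_three (hdeg u) ay az yz (Or.inl ua) huy huz hw
  · exact eq_of_card_three (hdeg x) byy bz yz (Or.inl xb) hxy hxz hw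
  · exact eq_of_card_three (hdeg y) ux (Ne.symm hT.2.1) (Ne.symm hT.2.2.1) huy.symm hxy.symm
      (Or.inl yT) hw
  · exact eq_of_card_three (hdeg z) ux (Ne.symm hS.2.1) (Ne.symm hS.2.2.1) huz.symm hxz.symm
      (Or.inr Sz) hw

theorem linked_nbrs : ∀ f ∈ [true, false], ∀ w ∈ [0, 3, 4], ∀ i ∈ [3, 4, 1, 2, 8, 0, 5],
    (nbrs (linked f w) i).Nodup ∧
    (∀ j ∈ nbrs (linked f w) i, j ∈ 6 :: ([3, 4, 1, 2, 8, 0, 5] ++ [7])) ∧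
    ∀ j ∈ nbrs (linked f w) i, ∀ k ∈ nbrs (linked f w) i, j ≠ k →
      j ∈ [3, 4, 1, 2, 8, 0, 5] ∨ k ∈ [3, 4, 1, 2, 8, 0, 5] := by
  decide +kernel

theorem linked_nbrs' : ∀ f ∈ [true, false], ∀ w ∈ [1, 2], ∀ i ∈ [3, 4, 1, 2, 8, 0, 5],
    (nbrs (linked f w) i).Nodup ∧
    (∀ j ∈ nbrs (linked f w) i, j ∈ 6 :: ([3, 4, 1, 2, 8, 0, 5] ++ [7, 9])) ∧
    ∀ j ∈ nbrs (linked f w) i, ∀ k ∈ nbrs (linked f w) i, j ≠ k →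
      j ∈ [3, 4, 1, 2, 8, 0, 5] ∨ k ∈ [3, 4, 1, 2, 8, 0, 5] := by
  decide +kernel

namespace Ctx

variable {R : V → V → Prop} {v a b : V}

/-- The exceptional configuration in which `X` is also an in-neighbour of `b`. -/
theorem of_linked (h : Ctx R v a b) {c : V → ℕ} (hc : IsCol (del R v) c)
    {X u x y z T S Q : V} (E : Exc (del R v) c a b X u x y z T S Q) (Xb : del R v X b) :
    ∃ c, IsCol R c := by
  obtain ⟨na, nb', nu, nx, ny, nz⟩ := E.neighbours h.card_del h.card_a h.card_b
  obtain ⟨tw, yT, Sz, xb, Qb, ua, Xa, nd, hX, hT, hS, hQ, -⟩ := E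
  have hTa : T ≠ a := by
    rintro rfl
    have := na y (Or.inr yT)
    simp at nd hX; grind
  have hSa : S ≠ a := by
    rintro rfl
    have := na z (Or.inl Sz)
    simp at nd hX; grind
  have asy := h.asymm_del
  have hnX : ∀ w ∈ [u, x], ¬ (del R v X w ∨ del R v w X) := by
    intro w hw hXw
    simp only [List.mem_cons, List.not_mem_nil, or_false] at hw
    rcases hw with rfl | rfl
    · have := nu X hXw.symm
      simp at hX; clear * - hX this; tauto
    · have := nx X hXw.symm
      simp at hX; clear * - hX this; tauto
  -- the possible positions of the third neighbour of `X`
  obtain ⟨w, T', S', t, hw, hT', hS', ht, hL, hcX⟩ : ∃ (w : ℕ) (T' S' t : V), w < 5 ∧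
      T' ∉ [y, z, u, x, X, a, b] ∧ S' ∉ [y, z, u, x, X, a, b] ∧
      (w = 1 ∨ w = 2 → t ∉ [y, z, u, x, X, a, b]) ∧
      ((w = 0 ∨ w = 1 ∨ w = 2) ∧ del R v y T' ∧ del R v S' z ∨
        w = 3 ∧ del R v y X ∧ del R v S' z ∨ w = 4 ∧ del R v y T' ∧ del R v X z) ∧
      (w = 0 ∧ (nb (del R v) X).card ≤ 2 ∨ w = 1 ∧ del R v X t ∨ w = 2 ∧ del R v t X ∨
        w = 3 ∨ w = 4) := by
    have hbase : ∀ s, s ∉ [b, u, x, y, z] → s ≠ a → s ≠ X → s ∉ [y, z, u, x, X, a, b] := by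
      intro s h1 h2 h3
      simp at h1 ⊢; clear * - h1 h2 h3; tauto
    by_cases hTX : T = X
    · have hSX : S ≠ X := by
        rintro rfl
        have := length_le_nb (R := del R v) (u := S) (l := [a, b, y, z])
          (by simp at nd ⊢; clear * - nd; tauto) (by simp; subst hTX; clear * - yT Sz Xa Xb; tauto)
        have := h.card_del S
        simp at *
        omega
      exact ⟨3, S, S, S, by omega, hbase S hS hSa hSX, hbase S hS hSa hSX, by omega,
        Or.inr (Or.inl ⟨rfl, hTX ▸ yT, Sz⟩), by simp⟩
    · by_cases hSX : S = X
      · exact ⟨4, T, T, T, by omega, hbase T hT hTa hTX, hbase T hT hTa hTX, by omega,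
          Or.inr (Or.inr ⟨rfl, yT, hSX ▸ Sz⟩), by simp⟩
      · by_cases hcX : (nb (del R v) X).card ≤ 2
        · exact ⟨0, T, S, T, by omega, hbase T hT hTa hTX, hbase S hS hSa hSX, by omega,
            Or.inl ⟨by simp, yT, Sz⟩, by simp [hcX]⟩
        · obtain ⟨t, ht, hta, htb⟩ := exists_third (not_le.1 hcX) a b
          have htX : t ≠ X := by
            rintro rfl
            rcases ht with ht | ht <;> exact asy _ _ ht ht
          have htu : t ≠ u := by rintro rfl; exact hnX t (by simp) ht
          have htx : t ≠ x := by rintro rfl; exact hnX t (by simp) ht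
          have hty : t ≠ y := by
            rintro rfl
            have := ny X ht.symm
            simp at hX; clear * - this hX hTX; tauto
          have htz : t ≠ z := by
            rintro rfl
            have := nz X ht.symm
            simp at hX; clear * - this hX hSX; tauto
          have htn : t ∉ [y, z, u, x, X, a, b] := by simp; tauto
          rcases ht with ht | ht
          · exact ⟨1, T, S, t, by omega, hbase T hT hTa hTX, hbase S hS hSa hSX, fun _ => htn,
              Or.inl ⟨by simp, yT, Sz⟩, by simp [ht]⟩
          · exact ⟨2, T, S, t, by omega, hbase T hT hTa hTX, hbase S hS hSa hSX, fun _ => htn,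
              Or.inl ⟨by simp, yT, Sz⟩, by simp [ht]⟩
  obtain ⟨f, hf⟩ : ∃ f : Bool, if f then (del R v u y ∧ del R v u z ∧ del R v x y ∧ del R v x z)
      else (del R v y u ∧ del R v z u ∧ del R v y x ∧ del R v z x) := by
    rcases tw with h1 | h1
    exacts [⟨true, by simpa using h1⟩, ⟨false, by simpa using h1⟩]
  have harcs : ∀ p ∈ linked f w, del R v ([a, u, x, y, z, b, T', S', X, t].getD p.1 v)
      ([a, u, x, y, z, b, T', S', X, t].getD p.2 v) := by
    clear * - hf hL hcX ua Xa xb Xb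
    intro p hp
    simp only [linked, List.mem_append] at hp
    rcases hp with hp | hp | hp
    · cases f <;> simp at hp hf <;> rcases hp with rfl | rfl | rfl | rfl <;> simp <;> tauto
    · simp at hp; rcases hp with rfl | rfl | rfl | rfl <;> simp <;> assumption
    · rcases hL with ⟨rfl | rfl | rfl, h1, h2⟩ | ⟨rfl, h1, h2⟩ | ⟨rfl, h1, h2⟩ <;>
        simp at hp hcX <;>
        rcases hp with rfl | rfl | rfl <;> simp <;> assumption
  have hnd : [y, z, u, x, X, a, b].Nodup := by
    simp at nd hX ⊢; clear * - nd hX; grind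
  have hcard : ∀ i ∈ [3, 4, 1, 2, 8, 0, 5],
      (nb (del R v) ([a, u, x, y, z, b, T', S', X, t].getD i v)).card ≤
        (nbrs (linked f w) i).length := by
    intro i hi
    have d := h.card_del
    have d1 := h.card_a
    have d2 := h.card_b
    clear * - d d1 d2 hcX hi hw
    have key : ∀ w < 5, ∀ f, ∀ i ∈ [3, 4, 1, 2, 8, 0, 5], (if i = 0 ∨ i = 5 ∨ i = 8 ∧ w = 0 then 2
        else 3) ≤ (nbrs (linked f w) i).length := by decide +kernel
    have := key w hw f i hi
    simp only [List.mem_cons, List.not_mem_nil, or_false] at hi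
    rcases hi with rfl | rfl | rfl | rfl | rfl | rfl | rfl
    · exact (d _).trans (by simpa using this)
    · exact (d _).trans (by simpa using this)
    · exact (d _).trans (by simpa using this)
    · exact (d _).trans (by simpa using this)
    · rcases hcX with ⟨rfl, hcX⟩ | h
      · exact hcX.trans (by simpa using this)
      · exact (d _).trans (by rw [if_neg (by omega)] at this; exact this)
    · exact d1.trans (by simpa using this)
    · exact d2.trans (by simpa using this)
  have hfm : f ∈ [true, false] := by cases f <;> simp
  by_cases hw12 : w = 1 ∨ w = 2
  · obtain ⟨c', hc', hne⟩ := hc.recolour_of_card asy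
      (check_linked' f hfm w (by rcases hw12 with rfl | rfl <;> simp)) (by simp) (by simp)
      (by simp) (by simp) (φ := fun i => [a, u, x, y, z, b, T', S', X, t].getD i v) harcs
      hnd (by
        intro i hi
        simp only [List.mem_cons, List.not_mem_nil, or_false] at hi
        rcases hi with rfl | rfl | rfl
        exacts [hT', hS', ht hw12])
      (linked_nbrs' f hfm w (by rcases hw12 with rfl | rfl <;> simp)) hcard
    exact h.finish hc' hne
  · obtain ⟨c', hc', hne⟩ := hc.recolour_of_card asy
      (check_linked f hfm w (by simp; omega)) (by simp) (by simp)
      (by simp) (by simp) (φ := fun i => [a, u, x, y, z, b, T', S', X, t].getD i v) harcs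
      hnd (by
        intro i hi
        simp only [List.mem_cons, List.not_mem_nil, or_false] at hi
        rcases hi with rfl | rfl
        exacts [hT', hS'])
      (linked_nbrs f hfm w (by simp; omega)) hcard
    exact h.finish hc' hne

end Ctx

end

section

variable {V : Type*} [Fintype V]

/-- Two linked copies of the exceptional configuration, with the internal vertices `0, …, 9` and
the terminals `10, …, 13`.  The flags are the directions of the two four-cycles. -/
def double (f f' : Bool) : List (ℕ × ℕ) :=
  (if f then [(2, 4), (2, 5), (3, 4), (3, 5)] else [(4, 2), (5, 2), (4, 3), (5, 3)]) ++
    ((if f' then [(6, 8), (6, 9), (7, 8), (7, 9)] else [(8, 6), (9, 6), (8, 7), (9, 7)]) ++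
      [(2, 0), (6, 0), (3, 1), (7, 1), (4, 10), (11, 5), (8, 12), (13, 9)])

theorem double_nbrs : ∀ f ∈ [true, false], ∀ f' ∈ [true, false],
    ∀ i ∈ [0, 1, 2, 3, 4, 5, 6, 7, 8, 9], (nbrs (double f f') i).Nodup ∧
    (∀ j ∈ nbrs (double f f') i, j ∈ [0, 1, 2, 3, 4, 5, 6, 7, 8, 9, 10, 11, 12, 13]) ∧
    (∀ j ∈ nbrs (double f f') i, ∀ k ∈ nbrs (double f f') i, j ≠ k →
      j ∈ [0, 1, 2, 3, 4, 5, 6, 7, 8, 9] ∨ k ∈ [0, 1, 2, 3, 4, 5, 6, 7, 8, 9]) ∧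
    (if i = 0 ∨ i = 1 then 2 else 3) ≤ (nbrs (double f f') i).length := by
  decide +kernel

/-- Colours for the vertex `y` between twins of colour `m` and a terminal of colour `γ`. -/
theorem exists_colour_in : ∀ f ∈ [true, false], ∀ m < 7, ∀ γ < 7, m ≠ γ → ∃ y < 7,
    (if f then adj m y else adj y m) = true ∧ adj y γ = true := by
  decide

theorem exists_colour_out : ∀ f ∈ [true, false], ∀ m < 7, ∀ γ < 7, m ≠ γ → ∃ z < 7,
    (if f then adj m z else adj z m) = true ∧ adj γ z = true := by
  decide

theorem exists_twin_colours (m : ℕ) (hm : m < 7) (γ : ℕ) (hγ : γ < 7) (h : m ≠ γ) (f : Bool) :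
    ∃ y < 7, ∃ z < 7, (if f then adj m y && adj m z else adj y m && adj z m) = true ∧
      adj y γ = true ∧ adj γ z = true := by
  have hf : f ∈ [true, false] := by cases f <;> simp
  obtain ⟨y, hy, h1, h2⟩ := exists_colour_in f hf m hm γ hγ h
  obtain ⟨z, hz, h3, h4⟩ := exists_colour_out f hf m hm γ hγ h
  refine ⟨y, hy, z, hz, ?_, h2, h4⟩
  cases f <;> simp_all

theorem adj_ne {i j : ℕ} (hi : i < 7) (hj : j < 7) (h : adj i j = true) : i ≠ j := by
  rintro rfl
  have := adj_asymm i hi i hi h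
  simp_all

/-- If the roles of `u` and `X` can be interchanged in the exceptional configuration, then the
terminals of one copy lie outside both copies: the colours of `T` and `S` agree with the colour of
`X` and thus differ from those of the neighbours of `X`. -/
theorem Exc.terminals {R : V → V → Prop} (hdeg : ∀ w, (nb R w).card ≤ 3) {c : V → ℕ}
    (hc : IsCol R c) {a b X u x y z T S Q y' z' T' S' : V} (E : Exc R c a b X u x y z T S Q)
    (E' : Exc R c a b u X Q y' z' T' S' x) (ha : (nb R a).card ≤ 2) (hb : (nb R b).card ≤ 2)
    (hd : ∀ w ∈ [y, z], w ∉ [y', z']) : ∀ t ∈ [T, S], t ∉ [a, b, u, x, y, z, X, Q, y', z'] := by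
  obtain ⟨na, nb', nu, nx, ny, nz⟩ := E.neighbours hdeg ha hb
  obtain ⟨na', nb'', nX, nQ, ny', nz'⟩ := E'.neighbours hdeg ha hb
  have nd := E.nodup
  have hX := E.hX
  have hQ := E.hQ
  have hcol : ∀ w, R X w ∨ R w X → c w ≠ c X := by
    intro w hw
    rcases hw with hw | hw
    · exact (adj_ne (hc.1 _) (hc.1 _) (hc.2 _ _ hw)).symm
    · exact adj_ne (hc.1 _) (hc.1 _) (hc.2 _ _ hw)
  have cy' : c y' ≠ c X := hcol _ (by have := E'.twins; clear * - this; tauto)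
  have cz' : c z' ≠ c X := hcol _ (by have := E'.twins; clear * - this; tauto)
  have main : ∀ t w, w ∈ [y, z] → (R w t ∨ R t w) → t ∉ [b, u, x, y, z] → c t = c X →
      t ∉ [a, b, u, x, y, z, X, Q, y', z'] := by
    intro t w hw hwt ht hct
    have hwd := hd w hw
    have h1 : t ≠ a := by
      rintro rfl
      have := na w hwt.symm
      simp at nd hX hw
      clear * - this nd hX hw
      grind
    have h2 : t ≠ X := by
      rintro rfl
      have := nX w hwt.symm
      simp at nd hX hw hwd
      clear * - this nd hX hw hwd
      grind
    have h3 : t ≠ Q := by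
      rintro rfl
      have := nQ w hwt.symm
      simp at nd hX hw hwd
      clear * - this nd hX hw hwd
      grind
    have h4 : t ≠ y' := by rintro rfl; exact cy' hct
    have h5 : t ≠ z' := by rintro rfl; exact cz' hct
    simp only [List.mem_cons, List.not_mem_nil, or_false, not_or] at ht ⊢
    exact ⟨h1, ht.1, ht.2.1, ht.2.2.1, ht.2.2.2.1, ht.2.2.2.2, h2, h3, h4, h5⟩
  intro t ht
  simp only [List.mem_cons, List.not_mem_nil, or_false] at ht
  rcases ht with rfl | rfl
  · exact main _ y (by simp) (Or.inl E.yT) E.hT E.cX.symm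
  · exact main _ z (by simp) (Or.inr E.Sz) E.hS (E.cS.trans E.cX.symm)

namespace Ctx

variable {R : V → V → Prop} {v a b : V}

/-- Two linked copies of the exceptional configuration.  All four in-neighbours of `a` and `b` can
get the same colour `m`, for any `m` that does not occur on the terminals, and then `a` and `b` can
get two different out-neighbours of `m`. -/
theorem of_double (h : Ctx R v a b) {c : V → ℕ} (hc : IsCol (del R v) c)
    {X u x y z T S Q x' y' z' T' S' Q' : V} (E : Exc (del R v) c a b X u x y z T S Q)
    (E' : Exc (del R v) c a b u X x' y' z' T' S' Q') : ∃ c, IsCol R c := by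
  have hdeg := h.card_del
  have asy := h.asymm_del
  obtain ⟨na, nb', nu, nx, ny, nz⟩ := E.neighbours hdeg h.card_a h.card_b
  obtain ⟨na', nb'', nX, nx', ny', nz'⟩ := E'.neighbours hdeg h.card_a h.card_b
  have nd := E.nodup
  have nd' := E'.nodup
  simp only [List.nodup_cons, List.mem_cons, List.not_mem_nil, or_false, not_or, List.nodup_nil,
    not_false_eq_true, and_true] at nd nd'
  obtain ⟨⟨ab, au, ax, ay, az⟩, ⟨bu, bx, byy, bz⟩, ⟨ux, uy, uz⟩, ⟨xy, xz⟩, yz⟩ := nd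
  obtain ⟨⟨-, aX, ax', ay', az'⟩, ⟨bX, bx', byy', bz'⟩, ⟨Xx', Xy', Xz'⟩, ⟨xy', xz'⟩, yz'⟩ := nd'
  have hX := E.hX
  have hX' := E'.hX
  have hQ := E.hQ
  have hQ' := E'.hQ
  simp only [List.mem_cons, List.not_mem_nil, or_false, not_or] at hX hX' hQ hQ'
  have hx' : x' = Q := by
    refine (nb' x' (Or.inr E'.xb)).resolve_left ?_
    rintro rfl
    have hyx' : del R v x' y' ∨ del R v y' x' := by have := E'.twins; clear * - this; tauto
    have hzx' : del R v x' z' ∨ del R v z' x' := by have := E'.twins; clear * - this; tauto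
    have hy := (nx y' hyx').resolve_left (Ne.symm byy')
    have hz := (nx z' hzx').resolve_left (Ne.symm bz')
    have hXyz : (del R v X y ∧ del R v X z) ∨ (del R v y X ∧ del R v z X) := by
      have := E'.twins
      clear * - this hy hz yz'
      grind
    have hXT : X = T := by
      have := ny X (by clear * - hXyz; tauto)
      clear * - this hX
      tauto
    have hXS : X = S := by
      have := nz X (by clear * - hXyz; tauto)
      clear * - this hX
      tauto
    have g1 : del R v y X := hXT ▸ E.yT
    have g2 : del R v X z := hXS ▸ E.Sz
    rcases hXyz with ⟨k1, -⟩ | ⟨-, k2⟩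
    · exact asy _ _ g1 k1
    · exact asy _ _ g2 k2
  subst hx'
  have hQx : Q' = x := by
    refine (nb' Q' (Or.inr E'.Qb)).resolve_right ?_
    clear * - hQ'
    tauto
  subst hQx
  have huy : del R v u y ∨ del R v y u := by have := E.twins; clear * - this; tauto
  have huz : del R v u z ∨ del R v z u := by have := E.twins; clear * - this; tauto
  have hxy : del R v Q' y ∨ del R v y Q' := by have := E.twins; clear * - this; tauto
  have hxz : del R v Q' z ∨ del R v z Q' := by have := E.twins; clear * - this; tauto
  have hXy : del R v X y' ∨ del R v y' X := by have := E'.twins; clear * - this; tauto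
  have hXz : del R v X z' ∨ del R v z' X := by have := E'.twins; clear * - this; tauto
  have hQy : del R v x' y' ∨ del R v y' x' := by have := E'.twins; clear * - this; tauto
  have hQz : del R v x' z' ∨ del R v z' x' := by have := E'.twins; clear * - this; tauto
  -- a common vertex of the two four-cycles would have degree four
  have hdis : ∀ w, (del R v u w ∨ del R v w u) → (del R v Q' w ∨ del R v w Q') →
      (del R v X w ∨ del R v w X) → ¬ (del R v x' w ∨ del R v w x') := by
    intro w h1 h2 h3 h4
    have := length_le_nb (R := del R v) (u := w) (l := [u, Q', X, x'])
      (by simp; clear * - ux hX hQ Xx'; tauto) (by simp; exact ⟨h1.symm, h2.symm, h3.symm, h4.symm⟩)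
    have := hdeg w
    simp at *
    omega
  have hd : ∀ w ∈ [y, z], w ∉ [y', z'] := by
    intro w hw hw'
    simp only [List.mem_cons, List.not_mem_nil, or_false] at hw hw'
    rcases hw with rfl | rfl <;> rcases hw' with rfl | rfl
    exacts [hdis _ huy hxy hXy hQy, hdis _ huy hxy hXz hQz, hdis _ huz hxz hXy hQy,
      hdis _ huz hxz hXz hQz]
  have ht := E.terminals hdeg hc E' h.card_a h.card_b hd
  have ht' := E'.terminals hdeg hc E h.card_a h.card_b (fun w hw hw' => hd w hw' hw)
  obtain ⟨m, hm, hm1, hm2⟩ : ∃ m < 7, m ≠ c T ∧ m ≠ c T' := by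
    have key : ∀ i < 7, ∀ j < 7, ∃ m < 7, m ≠ i ∧ m ≠ j := by decide
    exact key _ (hc.1 _) _ (hc.1 _)
  obtain ⟨α, hα, β, hβ, hαβ, hmα, hmβ⟩ : ∃ α < 7, ∃ β < 7, α ≠ β ∧ adj m α = true ∧
      adj m β = true := by
    have key : ∀ m < 7, ∃ α < 7, ∃ β < 7, α ≠ β ∧ adj m α = true ∧ adj m β = true := by decide
    exact key m hm
  obtain ⟨f, hf⟩ : ∃ f : Bool, if f then (del R v u y ∧ del R v u z ∧ del R v Q' y ∧ del R v Q' z)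
      else (del R v y u ∧ del R v z u ∧ del R v y Q' ∧ del R v z Q') := by
    rcases E.twins with h1 | h1
    exacts [⟨true, by simpa using h1⟩, ⟨false, by simpa using h1⟩]
  obtain ⟨f', hf'⟩ : ∃ f : Bool,
      if f then (del R v X y' ∧ del R v X z' ∧ del R v x' y' ∧ del R v x' z')
      else (del R v y' X ∧ del R v z' X ∧ del R v y' x' ∧ del R v z' x') := by
    rcases E'.twins with h1 | h1
    exacts [⟨true, by simpa using h1⟩, ⟨false, by simpa using h1⟩]
  have hfm : f ∈ [true, false] := by cases f <;> simp
  have hfm' : f' ∈ [true, false] := by cases f' <;> simp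
  obtain ⟨p, hp, q, hq, hpq, hp1, hq1⟩ := exists_twin_colours m hm _ (hc.1 T) hm1 f
  obtain ⟨p', hp', q', hq', hpq', hp1', hq1'⟩ := exists_twin_colours m hm _ (hc.1 T') hm2 f'
  let φ : ℕ → V := fun i => [a, b, u, Q', y, z, X, x', y', z', T, S, T', S'].getD i v
  let g : ℕ → ℕ := fun i =>
    [α, β, m, m, p, q, m, m, p', q', c T, c T, c T', c T'].getD i 0
  have harcs : ∀ e ∈ double f f', del R v (φ e.1) (φ e.2) := by
    have := E.yT
    have := E.Sz
    have := E.xb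
    have := E.Qb
    have := E.ua
    have := E.Xa
    have := E'.yT
    have := E'.Sz
    clear * - hf hf' this E E'
    intro e he
    simp only [double, List.mem_append] at he
    rcases he with he | he | he
    · cases f <;> simp at he hf <;> rcases he with rfl | rfl | rfl | rfl <;> simp [φ, hf]
    · cases f' <;> simp at he hf' <;> rcases he with rfl | rfl | rfl | rfl <;> simp [φ, hf']
    · simp at he
      rcases he with rfl | rfl | rfl | rfl | rfl | rfl | rfl | rfl
      exacts [E.ua, E.Xa, E.xb, E.Qb, E.yT, E.Sz, E'.yT, E'.Sz]
  have hg : ∀ e ∈ double f f', adj (g e.1) (g e.2) = true := by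
    clear * - hmα hmβ hpq hp1 hq1 hpq' hp1' hq1'
    intro e he
    simp only [double, List.mem_append] at he
    rcases he with he | he | he
    · cases f <;> simp at he hpq <;> rcases he with rfl | rfl | rfl | rfl <;> simp [g, hpq]
    · cases f' <;> simp at he hpq' <;> rcases he with rfl | rfl | rfl | rfl <;> simp [g, hpq']
    · simp at he
      rcases he with rfl | rfl | rfl | rfl | rfl | rfl | rfl | rfl
      exacts [hmα, hmα, hmβ, hmβ, hp1, hq1, hp1', hq1']
  have hnd : ([0, 1, 2, 3, 4, 5, 6, 7, 8, 9].map φ).Nodup := by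
    have hd1 := hd y (by simp)
    have hd2 := hd z (by simp)
    have hax : a ≠ x' := ax'
    simp [φ] at hd1 hd2 ⊢
    clear * - ab au ax ay az bu bx byy bz ux uy uz xy xz yz aX ax' ay' az' bX bx' byy' bz' Xx' Xy'
      Xz' xy' xz' yz' hX hX' hQ hQ' hd1 hd2
    grind
  have hts : ∀ t ∈ [10, 11, 12, 13], φ t ∉ [0, 1, 2, 3, 4, 5, 6, 7, 8, 9].map φ := by
    have k1 := ht T (by simp)
    have k2 := ht S (by simp)
    have k3 := ht' T' (by simp)
    have k4 := ht' S' (by simp)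
    simp [φ] at k1 k2 k3 k4 ⊢
    exact ⟨k1, k2, by clear * - k3; tauto, by clear * - k4; tauto⟩
  have hinj : ∀ i ∈ [0, 1, 2, 3, 4, 5, 6, 7, 8, 9],
      ∀ j ∈ [0, 1, 2, 3, 4, 5, 6, 7, 8, 9, 10, 11, 12, 13], i ≠ j → φ i ≠ φ j := by
    intro i hi j hj
    exact inj_of_nodup hnd hts i hi j (by simp at hj ⊢; clear * - hj; omega)
  have hcard : ∀ i ∈ [0, 1, 2, 3, 4, 5, 6, 7, 8, 9], (nb (del R v) (φ i)).card ≤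
      (nbrs (double f f') i).length := by
    intro i hi
    have hl := (double_nbrs f hfm f' hfm' i hi).2.2.2
    by_cases hi01 : i = 0 ∨ i = 1
    · rw [if_pos hi01] at hl
      rcases hi01 with rfl | rfl
      exacts [h.card_a.trans hl, h.card_b.trans hl]
    · rw [if_neg hi01] at hl
      exact (hdeg _).trans hl
  have hcomp : ∀ i ∈ [0, 1, 2, 3, 4, 5, 6, 7, 8, 9], ∀ w, del R v (φ i) w ∨ del R v w (φ i) →
      ∃ j ∈ [0, 1, 2, 3, 4, 5, 6, 7, 8, 9, 10, 11, 12, 13], φ j = w ∧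
        ((i, j) ∈ double f f' ∨ (j, i) ∈ double f f') := by
    intro i hi w hw
    obtain ⟨l1, l2, l3, -⟩ := double_nbrs f hfm f' hfm' i hi
    exact complete_of_card harcs hinj ⟨l1, l2, l3⟩ (hcard i hi) hw
  obtain ⟨c', hc', hv⟩ := hc.patch (φ := φ) (g := g) (L := double f f')
    (vs := [0, 1, 2, 3, 4, 5, 6, 7, 8, 9]) (l := [0, 1, 2, 3, 4, 5, 6, 7, 8, 9, 10, 11, 12, 13])
    (by decide) hinj
    (by
      intro i hi w hw
      obtain ⟨j, hj, rfl, hij | hij⟩ := hcomp i hi w (Or.inl hw)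
      · exact ⟨j, hj, rfl, hij⟩
      · exact absurd (harcs _ hij) (asy _ _ hw))
    (by
      intro i hi w hw
      obtain ⟨j, hj, rfl, hij | hij⟩ := hcomp i hi w (Or.inr hw)
      · exact absurd (harcs _ hij) (asy _ _ hw)
      · exact ⟨j, hj, rfl, hij⟩)
    (by
      intro j hj hjv
      have : j = 10 ∨ j = 11 ∨ j = 12 ∨ j = 13 := by simp at hj hjv; clear * - hj hjv; omega
      rcases this with rfl | rfl | rfl | rfl
      exacts [rfl, E.cS.symm, rfl, E'.cS.symm])
    (by
      intro i hi
      simp only [List.mem_cons, List.not_mem_nil, or_false] at hi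
      rcases hi with rfl | rfl | rfl | rfl | rfl | rfl | rfl | rfl | rfl | rfl
      exacts [hα, hβ, hm, hm, hp, hq, hm, hm, hp', hq'])
    (fun e he _ _ => hg e he)
  refine h.finish hc' ?_
  have h0 := hv 0 (by simp)
  have h1 := hv 1 (by simp)
  change c' a = α at h0
  change c' b = β at h1
  rwa [h0, h1]

end Ctx

end

/-! ### Colouring reducible graphs with seven colours -/

section

variable {V : Type*}

theorem exists_common : ∀ i < 7, ∀ j < 7, ∃ α < 7, adj i α = true ∧ adj j α = true := by decide

theorem exists_common' : ∀ i < 7, ∀ j < 7, ∃ α < 7, adj α i = true ∧ adj α j = true := by decide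

theorem exists_between : ∀ i < 7, ∀ j < 7, i ≠ j → ∃ α < 7, adj i α = true ∧ adj α j = true := by
  decide

set_option synthInstance.maxSize 1000 in
theorem exists_between_ne : ∀ i < 7, ∀ j < 7, ∀ k < 7, adj j i = true →
    ∃ α < 7, α ≠ k ∧ adj i α = true ∧ adj α j = true := by
  decide

theorem exists_out_ne : ∀ i < 7, ∀ k < 7, ∃ α < 7, α ≠ k ∧ adj i α = true := by decide

theorem exists_in_ne : ∀ i < 7, ∀ k < 7, ∃ α < 7, α ≠ k ∧ adj α i = true := by decide

theorem ne_of_path {i j k : ℕ} (hi : i < 7) (hj : j < 7) (h1 : adj i j = true)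
    (h2 : adj j k = true) : k ≠ i := by
  rintro rfl
  have := adj_asymm _ hi _ hj h1
  simp_all

theorem exists_col_of_flip {R : V → V → Prop} (h : ∃ c, IsCol (flip R) c) : ∃ c, IsCol R c := by
  obtain ⟨c, hc⟩ := h
  exact ⟨_, hc.flip⟩

variable [Fintype V]

namespace Ctx

variable {R : V → V → Prop} {v a b : V}

theorem card_del_del (h : Ctx R v a b) {u : V} (hu : del R v u a ∨ del R v a u) :
    (nb (del (del R v) a) u).card ≤ 2 := by
  have := card_nb_del_lt hu
  have := h.card_del u
  omega

theorem card_rep (x y : V) {u : V} (hux : u ≠ x) (huy : u ≠ y) :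
    (nb (rep R v a x y) u).card ≤ (nb (del (del R v) a) u).card := by
  refine Finset.card_le_card fun w hw => ?_
  rw [mem_nb] at hw ⊢
  rcases hw with (hw | hw) | (hw | hw)
  exacts [Or.inl hw, absurd hw.1 hux, Or.inr hw, absurd hw.2 huy]

theorem card_b' (h : Ctx R v a b) : (nb (del (del R v) a) b).card ≤ 2 :=
  (Finset.card_le_card (nb_mono (fun _ _ h => h.1) b)).trans h.card_b

/-- If `a` has the in-neighbours `u` and `X`, and `u` is not adjacent to `b`, then `a` and `v` are
replaced by an arc from `b` to `u`. -/
theorem exc_of_in (h : Ctx R v a b) {c : V → ℕ} (hc : IsCol (del R v) c) {u X : V}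
    (hua : del R v u a) (hXa : del R v X a) (hXu : X ≠ u) (hbu : ¬ R b u ∧ ¬ R u b) :
    (∃ c, IsCol R c) ∨ ∃ x y z T S Q, Exc (del R v) c a b X u x y z T S Q := by
  have irr := h.good.irrefl
  have hub : b ≠ u := by rintro rfl; exact h.nba hua.1
  have hXb : X ≠ b := by rintro rfl; exact h.nba hXa.1
  have hua' : u ≠ a := by rintro rfl; exact irr _ hua.1
  have hXa' : X ≠ a := by rintro rfl; exact irr _ hXa.1
  have na : ∀ w, del R v a w ∨ del R v w a → w = u ∨ w = X := fun w hw =>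
    eq_of_card_two h.card_a hXu.symm (Or.inr hua) (Or.inr hXa) hw
  rcases h.replace hub hbu.2 h.ne.symm hua' h.b_ne_v hua.2.1 hXa (Or.inr rfl) h.card_b'
    (h.card_del_del (Or.inl hua)) with ⟨c', hc'⟩ | ⟨U, hUb, hUu, hUa, hUv, hU, hU3⟩ |
      ⟨S, hS, φ, e, he, hφ, h1, h2⟩
  · left
    obtain ⟨α, hα, h1, h2⟩ := exists_common _ (hc'.1 u) _ (hc'.1 X)
    refine h.finish_of_ext (hc'.mono fun _ _ h => Or.inl h) hα
      (ne_of_path (hc'.1 b) (hc'.1 u) (hc'.2 _ _ (Or.inr ⟨rfl, rfl⟩)) h1) ?_ ?_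
    · intro w hw
      rcases na w (Or.inl hw) with rfl | rfl
      exacts [absurd hw (h.asymm_del _ _ hua), absurd hw (h.asymm_del _ _ hXa)]
    · intro w hw
      rcases na w (Or.inr hw) with rfl | rfl
      exacts [h1, h2]
  · left
    have hUX : ¬ U X := by
      intro hUX
      have := hU3 X hUX
      have := card_rep (R := R) (v := v) (a := a) b u hXb hXu
      have := h.card_del_del (Or.inl hXa)
      omega
    refine h.bridge (fun w => U w ∨ w = a ∨ w = v) hXa.1 ?_ ?_
    · simp [hUX, hXa', hXa.2.1]
    · intro p q hpq hne
      by_cases hpv : p = v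
      · subst hpv
        rcases h.nbv q (Or.inl hpq) with rfl | rfl <;> simp [hUb]
      · by_cases hqv : q = v
        · subst hqv
          rcases h.nbv p (Or.inr hpq) with rfl | rfl <;> simp [hUb]
        · by_cases hpa : p = a
          · subst hpa
            rcases na q (Or.inl ⟨hpq, hpv, hqv⟩) with rfl | rfl
            · simp [hUu]
            · exact absurd hpq (h.good.asymm _ _ hXa.1)
          · by_cases hqa : q = a
            · subst hqa
              rcases na p (Or.inr ⟨hpq, hpv, hqv⟩) with rfl | rfl
              · simp [hUu]
              · exact absurd ⟨rfl, rfl⟩ hne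
            · have := hU p q ⟨⟨hpq, hpv, hqv⟩, hpa, hqa⟩
              simp [hpv, hqv, hpa, hqa, this]
  · exact h.exc_of_occ hc hua hXa hXu hbu hS he hφ h1 h2

/-- The case in which both other neighbours of `a` are in-neighbours. -/
theorem of_in (h : Ctx R v a b) {a1 a2 : V} (hne : a1 ≠ a2) (h1 : del R v a1 a)
    (h2 : del R v a2 a) : ∃ c, IsCol R c := by
  have na : ∀ w, del R v a w ∨ del R v w a → w = a1 ∨ w = a2 := fun w hw =>
    eq_of_card_two h.card_a hne (Or.inr h1) (Or.inr h2) hw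
  by_cases hb : R b a1 ∨ R b a2
  · obtain ⟨c, hc⟩ := h.exists_del_del
    obtain ⟨α, hα, g1, g2⟩ := exists_common _ (hc.1 a1) _ (hc.1 a2)
    have irr := h.good.irrefl
    refine h.finish_of_ext hc hα ?_ ?_ ?_
    · rcases hb with hb | hb
      · exact ne_of_path (hc.1 b) (hc.1 a1) (hc.2 _ _ ⟨⟨hb, h.b_ne_v, h1.2.1⟩, h.ne.symm,
          by rintro rfl; exact irr _ h1.1⟩) g1
      · exact ne_of_path (hc.1 b) (hc.1 a2) (hc.2 _ _ ⟨⟨hb, h.b_ne_v, h2.2.1⟩, h.ne.symm,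
          by rintro rfl; exact irr _ h2.1⟩) g2
    · intro w hw
      rcases na w (Or.inl hw) with rfl | rfl
      exacts [absurd hw (h.asymm_del _ _ h1), absurd hw (h.asymm_del _ _ h2)]
    · intro w hw
      rcases na w (Or.inr hw) with rfl | rfl
      exacts [g1, g2]
  · push Not at hb
    obtain ⟨c, hc⟩ := h.exists_del
    have half : ∀ u X, u ≠ X → del R v u a → del R v X a → ¬ R b u → ¬ R b X → ¬ R u b →
        ∃ c, IsCol R c := by
      intro u X huX hu hX hbu hbX hub
      rcases h.exc_of_in hc hu hX huX.symm ⟨hbu, hub⟩ with h3 | ⟨x, y, z, T, S, Q, E⟩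
      · exact h3
      · by_cases hXb : R X b
        · exact h.of_linked hc E ⟨hXb, hX.2.1, h.b_ne_v⟩
        · rcases h.exc_of_in hc hX hu huX ⟨hbX, hXb⟩ with h3 | ⟨x', y', z', T', S', Q', E'⟩
          · exact h3
          · exact h.of_double hc E E'
    by_cases h1b : R a1 b
    · by_cases h2b : R a2 b
      · exact h.of_fourCycle hne h1 h2 ⟨h1b, h1.2.1, h.b_ne_v⟩ ⟨h2b, h2.2.1, h.b_ne_v⟩
      · exact half a2 a1 hne.symm h2 h1 hb.2 hb.1 h2b
    · exact half a1 a2 hne h1 h2 hb.1 hb.2 h1b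

/-- The case of a directed path from `y` through `a` to `x`, without the arc from `y` to `x`.  The
vertices `a` and `v` are replaced by an arc from `x` to `y`; two colours are then available for
`a`. -/
theorem of_path (h : Ctx R v a b) {x y : V} (h1 : del R v y a) (h2 : del R v a x)
    (hyx : ¬ R y x) : ∃ c, IsCol R c := by
  have irr := h.good.irrefl
  have hxy : x ≠ y := by rintro rfl; exact h.good.asymm _ _ h1.1 h2.1
  have hya : y ≠ a := by rintro rfl; exact irr _ h1.1
  have hxa : x ≠ a := by rintro rfl; exact irr _ h2.1
  have hby : b ≠ y := by rintro rfl; exact h.nba h1.1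
  have hbx : b ≠ x := by rintro rfl; exact h.nab h2.1
  have na : ∀ w, del R v a w ∨ del R v w a → w = y ∨ w = x := fun w hw =>
    eq_of_card_two h.card_a hxy.symm (Or.inr h1) (Or.inl h2) hw
  rcases h.replace hxy hyx hxa hya h2.2.2 h1.2.1 h1 (Or.inr rfl) (h.card_del_del (Or.inr h2))
    (h.card_del_del (Or.inl h1)) with ⟨c', hc'⟩ | ⟨U, hUx, hUy, hUa, hUv, hU, hU3⟩ |
      ⟨S, hS, φ, e, he, hφ, g1, g2⟩
  · obtain ⟨α, hα, hne, g1, g2⟩ := exists_between_ne _ (hc'.1 y) _ (hc'.1 x) _ (hc'.1 b)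
      (hc'.2 _ _ (Or.inr ⟨rfl, rfl⟩))
    refine h.finish_of_ext (hc'.mono fun _ _ h => Or.inl h) hα hne ?_ ?_
    · intro w hw
      rcases na w (Or.inl hw) with rfl | rfl
      exacts [absurd hw (h.asymm_del _ _ h1), g2]
    · intro w hw
      rcases na w (Or.inr hw) with rfl | rfl
      exacts [g1, absurd hw (h.asymm_del _ _ h2)]
  · have hUb : ¬ U b := by
      intro hUb
      have := hU3 b hUb
      have := card_rep (R := R) (v := v) (a := a) x y hbx hby
      have := h.card_b'
      omega
    have main : ∀ p q, R p q → ((p = a ∧ q = v) ∨ (p = v ∧ q = a)) → ∃ c, IsCol R c := by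
      intro p q hpq hpa
      refine h.bridge (fun w => U w ∨ w = a) hpq ?_ ?_
      · rcases hpa with ⟨rfl, rfl⟩ | ⟨rfl, rfl⟩ <;> simp [hUv, h.a_ne_v.symm]
      · intro r s hrs hne
        have hne' : ¬ ((r = a ∧ s = v) ∨ (r = v ∧ s = a)) := by
          rintro (⟨rfl, rfl⟩ | ⟨rfl, rfl⟩) <;> rcases hpa with ⟨rfl, rfl⟩ | ⟨rfl, rfl⟩
          exacts [hne ⟨rfl, rfl⟩, h.good.asymm _ _ hpq hrs, h.good.asymm _ _ hpq hrs,
            hne ⟨rfl, rfl⟩]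
        by_cases hrv : r = v
        · subst hrv
          rcases h.nbv s (Or.inl hrs) with rfl | rfl
          · exact absurd (Or.inr ⟨rfl, rfl⟩) hne'
          · simp [hUb, hUv, h.ne.symm, h.a_ne_v.symm]
        · by_cases hsv : s = v
          · subst hsv
            rcases h.nbv r (Or.inr hrs) with rfl | rfl
            · exact absurd (Or.inl ⟨rfl, rfl⟩) hne'
            · simp [hUb, hUv, h.ne.symm, h.a_ne_v.symm]
          · by_cases hra : r = a
            · subst hra
              rcases na s (Or.inl ⟨hrs, hrv, hsv⟩) with rfl | rfl <;> simp [hUx, hUy]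
            · by_cases hsa : s = a
              · subst hsa
                rcases na r (Or.inr ⟨hrs, hrv, hsv⟩) with rfl | rfl <;> simp [hUx, hUy]
              · have := hU r s ⟨⟨hrs, hrv, hsv⟩, hra, hsa⟩
                simp [hra, hsa, this]
    rcases h.av with h3 | h3
    exacts [main _ _ h3 (Or.inl ⟨rfl, rfl⟩), main _ _ h3 (Or.inr ⟨rfl, rfl⟩)]
  · obtain ⟨c, hc⟩ := h.exists_del
    rcases h.of_occ hc hxy hxa hya h.ne.symm hbx hby hS he hφ g1 g2 (typ := 2)
      (Or.inr (Or.inr ⟨rfl, h1, h2, rfl⟩)) with h3 | ⟨h3, -⟩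
    · exact h3
    · simp at h3

/-- The case of a transitive triangle with middle vertex `a` whose source is not adjacent to
`b`.  An arc from `b` to this source replaces `a` and `v`. -/
theorem of_triangle (h : Ctx R v a b) {X y : V} (h1 : del R v y a) (h2 : del R v a X)
    (hyX : R y X) (hby : ¬ R b y) (hyb : ¬ R y b) : ∃ c, IsCol R c := by
  have irr := h.good.irrefl
  have hXy : X ≠ y := by rintro rfl; exact irr _ hyX
  have hya : y ≠ a := by rintro rfl; exact irr _ h1.1
  have hXa : X ≠ a := by rintro rfl; exact irr _ h2.1
  have hyb' : b ≠ y := by rintro rfl; exact h.nba h1.1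
  have hXb : X ≠ b := by rintro rfl; exact h.nab h2.1
  have na : ∀ w, del R v a w ∨ del R v w a → w = y ∨ w = X := fun w hw =>
    eq_of_card_two h.card_a hXy.symm (Or.inr h1) (Or.inl h2) hw
  have hyX' : del (del R v) a y X := ⟨⟨hyX, h1.2.1, h2.2.2⟩, hya, hXa⟩
  rcases h.replace hyb' hyb h.ne.symm hya h.b_ne_v h1.2.1 h1 (Or.inr rfl) h.card_b'
    (h.card_del_del (Or.inl h1)) with ⟨c', hc'⟩ | ⟨U, hUx, hUy, hUa, hUv, hU, hU3⟩ |
      ⟨S, hS, φ, e, he, hφ, g1, g2⟩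
  · obtain ⟨α, hα, g1, g2⟩ := exists_between _ (hc'.1 y) _ (hc'.1 X)
      (adj_ne (hc'.1 _) (hc'.1 _) (hc'.2 _ _ (Or.inl hyX')))
    refine h.finish_of_ext (hc'.mono fun _ _ h => Or.inl h) hα
      (ne_of_path (hc'.1 b) (hc'.1 y) (hc'.2 _ _ (Or.inr ⟨rfl, rfl⟩)) g1) ?_ ?_
    · intro w hw
      rcases na w (Or.inl hw) with rfl | rfl
      exacts [absurd hw (h.asymm_del _ _ h1), g2]
    · intro w hw
      rcases na w (Or.inr hw) with rfl | rfl
      exacts [g1, absurd hw (h.asymm_del _ _ h2)]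
  · exfalso
    have := hU3 X ((hU _ _ hyX').1 hUy)
    have := card_rep (R := R) (v := v) (a := a) b y hXb hXy
    have := h.card_del_del (Or.inr h2)
    omega
  · obtain ⟨c, hc⟩ := h.exists_del
    rcases h.of_occ hc hyb' h.ne.symm hya hXa hXb hXy hS he hφ g1 g2 (typ := 1)
      (Or.inr (Or.inl ⟨rfl, h1, h2, rfl⟩)) with h3 | ⟨h3, -⟩
    · exact h3
    · simp at h3

/-- The case in which `a` has another in-neighbour and another out-neighbour. -/
theorem of_mixed (h : Ctx R v a b) {a1 a2 : V} (h1 : del R v a1 a) (h2 : del R v a a2) :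
    ∃ c, IsCol R c := by
  have irr := h.good.irrefl
  by_cases h12 : R a1 a2
  swap
  · exact h.of_path h1 h2 h12
  have hne : a1 ≠ a2 := by rintro rfl; exact irr _ h12
  have h1a : a1 ≠ a := by rintro rfl; exact irr _ h1.1
  have h2a : a2 ≠ a := by rintro rfl; exact irr _ h2.1
  have n1b : a1 ≠ b := by rintro rfl; exact h.nba h1.1
  have n2b : a2 ≠ b := by rintro rfl; exact h.nab h2.1
  have na : ∀ w, del R v a w ∨ del R v w a → w = a1 ∨ w = a2 := fun w hw =>
    eq_of_card_two h.card_a hne (Or.inr h1) (Or.inl h2) hw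
  by_cases hb : R b a1 ∨ R a2 b
  · obtain ⟨c, hc⟩ := h.exists_del_del
    obtain ⟨α, hα, g1, g2⟩ := exists_between _ (hc.1 a1) _ (hc.1 a2)
      (adj_ne (hc.1 _) (hc.1 _) (hc.2 _ _ ⟨⟨h12, h1.2.1, h2.2.2⟩, h1a, h2a⟩))
    refine h.finish_of_ext hc hα ?_ ?_ ?_
    · rcases hb with hb | hb
      · exact ne_of_path (hc.1 b) (hc.1 a1) (hc.2 _ _ ⟨⟨hb, h.b_ne_v, h1.2.1⟩, h.ne.symm, h1a⟩) g1
      · exact (ne_of_path hα (hc.1 a2) g2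
          (hc.2 _ _ ⟨⟨hb, h2.2.2, h.b_ne_v⟩, h2a, h.ne.symm⟩)).symm
    · intro w hw
      rcases na w (Or.inl hw) with rfl | rfl
      exacts [absurd hw (h.asymm_del _ _ h1), g2]
    · intro w hw
      rcases na w (Or.inr hw) with rfl | rfl
      exacts [g1, absurd hw (h.asymm_del _ _ h2)]
  · push Not at hb
    by_cases h1b : R a1 b
    · by_cases h2b : R b a2
      · -- the path through `v` completes an excluded diamond
        exfalso
        have main : ∀ m1 m2, R a1 m1 → R a1 m2 → R m1 a2 → R m2 a2 → R m1 v → R v m2 →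
            m1 ≠ m2 → False := by
          intro m1 m2 g1 g2 g3 g4 g5 g6 hm
          have irm : ∀ u w, R u w → u ≠ w := by rintro u w huw rfl; exact irr _ huw
          have k1 := irm _ _ g1
          have k2 := irm _ _ g2
          have k3 := irm _ _ g3
          have k4 := irm _ _ g4
          have k5 := irm _ _ g5
          have k6 := irm _ _ g6
          have k7 := h1.2.1
          have k8 := h2.2.2
          refine h.good.free _ List.mem_cons_self
            (fun i => [v, a1, m1, m2, a2, v, v, v].getD i v) ⟨?_, ?_⟩
          · simp; clear * - g1 g2 g3 g4 g5 g6 h12; tauto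
          · have := inj_of_nodup (φ := fun i => [v, a1, m1, m2, a2, v, v, v].getD i v)
              (is := [2, 1, 3, 4]) (ts := [6, 7])
              (by simp; clear * - k1 k2 k3 k4 hm hne; tauto)
              (by simp; clear * - k5 k6 k7 k8; tauto)
            intro i hi hi0 j hj hj0 hij
            refine this i ?_ j ?_ hij
            · simp at hi ⊢; clear * - hi hi0; tauto
            · simp at hj ⊢; clear * - hj hj0; tauto
        rcases h.mixed with ⟨g1, g2⟩ | ⟨g1, g2⟩
        · exact main a b h1.1 h1b h2.1 h2b g1 g2 h.ne
        · exact main b a h1b h1.1 h2b h2.1 g2 g1 h.ne.symm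
      · exact exists_col_of_flip (h.flip.of_triangle (X := a1) (y := a2) ⟨h2.1, h2.2.2, h2.2.1⟩
          ⟨h1.1, h1.2.2, h1.2.1⟩ h12 hb.2 h2b)
    · exact h.of_triangle h1 h2 h12 hb.1 h1b

/-- The induction step for a vertex of degree two on a directed path with nonadjacent ends. -/
theorem colourable (h : Ctx R v a b) : ∃ c, IsCol R c := by
  classical
  by_cases hcard : (nb (del R v) a).card ≤ 1
  · obtain ⟨c, hc⟩ := h.exists_del_del
    by_cases hd : ∃ d, del R v d a ∨ del R v a d
    · obtain ⟨d, hd⟩ := hd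
      have na : ∀ w, del R v a w ∨ del R v w a → w = d := by
        intro w hw
        have := mem_of_nb_le (R := del R v) (l := [d]) (by simp) (by simpa using hd.symm) hcard hw
        simpa using this
      rcases hd with hd | hd
      · obtain ⟨α, hα, hne, h1⟩ := exists_out_ne _ (hc.1 d) _ (hc.1 b)
        refine h.finish_of_ext hc hα hne ?_ ?_
        · intro w hw
          obtain rfl := na w (Or.inl hw)
          exact absurd hw (h.asymm_del _ _ hd)
        · intro w hw
          obtain rfl := na w (Or.inr hw)
          exact h1
      · obtain ⟨α, hα, hne, h1⟩ := exists_in_ne _ (hc.1 d) _ (hc.1 b)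
        refine h.finish_of_ext hc hα hne ?_ ?_
        · intro w hw
          obtain rfl := na w (Or.inl hw)
          exact h1
        · intro w hw
          obtain rfl := na w (Or.inr hw)
          exact absurd hw (h.asymm_del _ _ hd)
    · obtain ⟨α, hα, hne, -⟩ := exists_out_ne _ (hc.1 b) _ (hc.1 b)
      exact h.finish_of_ext hc hα hne (fun w hw => absurd ⟨w, Or.inr hw⟩ hd)
        fun w hw => absurd ⟨w, Or.inl hw⟩ hd
  · obtain ⟨a1, a2, hne, hnb⟩ := Finset.card_eq_two.1 (le_antisymm h.card_a (not_le.1 hcard))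
    have h1 : a1 ∈ nb (del R v) a := by rw [hnb]; simp
    have h2 : a2 ∈ nb (del R v) a := by rw [hnb]; simp
    rw [mem_nb] at h1 h2
    rcases h1 with h1 | h1 <;> rcases h2 with h2 | h2
    · exact exists_col_of_flip (h.flip.of_in hne ⟨h1.1, h1.2.2, h1.2.1⟩ ⟨h2.1, h2.2.2, h2.2.1⟩)
    · exact h.of_mixed h2 h1
    · exact h.of_mixed h1 h2
    · exact h.of_in hne h1 h2

end Ctx

/-- Every oriented graph in the inductive class has a homomorphism to the Paley tournament on
seven vertices. -/
theorem Good.colourable {R : V → V → Prop} (h : Good R) : ∃ c, IsCol R c := by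
  classical
  induction hn : size R using Nat.strong_induction_on generalizing R with
  | _ n ih =>
    subst hn
    by_cases hU : (Finset.univ.filter fun u => (nb R u).Nonempty).Nonempty
    · obtain ⟨v, hv, hv2⟩ := h.proper _ hU
      have hsub : nb R v ⊆ Finset.univ.filter fun u => (nb R u).Nonempty := by
        intro w hw
        rw [mem_nb] at hw
        exact Finset.mem_filter.2 ⟨Finset.mem_univ _, v, mem_nb.2 hw.symm⟩
      have hcard : (nb R v).card ≤ 2 := by
        rw [← Finset.inter_eq_left.2 hsub]
        convert hv2
      obtain ⟨a, b, ha, hb, hnb⟩ : ∃ a b, (R v a ∨ R a v) ∧ (R v b ∨ R b v) ∧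
          ∀ w, R v w ∨ R w v → w = a ∨ w = b := by
        obtain ⟨a, ha⟩ := (Finset.mem_filter.1 hv).2
        rw [mem_nb] at ha
        by_cases hb : ∃ b, (R v b ∨ R b v) ∧ a ≠ b
        · obtain ⟨b, hb, hab⟩ := hb
          exact ⟨a, b, ha, hb, fun w hw => eq_of_card_two hcard hab ha hb hw⟩
        · push Not at hb
          exact ⟨a, a, ha, ha, fun w hw => Or.inl (hb w hw).symm⟩
      obtain ⟨c, hc⟩ : ∃ c, IsCol (del R v) c := by
        refine ih _ ?_ (h.mono fun _ _ h => h.1) rfl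
        rcases ha with h1 | h1
        · exact size_lt (fun _ _ h => h.1) h1 fun h2 => h2.2.1 rfl
        · exact size_lt (fun _ _ h => h.1) h1 fun h2 => h2.2.2 rfl
      have mixed : (R a v ∧ R v b) ∨ (R v a ∧ R b v) → ∃ c, IsCol R c := by
        intro hm
        by_cases hab : R a b ∨ R b a
        · have hav : a ≠ v := by rintro rfl; rcases ha with h1 | h1 <;> exact h.irrefl _ h1
          have hbv : b ≠ v := by rintro rfl; rcases hb with h1 | h1 <;> exact h.irrefl _ h1
          refine h.finish hm hnb hc ?_
          rcases hab with h1 | h1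
          · exact adj_ne (hc.1 _) (hc.1 _) (hc.2 _ _ ⟨h1, hav, hbv⟩)
          · exact (adj_ne (hc.1 _) (hc.1 _) (hc.2 _ _ ⟨h1, hbv, hav⟩)).symm
        · push Not at hab
          exact Ctx.colourable (v := v) (a := a) (b := b)
            ⟨h, hm, hnb, hab.1, hab.2, fun R' hR' hs => ih _ hs hR' rfl⟩
      rcases ha with ha | ha <;> rcases hb with hb | hb
      · obtain ⟨α, hα, h1, h2⟩ := exists_common' _ (hc.1 a) _ (hc.1 b)
        obtain ⟨c', hc', -⟩ := IsCol.extend h.irrefl hc hα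
          (by intro w hw; rcases hnb w (Or.inl hw) with rfl | rfl; exacts [h1, h2])
          (by
            intro w hw
            rcases hnb w (Or.inr hw) with rfl | rfl
            exacts [absurd hw (h.asymm _ _ ha), absurd hw (h.asymm _ _ hb)])
        exact ⟨c', hc'⟩
      · exact mixed (Or.inr ⟨ha, hb⟩)
      · exact mixed (Or.inl ⟨ha, hb⟩)
      · obtain ⟨α, hα, h1, h2⟩ := exists_common _ (hc.1 a) _ (hc.1 b)
        obtain ⟨c', hc', -⟩ := IsCol.extend h.irrefl hc hα
          (by
            intro w hw
            rcases hnb w (Or.inl hw) with rfl | rfl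
            exacts [absurd hw (h.asymm _ _ ha), absurd hw (h.asymm _ _ hb)])
          (by intro w hw; rcases hnb w (Or.inr hw) with rfl | rfl; exacts [h1, h2])
        exact ⟨c', hc'⟩
    · refine ⟨fun _ => 0, fun _ => by norm_num, fun u w huw => ?_⟩
      exact absurd ⟨u, Finset.mem_filter.2 ⟨Finset.mem_univ _, w, mem_nb.2 (Or.inl huw)⟩⟩ hU

end

/-! ### Two additional colours -/

section

variable {V : Type*}

/-- An oriented colouring with nine colours, in terms of natural numbers. -/
def IsCol9 (R : V → V → Prop) (c : V → ℕ) : Prop :=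
  (∀ u, c u < 9) ∧ (∀ u w, R u w → c u ≠ c w) ∧
    ∀ u v x y, R u v → R x y → c u = c y → c v ≠ c x

/-- Give the ends of one arc two new colours.  The neighbours of an end `p` keep colours that are
consistent with the direction of their arcs, as `p` itself has a colour in the tournament. -/
theorem IsCol9.of_arc {R : V → V → Prop} (hR : ∀ u w, R u w → ¬ R w u) {p q : V} (hpq : R p q)
    {c : V → ℕ} (hc : IsCol (fun u w => R u w ∧ ¬ (u = p ∧ w = q)) c) : ∃ c, IsCol9 R c := by
  classical
  have hne : p ≠ q := by rintro rfl; exact hR _ _ hpq hpq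
  have irr : ∀ u w, R u w → u ≠ w := by rintro u w huw rfl; exact hR _ _ huw huw
  let d : V → ℕ := fun u => if u = p then 7 else if u = q then 8 else c u
  have dp : ∀ u, d u = 7 ↔ u = p := by
    intro u
    have := hc.1 u
    simp only [d]
    split_ifs with h1 h2
    · simp [h1]
    · simp [h1]
    · simp only [h1, iff_false]; omega
  have dq : ∀ u, d u = 8 ↔ u = q := by
    intro u
    have := hc.1 u
    simp only [d]
    split_ifs with h1 h2
    · simp [h1, hne]
    · simp [h2]
    · simp only [h2, iff_false]; omega
  have dc : ∀ u, u ≠ p → u ≠ q → d u = c u := fun u h1 h2 => by simp only [d, h1, h2, if_false]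
  -- the ends of a path of two arcs get different colours
  have path : ∀ u m w, R u m → R m w → d u ≠ d w := by
    intro u m w hum hmw huw
    have huw' : u ≠ w := by rintro rfl; exact hR _ _ hum hmw
    have hup : u ≠ p := by
      rintro rfl
      exact huw' ((dp w).1 (huw ▸ (dp u).2 rfl)).symm
    have huq : u ≠ q := by
      rintro rfl
      exact huw' ((dq w).1 (huw ▸ (dq u).2 rfl)).symm
    have hwp : w ≠ p := by
      rintro rfl
      exact huw' ((dp u).1 (huw ▸ (dp w).2 rfl))
    have hwq : w ≠ q := by
      rintro rfl
      exact huw' ((dq u).1 (huw ▸ (dq w).2 rfl))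
    rw [dc u hup huq, dc w hwp hwq] at huw
    exact ne_of_path (hc.1 u) (hc.1 m) (hc.2 u m ⟨hum, fun h => hup h.1⟩)
      (hc.2 m w ⟨hmw, fun h => hwq h.2⟩) huw.symm
  refine ⟨d, fun u => ?_, fun u w huw => ?_, fun u v x y huv hxy h1 h2 => ?_⟩
  · have := hc.1 u
    simp only [d]
    split_ifs <;> omega
  · intro h
    by_cases hup : u = p
    · exact irr _ _ huw (hup.trans ((dp w).1 (h ▸ (dp u).2 hup)).symm)
    · by_cases huq : u = q
      · exact irr _ _ huw (huq.trans ((dq w).1 (h ▸ (dq u).2 huq)).symm)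
      · have hwp : w ≠ p := fun e => hup ((dp u).1 (h.trans ((dp w).2 e)))
        have hwq : w ≠ q := fun e => huq ((dq u).1 (h.trans ((dq w).2 e)))
        rw [dc u hup huq, dc w hwp hwq] at h
        exact adj_ne (hc.1 u) (hc.1 w) (hc.2 u w ⟨huw, fun e => hup e.1⟩) h
  · have huy : ∀ s, (s = p ∨ s = q) → u ≠ s := by
      rintro s hs rfl
      have : y = u := by
        rcases hs with rfl | rfl
        exacts [(dp y).1 (h1 ▸ (dp _).2 rfl), (dq y).1 (h1 ▸ (dq _).2 rfl)]
      subst this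
      exact path x y v hxy huv h2.symm
    have hvx : ∀ s, (s = p ∨ s = q) → v ≠ s := by
      rintro s hs rfl
      have : x = v := by
        rcases hs with rfl | rfl
        exacts [(dp x).1 (h2 ▸ (dp _).2 rfl), (dq x).1 (h2 ▸ (dq _).2 rfl)]
      subst this
      exact path u x y huv hxy h1
    have hup := huy p (Or.inl rfl)
    have huq := huy q (Or.inr rfl)
    have hvp := hvx p (Or.inl rfl)
    have hvq := hvx q (Or.inr rfl)
    have hyp : y ≠ p := fun e => hup ((dp u).1 (h1.trans ((dp y).2 e)))
    have hyq : y ≠ q := fun e => huq ((dq u).1 (h1.trans ((dq y).2 e)))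
    have hxp : x ≠ p := fun e => hvp ((dp v).1 (h2.trans ((dp x).2 e)))
    have hxq : x ≠ q := fun e => hvq ((dq v).1 (h2.trans ((dq x).2 e)))
    rw [dc u hup huq, dc y hyp hyq] at h1
    rw [dc v hvp hvq, dc x hxp hxq] at h2
    have a1 := hc.2 u v ⟨huv, fun h => hup h.1⟩
    have a2 := hc.2 x y ⟨hxy, fun h => hxp h.1⟩
    rw [h1, h2] at a1
    exact absurd (adj_asymm _ (hc.1 y) _ (hc.1 x) a1) (by simp [a2])

variable [Fintype V]

/-- A source of degree three. -/
def Src (R : V → V → Prop) (u : V) : Prop := (nb R u).card = 3 ∧ ∀ w, ¬ R w u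

/-- A sink of degree three. -/
def Snk (R : V → V → Prop) (u : V) : Prop := (nb R u).card = 3 ∧ ∀ w, ¬ R u w

theorem pats_src_snk : ∀ S ∈ pats, (1, 4) ∈ S.arcs ∧ ∀ i ∈ [1, 4], (nbrs S.arcs i).Nodup ∧
    (nbrs S.arcs i).length = 3 ∧ (∀ j ∈ nbrs S.arcs i, (j ∈ 6 :: 7 :: S.ord ∧ j ≠ 0) ∧
      if i = 1 then (1, j) ∈ S.arcs else (j, 4) ∈ S.arcs) ∧
    ∀ j ∈ nbrs S.arcs i, ∀ k ∈ nbrs S.arcs i, j ≠ k → j ∈ S.ord ∨ k ∈ S.ord := by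
  decide +kernel

/-- Every excluded configuration contains an arc from a source of degree three to a sink of degree
three. -/
theorem Occ.src_snk {R : V → V → Prop} (hR : ∀ u w, R u w → ¬ R w u)
    (hdeg : ∀ u, (nb R u).card ≤ 3) {S : Pat} (hS : S ∈ pats) {φ : ℕ → V} (h : Occ R S φ) :
    (1, 4) ∈ S.arcs ∧ Src R (φ 1) ∧ Snk R (φ 4) := by
  obtain ⟨h14, hi⟩ := pats_src_snk S hS
  have main : ∀ i ∈ [1, 4], ((nbrs S.arcs i).map φ).Nodup ∧
      ∀ w, R (φ i) w ∨ R w (φ i) → w ∈ (nbrs S.arcs i).map φ := by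
    intro i hi'
    obtain ⟨h1, h2, h3, h4⟩ := hi i hi'
    have hnd : ((nbrs S.arcs i).map φ).Nodup := by
      refine nodup_map_of h1 fun j hj k hk hjk => ?_
      rcases h4 j hj k hk hjk with h5 | h5
      · exact h.inj j h5 (h3 j hj).1.2 k (h3 k hk).1.1 (h3 k hk).1.2 hjk
      · exact (h.inj k h5 (h3 k hk).1.2 j (h3 j hj).1.1 (h3 j hj).1.2 hjk.symm).symm
    refine ⟨hnd, fun w hw => mem_of_nb_le hnd ?_ (by simpa [h2] using hdeg (φ i)) hw⟩
    intro w hw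
    obtain ⟨j, hj, rfl⟩ := List.mem_map.1 hw
    exact (mem_nbrs hj).imp (h.arcs _) (h.arcs _)
  have card : ∀ i ∈ [1, 4], (nb R (φ i)).card = 3 := by
    intro i hi'
    refine le_antisymm (hdeg _) ?_
    have := length_le_nb (R := R) (u := φ i) (main i hi').1 (by
      intro w hw
      obtain ⟨j, hj, rfl⟩ := List.mem_map.1 hw
      exact (mem_nbrs hj).imp (h.arcs _) (h.arcs _))
    rwa [List.length_map, (hi i hi').2.1] at this
  refine ⟨h14, ⟨card 1 (by simp), fun w hw => ?_⟩, card 4 (by simp), fun w hw => ?_⟩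
  · obtain ⟨j, hj, rfl⟩ := List.mem_map.1 ((main 1 (by simp)).2 w (Or.inr hw))
    have := ((hi 1 (by simp)).2.2.1 j hj).2
    rw [if_pos rfl] at this
    exact hR _ _ (h.arcs _ this) hw
  · obtain ⟨j, hj, rfl⟩ := List.mem_map.1 ((main 4 (by simp)).2 w (Or.inl hw))
    have := ((hi 4 (by simp)).2.2.1 j hj).2
    rw [if_neg (by simp)] at this
    exact hR _ _ (h.arcs _ this) hw

/-- A subgraph of a connected subcubic graph belongs to the inductive class if it avoids the
excluded configurations and is proper, or if the whole graph is not cubic. -/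
theorem Good.of_connected {R R' : V → V → Prop} (hR : ∀ u w, R u w → ¬ R w u)
    (hdeg : ∀ u, (nb R u).card ≤ 3) (hsub : ∀ u w, R' u w → R u w)
    (hconn : ∀ U : Finset V, U.Nonempty → (∀ u ∈ U, ∀ w ∈ nb R u, w ∈ U) → ∀ u, u ∈ U)
    (hprop : (∃ u, (nb R u).card ≤ 2) ∨ ∃ u w, R u w ∧ ¬ R' u w)
    (hfree : ∀ u w, Src R u → Snk R w → ¬ R' u w) : Good R' where
  asymm u w h1 h2 := hR _ _ (hsub _ _ h1) (hsub _ _ h2)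
  deg u := (Finset.card_le_card (nb_mono hsub u)).trans (hdeg u)
  proper U hU := by
    classical
    by_contra hn
    push Not at hn
    have hdeg' : ∀ u, (nb R' u).card ≤ 3 := fun u =>
      (Finset.card_le_card (nb_mono hsub u)).trans (hdeg u)
    have key : ∀ u ∈ U, nb R' u = nb R u ∧ nb R u ⊆ U ∧ 3 ≤ (nb R u).card := by
      intro u hu
      have h3 : 3 ≤ (nb R' u ∩ U).card := Nat.succ_le_of_lt (by convert hn u hu)
      have h4 := Finset.card_le_card (Finset.inter_subset_left (s₁ := nb R' u) (s₂ := U))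
      have h5 : nb R' u = nb R u := Finset.eq_of_subset_of_card_le (nb_mono hsub u)
        ((hdeg u).trans (h3.trans h4))
      refine ⟨h5, ?_, by rw [← h5]; exact h3.trans h4⟩
      rw [← h5]
      exact Finset.inter_eq_left.1 (Finset.eq_of_subset_of_card_le Finset.inter_subset_left
        ((hdeg' u).trans h3))
    have hall := hconn U hU fun u hu w hw => (key u hu).2.1 hw
    rcases hprop with ⟨u, hu⟩ | ⟨u, w, huw, hn'⟩
    · have := (key u (hall u)).2.2
      omega
    · have : w ∈ nb R' u := by
        rw [(key u (hall u)).1]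
        exact mem_nb.2 (Or.inl huw)
      rcases mem_nb.1 this with h1 | h1
      · exact hn' h1
      · exact hR _ _ huw (hsub _ _ h1)
  free S hS φ hφ := by
    obtain ⟨h14, h1, h4⟩ := Occ.src_snk hR hdeg hS (φ := φ)
      ⟨fun p hp => hsub _ _ (hφ.arcs p hp), hφ.inj⟩
    exact hfree _ _ h1 h4 (hφ.arcs _ h14)

/-- Give the sources and sinks of degree three two new colours. -/
theorem IsCol9.of_src_snk {R : V → V → Prop} {c : V → ℕ}
    (hc : IsCol (fun u w => R u w ∧ ¬ (Src R u ∧ Snk R w)) c) : ∃ c, IsCol9 R c := by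
  classical
  refine ⟨fun u => if Src R u then 7 else if Snk R u then 8 else c u, fun u => ?_,
    fun u w huw => ?_, fun u v x y huv hxy h1 h2 => ?_⟩
  · have := hc.1 u
    dsimp only
    split_ifs <;> omega
  · have hu : ¬ Snk R u := fun h => h.2 _ huw
    have hw : ¬ Src R w := fun h => h.2 _ huw
    have c1 := hc.1 u
    have c2 := hc.1 w
    by_cases hu' : Src R u <;> by_cases hw' : Snk R w <;>
      simp only [hu, hw, hu', hw', if_true, if_false]
    · omega
    · omega
    · omega
    · exact adj_ne c1 c2 (hc.2 _ _ ⟨huw, fun h => hu' h.1⟩)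
  · have hu : ¬ Snk R u := fun h => h.2 _ huv
    have hv : ¬ Src R v := fun h => h.2 _ huv
    have hx : ¬ Snk R x := fun h => h.2 _ hxy
    have hy : ¬ Src R y := fun h => h.2 _ hxy
    have c1 := hc.1 u
    have c2 := hc.1 v
    have c3 := hc.1 x
    have c4 := hc.1 y
    simp only [hu, hv, hx, hy, if_false] at h1 h2
    have hu' : ¬ Src R u := by
      intro h
      rw [if_pos h] at h1
      split_ifs at h1 <;> omega
    have hx' : ¬ Src R x := by
      intro h
      rw [if_pos h] at h2
      split_ifs at h2 <;> omega
    have hy' : ¬ Snk R y := by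
      intro h
      rw [if_pos h, if_neg hu'] at h1
      omega
    have hv' : ¬ Snk R v := by
      intro h
      rw [if_pos h, if_neg hx'] at h2
      omega
    rw [if_neg hu', if_neg hy'] at h1
    rw [if_neg hv', if_neg hx'] at h2
    have a1 := hc.2 u v ⟨huv, fun h => hu' h.1⟩
    have a2 := hc.2 x y ⟨hxy, fun h => hx' h.1⟩
    rw [h1, h2] at a1
    exact absurd (adj_asymm _ c4 _ c3 a1) (by simp [a2])

/-- A connected oriented graph of maximum degree three has an oriented colouring with nine
colours. -/
theorem exists_isCol9 [Nonempty V] {R : V → V → Prop} (hR : ∀ u w, R u w → ¬ R w u)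
    (hdeg : ∀ u, (nb R u).card ≤ 3)
    (hconn : ∀ U : Finset V, U.Nonempty → (∀ u ∈ U, ∀ w ∈ nb R u, w ∈ U) → ∀ u, u ∈ U) :
    ∃ c, IsCol9 R c := by
  by_cases h : (∃ u, (nb R u).card ≤ 2) ∨ ∃ u w, R u w ∧ Src R u ∧ Snk R w
  · obtain ⟨c, hc⟩ := (Good.of_connected (R' := fun u w => R u w ∧ ¬ (Src R u ∧ Snk R w)) hR hdeg
      (fun _ _ h => h.1) hconn (h.imp_right fun ⟨u, w, huw, h⟩ => ⟨u, w, huw, fun h' => h'.2 h⟩)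
      (fun u w h1 h2 h3 => h3.2 ⟨h1, h2⟩)).colourable
    exact IsCol9.of_src_snk hc
  · push Not at h
    obtain ⟨p, q, hpq⟩ : ∃ p q, R p q := by
      obtain ⟨u⟩ := ‹Nonempty V›
      obtain ⟨w, hw⟩ := Finset.card_pos.1 (lt_trans (by norm_num) (h.1 u))
      rcases mem_nb.1 hw with h1 | h1
      exacts [⟨_, _, h1⟩, ⟨_, _, h1⟩]
    obtain ⟨c, hc⟩ := (Good.of_connected (R' := fun u w => R u w ∧ ¬ (u = p ∧ w = q)) hR hdeg
      (fun _ _ h => h.1) hconn (Or.inr ⟨p, q, hpq, fun h => h.2 ⟨rfl, rfl⟩⟩)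
      (fun u w h1 h2 h3 => h.2 u w h3.1 h1 h2)).colourable
    exact IsCol9.of_arc hR hpq hc

end

end OrientedCubic

theorem mainTheorem1 {V : Type*} [Fintype V] (H : SimpleGraph V) [DecidableRel H.Adj]
    (hconn : H.Connected) (hdeg : H.maxDegree ≤ 3)
    (G : Digraph V) (hG : G.IsOrientationOf H) :
    G.orientedChromaticNumber ≤ 9 := by
  have hne : Nonempty V := hconn.nonempty
  have hnb : ∀ u, OrientedCubic.nb G.Adj u = H.neighborFinset u := by
    intro u
    ext w
    rw [OrientedCubic.mem_nb, SimpleGraph.mem_neighborFinset, hG.adj_iff]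
  obtain ⟨c, h9, h1, h2⟩ := OrientedCubic.exists_isCol9 (R := G.Adj) hG.asymm
    (fun u => by
      rw [hnb, SimpleGraph.card_neighborFinset_eq_degree]
      exact (H.degree_le_maxDegree u).trans hdeg)
    (fun U ⟨u, hu⟩ hU w => by
      obtain ⟨p⟩ := hconn.preconnected u w
      induction p with
      | nil => exact hu
      | cons h p ih => exact ih (hU _ hu _ (by rw [hnb]; simpa using h)))
  have hcol : G.OrientedColourable 9 := by
    refine ⟨fun u => ⟨c u, h9 u⟩, fun u v huv h => h1 u v huv (by simpa using h),
      fun u v x y huv hxy h h' => h2 u v x y huv hxy (by simpa using h) (by simpa using h')⟩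
  exact iInf₂_le_of_le 9 hcol le_rfl
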